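/- Identify $S^2=\mathbb{C}\cup\{\infty\}$. Every holomorphic map $f:S^2\to\mathbb{C}P^3$ can be written $f=[F]=[F_0,F_1,F_2,F_3]$ with $F_i$ coprime polynomials; its degree $d$ is $\max_i\deg F_i$. The space $\mathrm{Hol}_d(S^2,\mathbb{C}P^3)$ of holomorphic maps of degree $d$ is a complex manifold, being identified by $f\mapsto[F]$ with an open subset of the projective space $P(\mathbb{C}[z]_d^4)$ of quadruplets of polynomials of degree $\le d$. The map $f$ is full if its image lies in no projective plane $\mathbb{C}P^2\subset\mathbb{C}P^3$. A tangent vector $dp_W(V)$ at $[W]$, where $p:\mathbb{C}^4\setminus\{0\}\to\mathbb{C}P^3$ is the projection, is horizontal if $V_1W_0-V_0W_1+V_3W_2-V_2W_3=0$, i.e. if $V$ is Hermitian orthogonal to $\mathrm{j}W=(-\overline W_1,\overline W_0,-\overline W_3,\overline W_2)$; the vertical tangent vectors are those orthogonal, for the Fubini–Study metric, to all horizontal ones. A map is horizontal if its differential has horizontal image. Let $\mathrm{HHol}_d$ be the set of horizontal maps in $\mathrm{Hol}_d(S^2,\mathbb{C}P^3)$, and $\mathrm{HHol}_d^{\mathrm{full}}$,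 $\mathrm{HHol}_d^{\mathrm{non}}$ its subsets of full and of non-full maps. A point $f\in\mathrm{HHol}_d$ is a smooth point if, near $f$, $\mathrm{HHol}_d$ is a complex submanifold of $\mathrm{Hol}_d(S^2,\mathbb{C}P^3)$. A map $f\in\mathrm{HHol}_d^{\mathrm{non}}$ is a collapse point if it lies in the closure of $\mathrm{HHol}_d^{\mathrm{full}}$. An infinitesimal horizontal holomorphic deformation (IHHD) of $f\in\mathrm{HHol}_d$ is a holomorphic vector field $u$ along $f$ (a holomorphic section of $f^{-1}T'\mathbb{C}P^3$) such that for every smooth variation $\{f_t\}$ of $f$ with $\partial f_t/\partial t|_{t=0}=u$ the norm of the vertical component of $df_t$ is $o(t)$. It is integrable by horizontal holomorphic maps if $u=\partial f_t/\partial t|_{t=0}$ for some smooth one-parameter family $f_t\in\mathrm{HHol}_d$, $|t|<\varepsilon$, with $f_0=f$. For $f\in\mathrm{HHol}_d^{\mathrm{non}}$ there is a unitary matrix $A$ in the symplectic group $\mathrm{Sp}(2)$ such that $A\circ f=[F_0,0,F_2,0]$; writing locally $A_*u=dp_F(U)$ with $F=(F_0,0,F_2,0)$, an IHHD $u$ of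 $f$ is called extra if $(U_1,U_3)$ is not in the complex linear span of $(F_0,0)$, $(0,F_2)$ and $(F_2,F_0)$. **Proposition 3.5.** Let $f:S^2\to\mathbb{C}P^3$ be a non-full horizontal holomorphic map, of degree $d$. Then the following are equivalent: (i) $f$ is a non-smooth point of $\mathrm{HHol}_d(S^2,\mathbb{C}P^3)$; (ii) $f$ is a collapse point; (iii) $f$ has an extra IHHD; (iv) $f$ has an extra IHHD which is not integrable by horizontal holomorphic maps; (v) $f$ has an extra IHHD which is integrable by horizontal holomorphic maps. -/

import Mathlib

open scoped ContDiff Topology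

noncomputable section

namespace Twistor

/-! ### The sphere, projective space, and holomorphic maps -/

/-- The vector space `ℂ⁴`. -/
abbrev C4 : Type := Fin 4 → ℂ

/-- The Riemann sphere `S² = ℂ ∪ {∞}`. -/
abbrev S2 : Type := OnePoint ℂ

/-- Complex projective `3`-space. -/
abbrev CP3 : Type := Projectivization ℂ C4

/-- The inverses `ℂ → S²` of the two standard holomorphic charts of the Riemann sphere:
`z ↦ z` and `w ↦ 1 / w` (with `0 ↦ ∞`). -/
def chart : Bool → ℂ → S2
  | false, z => (z : S2)
  | true, w => if w = 0 then OnePoint.infty else ((w⁻¹ : ℂ) : S2)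

/-- `p = [W]`: the vector `W` is non-zero and spans the line `p`. -/
def IsRep (p : CP3) (W : C4) : Prop := ∃ h : W ≠ 0, Projectivization.mk ℂ W h = p

/-- `F` is a lift, near `z`, of `f` read in the chart `c`. -/
def IsLift (f : S2 → CP3) (c : Bool) (F : ℂ → C4) (z : ℂ) : Prop :=
  ∀ᶠ ζ in 𝓝 z, IsRep (f (chart c ζ)) (F ζ)

/-- A map `S² → ℂP³` is holomorphic if it has holomorphic local lifts to `ℂ⁴ ∖ {0}`. -/
def IsHolomorphic (f : S2 → CP3) : Prop :=
  ∀ (c : Bool) (z : ℂ), ∃ F : ℂ → C4, AnalyticAt ℂ F z ∧ IsLift f c F z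

/-- A map is full if its image lies in no projective plane `ℂP² ⊂ ℂP³`. -/
def IsFull (f : S2 → CP3) : Prop :=
  ¬ ∃ l : C4 →ₗ[ℂ] ℂ, l ≠ 0 ∧ ∀ x, ∀ W ∈ (f x).submodule, l W = 0

/-! ### Horizontality -/

/-- The matrix of the complex symplectic form; `J0 W` is the complex conjugate of `j W`,
`j` being multiplication by the quaternion `j` on `ℍ² = ℂ⁴`. -/
def J0 : Matrix (Fin 4) (Fin 4) ℂ :=
  !![0, -1, 0, 0; 1, 0, 0, 0; 0, 0, 0, -1; 0, 0, 1, 0]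

/-- The symplectic form `⟨V, J₀ W⟩ᶜ`, which is the Hermitian product of `V` with `j W`. -/
def symp (V W : C4) : ℂ := V ⬝ᵥ (J0.mulVec W)

/-- The Fubini–Study norm of the vertical component of the tangent vector `dp_W(V)` at `[W]`.
The vertical space at `[W]` is `Hom(W, span (j W))`, and `j W` is Hermitian orthogonal to `W` and
has the same length, so that this is the length of the orthogonal projection of `V` to
`span (j W)`, divided by the length of `W`. -/
def verticalNorm (W V : C4) : ℝ := ‖symp V W‖ / ∑ i, ‖W i‖ ^ 2

/-- A smooth map is horizontal if the image of its differential is contained in the horizontal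
subbundle, the orthogonal complement of the vertical one. -/
def IsHorizontal (f : S2 → CP3) : Prop :=
  ∀ (c : Bool) (z : ℂ) (F : ℂ → C4), ContDiffAt ℝ ∞ F z → IsLift f c F z →
    ∀ X : ℂ, symp (fderiv ℝ F z X) (F z) = 0

/-- The compact symplectic group `Sp(2)`: the unitary matrices that preserve `J0`. -/
def Sp2 : Set (Matrix (Fin 4) (Fin 4) ℂ) :=
  {A | A ∈ Matrix.unitaryGroup (Fin 4) ℂ ∧ A.transpose * J0 * A = J0}

/-! ### Polynomial representation, degree, and the spaces of maps of degree `d` -/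

/-- Quadruplets of polynomials of degree at most `d`, given by their coefficients:
`a i k` is the coefficient of `z ^ k` in the `i`-th polynomial. -/
abbrev Coef (d : ℕ) : Type := Fin 4 → Fin (d + 1) → ℂ

/-- The value at `z` of a quadruplet of polynomials. -/
def evalC {d : ℕ} (a : Coef d) (z : ℂ) : C4 := fun i => ∑ k : Fin (d + 1), a i k * z ^ (k : ℕ)

/-- The coefficients of `z ^ d`. -/
def topC {d : ℕ} (a : Coef d) : C4 := fun i => a i (Fin.last d)

/-- The quadruplets of polynomials that are coprime (have no common zero in `ℂ`) and of maximum
degree exactly `d`. -/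
def V (d : ℕ) : Set (Coef d) := {a | (∀ z, evalC a z ≠ 0) ∧ topC a ≠ 0}

/-- The map `z ↦ [F₀(z), F₁(z), F₂(z), F₃(z)]` of `S²` into `ℂP³`, where the value at `∞` is the
limit, given by the coefficients of `z ^ d`. -/
def polyMap {d : ℕ} (a : V d) : S2 → CP3 := fun x =>
  OnePoint.elim x (Projectivization.mk ℂ (topC a.1) a.2.2)
    (fun z => Projectivization.mk ℂ (evalC a.1 z) (a.2.1 z))

theorem polyMap_isHolomorphic {d : ℕ} (a : V d) : IsHolomorphic (polyMap a) := by
  intro c z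
  cases c with
  | false =>
    refine ⟨evalC a.1, ?_, Filter.Eventually.of_forall fun ζ => ⟨a.2.1 ζ, rfl⟩⟩
    rw [analyticAt_pi_iff]
    intro i
    unfold evalC
    fun_prop
  | true =>
    have key : ∀ w : ℂ, w ≠ 0 →
        (fun i => ∑ k : Fin (d + 1), a.1 i k * w ^ (d - (k : ℕ))) = w ^ d • evalC a.1 w⁻¹ := by
      intro w hw
      funext i
      simp only [evalC, Pi.smul_apply, smul_eq_mul, Finset.mul_sum]
      refine Finset.sum_congr rfl fun k _ => ?_
      have hk : (k : ℕ) ≤ d := Nat.lt_succ_iff.mp k.2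
      rw [pow_sub₀ _ hw hk, inv_pow]
      ring
    have key0 : (fun i => ∑ k : Fin (d + 1), a.1 i k * (0 : ℂ) ^ (d - (k : ℕ))) = topC a.1 := by
      funext i
      rw [Finset.sum_eq_single (Fin.last d)]
      · simp [topC]
      · intro k _ hk
        have : (k : ℕ) < d := lt_of_le_of_ne (Nat.lt_succ_iff.mp k.2)
          (fun h => hk (Fin.ext h))
        rw [zero_pow (by omega), mul_zero]
      · simp
    refine ⟨fun w i => ∑ k : Fin (d + 1), a.1 i k * w ^ (d - (k : ℕ)), ?_,
      Filter.Eventually.of_forall fun w => ?_⟩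
    · rw [analyticAt_pi_iff]
      intro i
      fun_prop
    · by_cases hw : w = 0
      · subst hw
        beta_reduce
        rw [key0]
        exact ⟨a.2.2, by simp [chart, polyMap]⟩
      · beta_reduce
        rw [key w hw]
        refine ⟨smul_ne_zero (pow_ne_zero _ hw) (a.2.1 _), ?_⟩
        simp only [chart, hw, if_false, polyMap, OnePoint.elim_some]
        rw [Projectivization.mk_eq_mk_iff']
        exact ⟨w ^ d, rfl⟩

/-- The space `Hol_d(S², ℂP³)` of holomorphic maps of degree `d`; the degree of a holomorphic map
is the maximum degree of the coprime polynomials that represent it. -/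
structure Hol (d : ℕ) where
  /-- the underlying map -/
  toFun : S2 → CP3
  holomorphic : IsHolomorphic toFun
  degree : ∃ a : V d, polyMap a = toFun

/-- The projection from coprime quadruplets of polynomials to `Hol_d(S², ℂP³)`; it identifies
`Hol_d(S², ℂP³)` with an open subset of the projective space of `Coef d`. -/
def proj {d : ℕ} (a : V d) : Hol d := ⟨polyMap a, polyMap_isHolomorphic a, a, rfl⟩

/-- The topology of `Hol_d(S², ℂP³)`, as a subspace of the projective space of `Coef d`. -/
instance (d : ℕ) : TopologicalSpace (Hol d) := TopologicalSpace.coinduced proj inferInstance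

/-- The space `HHol_d(S², ℂP³)` of horizontal holomorphic maps of degree `d`. -/
def HHol (d : ℕ) : Set (Hol d) := {f | IsHorizontal f.toFun}

/-- The full horizontal holomorphic maps of degree `d`. -/
def HHolFull (d : ℕ) : Set (Hol d) := {f | f ∈ HHol d ∧ IsFull f.toFun}

/-- The non-full horizontal holomorphic maps of degree `d`. -/
def HHolNon (d : ℕ) : Set (Hol d) := {f | f ∈ HHol d ∧ ¬ IsFull f.toFun}

/-- A function on `Hol_d` read in homogeneous coordinates (extended by zero outside the open
set `V d`). -/
def pullback {d n : ℕ} (g : Hol d → Fin n → ℂ) : Coef d → Fin n → ℂ := by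
  classical exact fun a => if h : a ∈ V d then g (proj ⟨a, h⟩) else 0

/-- `f` is a smooth point of the subset `S` of the complex manifold `Hol_d`: near `f`, the set `S`
is a complex submanifold, i.e. the zero set of a holomorphic submersion `g` to some `ℂⁿ`.
As `proj` is a holomorphic submersion, `g` is holomorphic near `f` or submersive at `f` if and only
if it has that property when read in homogeneous coordinates. -/
def IsSmoothPoint {d : ℕ} (S : Set (Hol d)) (f : Hol d) : Prop :=
  f ∈ S ∧ ∃ a : V d, proj a = f ∧ ∃ (n : ℕ) (g : Hol d → Fin n → ℂ),
    AnalyticAt ℂ (pullback g) a.1 ∧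
    Function.Surjective (fderiv ℂ (pullback g) a.1) ∧
    ∀ᶠ h in 𝓝 f, (h ∈ S ↔ g h = 0)

/-- A collapse point: a non-full horizontal holomorphic map in the closure of the full ones. -/
def IsCollapsePoint {d : ℕ} (f : Hol d) : Prop := f ∈ closure (HHolFull d) ∩ HHolNon d

/-! ### Vector fields and variations -/

/-- Vector fields along `f`: sections of the bundle with fibre the holomorphic tangent space
`T'_{f(x)} ℂP³ = Hom(f(x), ℂ⁴ / f(x))` at `x`. -/
abbrev VectorField (f : S2 → CP3) : Type :=
  (x : S2) → ((f x).submodule →ₗ[ℂ] (C4 ⧸ (f x).submodule))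

/-- `τ = dp_W(U)`: the point `p` is `[W]`, and the tangent vector `τ` at `p` is the linear map
that sends `W` to `U` modulo `p`. -/
def IsDp (p : CP3) (τ : p.submodule →ₗ[ℂ] (C4 ⧸ p.submodule)) (W U : C4) : Prop :=
  W ≠ 0 ∧ ∃ h : W ∈ p.submodule, τ ⟨W, h⟩ = Submodule.Quotient.mk U

/-- A vector field along `f` is holomorphic if it is locally `dp_F(U)` with `F` and `U`
holomorphic. -/
def IsHolomorphicField (f : S2 → CP3) (u : VectorField f) : Prop :=
  ∀ (c : Bool) (z : ℂ), ∃ F U : ℂ → C4, AnalyticAt ℂ F z ∧ AnalyticAt ℂ U z ∧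
    ∀ᶠ ζ in 𝓝 z, IsDp (f (chart c ζ)) (u (chart c ζ)) (F ζ) (U ζ)

/-- `F` is a smooth lift near `(t, z)` of the family `φ` of maps, read in the chart `c`. -/
def IsSmoothLift (φ : ℝ → S2 → CP3) (c : Bool) (F : ℝ × ℂ → C4) (t : ℝ) (z : ℂ) : Prop :=
  ContDiffAt ℝ ∞ F (t, z) ∧ ∀ᶠ q in 𝓝 (t, z), IsRep (φ q.1 (chart c q.2)) (F q)

/-- `φ` is a smooth one-parameter variation `{φ_t}`, `|t| < ε`, of `f`; smoothness of
`(x, t) ↦ φ_t(x)` is expressed through smooth local lifts. -/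
def IsVariation (f : S2 → CP3) (φ : ℝ → S2 → CP3) (ε : ℝ) : Prop :=
  0 < ε ∧ φ 0 = f ∧
    ∀ t : ℝ, |t| < ε → ∀ (c : Bool) (z : ℂ), ∃ F, IsSmoothLift φ c F t z

/-- The vector field `u` along `f` is tangent to the variation `φ` of `f`:
`∂φ_t/∂t = u` at `t = 0`. -/
def IsTangentTo (f : S2 → CP3) (u : VectorField f) (φ : ℝ → S2 → CP3) : Prop :=
  ∀ (c : Bool) (z : ℂ) (F : ℝ × ℂ → C4), IsSmoothLift φ c F 0 z →
    IsDp (f (chart c z)) (u (chart c z)) (F (0, z)) (deriv (fun t => F (t, z)) 0)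

/-- `u` preserves horizontality to first order: for any smooth variation of `f` tangent to `u`,
the norm of the vertical component of `dφ_t` is `o(t)`. -/
def IsInfHorizontal (f : S2 → CP3) (u : VectorField f) : Prop :=
  ∀ (φ : ℝ → S2 → CP3) (ε : ℝ), IsVariation f φ ε → IsTangentTo f u φ →
    ∀ (c : Bool) (z : ℂ) (F : ℝ × ℂ → C4), IsSmoothLift φ c F 0 z → ∀ X : ℂ,
      (fun t : ℝ => verticalNorm (F (t, z)) (fderiv ℝ (fun ζ => F (t, ζ)) z X))
        =o[𝓝 0] (fun t : ℝ => t)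

/-- Infinitesimal horizontal holomorphic deformations of the horizontal holomorphic map `f`. -/
def IsIHHD {d : ℕ} (f : Hol d) (u : VectorField f.toFun) : Prop :=
  f ∈ HHol d ∧ IsHolomorphicField f.toFun u ∧ IsInfHorizontal f.toFun u

/-- `u` is extra: after a transformation `A ∈ Sp(2)` that moves the image of `f` into
`ℂP¹₀ = {[z₀, 0, z₂, 0]}`, so that `A f = [F₀, 0, F₂, 0]`, the normal component `(U₁, U₃)` of `u` is
not in the span of `(F₀, 0)`, `(0, F₂)` and `(F₂, F₀)`. -/
def IsExtra (f : S2 → CP3) (u : VectorField f) : Prop :=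
  ∃ A ∈ Sp2,
    (∀ x, ∀ W ∈ (f x).submodule, A.mulVec W 1 = 0 ∧ A.mulVec W 3 = 0) ∧
    ¬ ∃ α β γ : ℂ, ∀ (x : S2) (W U : C4), IsDp (f x) (u x) W U →
      A.mulVec U 1 = α * A.mulVec W 0 + γ * A.mulVec W 2 ∧
      A.mulVec U 3 = β * A.mulVec W 2 + γ * A.mulVec W 0

/-- `u` is an extra infinitesimal horizontal holomorphic deformation of `f`. -/
def IsExtraIHHD {d : ℕ} (f : Hol d) (u : VectorField f.toFun) : Prop :=
  IsIHHD f u ∧ IsExtra f.toFun u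

/-- `u` is integrable by horizontal holomorphic maps: it is tangent to a smooth variation of `f`
through horizontal holomorphic maps (which have the same degree as `f`, the degree being constant
in a continuous family). -/
def IsIntegrable {d : ℕ} (f : Hol d) (u : VectorField f.toFun) : Prop :=
  ∃ (φ : ℝ → S2 → CP3) (ε : ℝ), IsVariation f.toFun φ ε ∧ IsTangentTo f.toFun u φ ∧
    ∀ t : ℝ, |t| < ε → ∃ g ∈ HHol d, g.toFun = φ t

end Twistor

end

/-!
A non-full horizontal map of degree `d` is moved by an element of `Sp(2)` to the form
`[F₀, 0, F₂, 0]` with `F₀`, `F₂` coprime. The map `[P]` is horizontal if and only if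
`W(P₀, P₁) + W(P₂, P₃) = 0`, where `W` is the Wronskian, a map into the `2d - 1` dimensional space
of polynomials of degree at most `2d - 2`. For fixed `(P₀, P₂)` this equation is *linear* in the
normal components `(P₁, P₃)`, and `Sp(2)` preserves it.

*Deformations as solutions of a linear equation.* A holomorphic vector field along `f` is
`dp_F(U)` for a quadruplet `U` of polynomials of degree at most `d` (a Liouville argument), and it
is an infinitesimal horizontal deformation exactly if `W(F₀, U₁) + W(F₂, U₃) = 0`. The span of
`(F₀, 0)`, `(0, F₂)`, `(F₂, F₀)` consists of solutions; an extra deformation is one with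
`(U₁, U₃)` outside of this span. A solution `N` belongs to the span if and only if
`[F₀, N₁, F₂, N₃]` is not full.

*No extra deformation.* For `d ≥ 1` the span has dimension `3`, so that if there are no other
solutions the linear map `(U₁, U₃) ↦ W(F₀, U₁) + W(F₂, U₃)` is surjective, as
`2 (d + 1) = 3 + (2d - 1)`. The equation of horizontality is then a submersion at `f`, hence `f` is
a smooth point (`isSmoothPoint_of_no_extra`). Surjectivity persists for pairs near `(F₀, F₂)`, so
that all horizontal maps near `f` are non-full and `f` is not a collapse point
(`not_isCollapsePoint`). In degree `0` every map is constant and nothing is extra.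

*An extra deformation `N`.* By linearity `[F₀, tN₁, F₂, tN₃]` is a family of horizontal maps,
full for `t ≠ 0`. Hence `f` is a collapse point (`isCollapsePoint_of_extra`) and the extra
deformation `(0, N₁, 0, N₃)` is integrable (`exists_integrable_extra`). On the other hand there is
a tangential direction `(E₀, E₂)` such that any curve of pairs through `(F₀, F₂)` with this
velocity consists, for small `t ≠ 0`, of pairs that admit only the three-dimensional space of
trivial solutions: the determinant of the linearized equation, completed by three linear forms
that are independent on the solutions at `(z ^ d, 1)`, is a non-zero polynomial on the space of
pairs, and the direction is chosen where its leading homogeneous term at `(F₀, F₂)` does not vanish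
(`exists_direction_disjoint`). By continuity no curve of horizontal maps can have a velocity with
tangential part `(E₀, E₂)` and normal part `N` (`exists_obstructed`). A smooth variation through
horizontal maps comes from a differentiable curve of quadruplets of polynomials
(`IsPolyField.exists_curve`), so the extra deformation `(E₀, N₁, E₂, N₃)` is not integrable
(`exists_nonintegrable_extra`). If `f` were a smooth point, the tangent space would
be a linear space that contains both `(0, N₁, 0, N₃)` and `(E₀, 0, E₂, 0)`, hence their sum, and
the implicit function theorem would give the curve that was just excluded
(`not_isSmoothPoint_of_extra`).
-/

noncomputable section

namespace Twistor

open Polynomial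

/-! ### Polynomials and their coefficient vectors -/

/-- The polynomial of degree at most `d` with coefficients `p`. -/
def polyOf {d : ℕ} : (Fin (d + 1) → ℂ) →ₗ[ℂ] ℂ[X] :=
  (degreeLT ℂ (d + 1)).subtype ∘ₗ (degreeLTEquiv ℂ (d + 1)).symm.toLinearMap

theorem polyOf_eq_sum {d : ℕ} (p : Fin (d + 1) → ℂ) :
    polyOf p = ∑ k : Fin (d + 1), monomial (k : ℕ) (p k) := rfl

theorem coeff_polyOf {d : ℕ} (p : Fin (d + 1) → ℂ) (k : Fin (d + 1)) :
    (polyOf p).coeff k = p k :=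
  congrFun ((degreeLTEquiv ℂ (d + 1)).apply_symm_apply p) k

theorem natDegree_polyOf_le {d : ℕ} (p : Fin (d + 1) → ℂ) : (polyOf p).natDegree ≤ d := by
  have : polyOf p ∈ degreeLT ℂ (d + 1) := ((degreeLTEquiv ℂ (d + 1)).symm p).2
  rw [degreeLT_succ_eq_degreeLE, mem_degreeLE] at this
  exact natDegree_le_of_degree_le this

theorem polyOf_injective {d : ℕ} : Function.Injective (polyOf (d := d)) :=
  Subtype.val_injective.comp (degreeLTEquiv ℂ (d + 1)).symm.injective

theorem exists_polyOf_eq {d : ℕ} {P : ℂ[X]} (h : P.natDegree ≤ d) :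
    ∃ p : Fin (d + 1) → ℂ, polyOf p = P := by
  have hP : P ∈ degreeLT ℂ (d + 1) := by
    rw [degreeLT_succ_eq_degreeLE, mem_degreeLE]
    exact degree_le_of_natDegree_le h
  exact ⟨degreeLTEquiv ℂ (d + 1) ⟨P, hP⟩, by simp [polyOf]⟩

theorem eval_polyOf {d : ℕ} (p : Fin (d + 1) → ℂ) (z : ℂ) :
    (polyOf p).eval z = ∑ k : Fin (d + 1), p k * z ^ (k : ℕ) := by
  simp [polyOf_eq_sum, eval_finsetSum]

theorem evalC_apply {d : ℕ} (a : Coef d) (z : ℂ) (i : Fin 4) :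
    evalC a z i = (polyOf (a i)).eval z := (eval_polyOf _ _).symm

theorem evalC_add {d : ℕ} (a b : Coef d) (z : ℂ) : evalC (a + b) z = evalC a z + evalC b z := by
  ext i; simp [evalC_apply]

theorem evalC_smul {d : ℕ} (c : ℂ) (a : Coef d) (z : ℂ) : evalC (c • a) z = c • evalC a z := by
  ext i; simp [evalC_apply]

/-- The derivative with respect to `z` of a quadruplet of polynomials. -/
def derivC {d : ℕ} (a : Coef d) (z : ℂ) : C4 := fun i => (derivative (polyOf (a i))).eval z

theorem hasDerivAt_evalC {d : ℕ} (a : Coef d) (z : ℂ) : HasDerivAt (evalC a) (derivC a z) z := by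
  rw [hasDerivAt_pi]
  intro i
  simp only [evalC_apply]
  exact (polyOf (a i)).hasDerivAt z

theorem analyticAt_evalC {d : ℕ} (a : Coef d) (z : ℂ) : AnalyticAt ℂ (evalC a) z := by
  rw [analyticAt_pi_iff]
  intro i
  unfold evalC
  fun_prop

/-- Coprime polynomials generate the unit ideal. -/
theorem exists_bezout {d : ℕ} {a : Coef d} (ha : ∀ z, evalC a z ≠ 0) :
    ∃ u : Fin 4 → ℂ[X], ∑ i, u i * polyOf (a i) = 1 := by
  obtain ⟨g, hg⟩ := (IsPrincipalIdealRing.principal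
    (Ideal.span (Set.range fun i => polyOf (a i)))).principal
  by_cases hu : degree g = 0
  · rw [← isUnit_iff_degree_eq_zero] at hu
    have : (1 : ℂ[X]) ∈ Ideal.span (Set.range fun i => polyOf (a i)) := by
      rw [hg]
      exact (Ideal.eq_top_iff_one _).mp (Ideal.span_singleton_eq_top.mpr hu)
    exact Ideal.mem_span_range_iff_exists_fun.mp this
  · obtain ⟨z, hz⟩ := IsAlgClosed.exists_root g hu
    refine absurd ?_ (ha z)
    ext i
    have : polyOf (a i) ∈ Ideal.span {g} := by
      have h2 : polyOf (a i) ∈ Ideal.span (Set.range fun i => polyOf (a i)) :=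
        Ideal.subset_span ⟨i, rfl⟩
      rwa [hg] at h2
    obtain ⟨q, hq⟩ := Ideal.mem_span_singleton.mp this
    simp [evalC_apply, hq, hz.eq_zero]

theorem exists_natDegree_eq {d : ℕ} {a : Coef d} (ha : topC a ≠ 0) :
    ∃ i, (polyOf (a i)).natDegree = d ∧ polyOf (a i) ≠ 0 := by
  obtain ⟨i, hi⟩ := Function.ne_iff.mp ha
  have h : (polyOf (a i)).coeff d ≠ 0 := by
    have := coeff_polyOf (a i) (Fin.last d)
    simp only [Fin.val_last] at this
    rw [this]; exact hi
  exact ⟨i, le_antisymm (natDegree_polyOf_le _) (le_natDegree_of_ne_zero h),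
    fun h0 => h (by simp [h0])⟩

/-- A quadruplet that is pointwise proportional to a coprime quadruplet of the same degree
at `2 d + 1` points is a constant multiple of it. -/
theorem exists_eq_smul_of_proportional {d : ℕ} {a b : Coef d} (ha : a ∈ V d)
    (h : ∀ n : Fin (2 * d + 1), ∀ i j,
      evalC a (n : ℕ) i * evalC b (n : ℕ) j = evalC a (n : ℕ) j * evalC b (n : ℕ) i) :
    ∃ c : ℂ, b = c • a := by
  have key : ∀ i j, polyOf (a i) * polyOf (b j) = polyOf (a j) * polyOf (b i) := by
    intro i j
    rw [← sub_eq_zero]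
    refine eq_zero_of_natDegree_lt_card_of_eval_eq_zero (ι := Fin (2 * d + 1)) _
      (f := fun n => ((n : ℕ) : ℂ)) ?_ ?_ ?_
    · intro m n hmn
      exact Fin.ext (Nat.cast_injective hmn)
    · intro n
      simpa [evalC_apply, sub_eq_zero] using h n i j
    · rw [Fintype.card_fin, Nat.lt_succ_iff]
      have h1 : ∀ p q : Fin (d + 1) → ℂ, (polyOf p * polyOf q).natDegree ≤ 2 * d := fun p q =>
        natDegree_mul_le.trans (by
          have := natDegree_polyOf_le p; have := natDegree_polyOf_le q; omega)
      exact (natDegree_sub_le _ _).trans (max_le (h1 _ _) (h1 _ _))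
  obtain ⟨u, hu⟩ := exists_bezout ha.1
  obtain ⟨j, hj, hj0⟩ := exists_natDegree_eq ha.2
  set r : ℂ[X] := ∑ i, u i * polyOf (b i) with hr
  have hb : ∀ j, polyOf (b j) = polyOf (a j) * r := by
    intro j
    rw [hr, Finset.mul_sum, ← one_mul (polyOf (b j)), ← hu, Finset.sum_mul]
    refine Finset.sum_congr rfl fun i _ => ?_
    rw [mul_assoc, key i j]; ring
  have hr0 : r.natDegree = 0 := by
    by_cases h0 : r = 0
    · simp [h0]
    · have := natDegree_polyOf_le (b j)
      rw [hb j, natDegree_mul hj0 h0, hj] at this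
      omega
  refine ⟨r.coeff 0, funext fun i => polyOf_injective ?_⟩
  rw [hb i, eq_C_of_natDegree_eq_zero hr0]
  simp [smul_eq_C_mul, mul_comm]

/-! ### The two charts -/

/-- The polynomials that represent the same map in the chart `c`: in the chart at infinity the
order of the coefficients is reversed. -/
def flipC {d : ℕ} (c : Bool) : Coef d →ₗ[ℂ] Coef d where
  toFun a := fun i k => a i (bif c then k.rev else k)
  map_add' _ _ := rfl
  map_smul' _ _ := rfl

@[simp] theorem flipC_false {d : ℕ} (a : Coef d) : flipC false a = a := rfl

@[simp] theorem flipC_flipC {d : ℕ} (c : Bool) (a : Coef d) : flipC c (flipC c a) = a := by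
  cases c
  · rfl
  · ext i k; simp [flipC]

theorem evalC_flipC_zero {d : ℕ} (a : Coef d) : evalC (flipC true a) 0 = topC a := by
  ext i
  simp only [evalC]
  rw [Finset.sum_eq_single 0]
  · simp [flipC, topC]
  · intro k _ hk
    have : (k : ℕ) ≠ 0 := fun h => hk (Fin.ext h)
    simp [this]
  · simp

theorem evalC_flipC {d : ℕ} (a : Coef d) {w : ℂ} (hw : w ≠ 0) :
    evalC (flipC true a) w = w ^ d • evalC a w⁻¹ := by
  ext i
  simp only [evalC, Pi.smul_apply, smul_eq_mul, Finset.mul_sum]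
  rw [← Equiv.sum_comp Fin.revPerm]
  refine Finset.sum_congr rfl fun k _ => ?_
  have hk : (k : ℕ) ≤ d := Nat.lt_succ_iff.mp k.2
  have h1 : d + 1 - ((k : ℕ) + 1) = d - k := by omega
  simp only [flipC, LinearMap.coe_mk, AddHom.coe_mk, cond_true, Fin.revPerm_apply, Fin.rev_rev,
    Fin.val_rev, h1]
  rw [pow_sub₀ _ hw hk, inv_pow]
  ring

theorem topC_flipC {d : ℕ} (a : Coef d) : topC (flipC true a) = evalC a 0 := by
  rw [← evalC_flipC_zero, flipC_flipC]

theorem flipC_mem_V {d : ℕ} (c : Bool) {a : Coef d} (ha : a ∈ V d) : flipC c a ∈ V d := by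
  cases c
  · exact ha
  · refine ⟨fun w => ?_, ?_⟩
    · by_cases hw : w = 0
      · subst hw; rw [evalC_flipC_zero]; exact ha.2
      · rw [evalC_flipC a hw]
        exact smul_ne_zero (pow_ne_zero _ hw) (ha.1 _)
    · rw [topC_flipC]; exact ha.1 0

theorem IsRep.ne_zero {p : CP3} {W : C4} (h : IsRep p W) : W ≠ 0 := h.1

theorem IsRep.smul {p : CP3} {W : C4} (h : IsRep p W) {c : ℂ} (hc : c ≠ 0) : IsRep p (c • W) := by
  obtain ⟨h0, rfl⟩ := h
  refine ⟨smul_ne_zero hc h0, ?_⟩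
  rw [Projectivization.mk_eq_mk_iff']
  exact ⟨c, rfl⟩

theorem IsRep.exists_smul {p : CP3} {W W' : C4} (h : IsRep p W) (h' : IsRep p W') :
    ∃ c : ℂ, c ≠ 0 ∧ W' = c • W := by
  obtain ⟨h0, rfl⟩ := h
  obtain ⟨h0', h1⟩ := h'
  rw [Projectivization.mk_eq_mk_iff'] at h1
  obtain ⟨c, hc⟩ := h1
  exact ⟨c, fun h => h0' (by rw [← hc, h, zero_smul]), hc.symm⟩

theorem IsRep.submodule_eq {p : CP3} {W : C4} (h : IsRep p W) :
    p.submodule = Submodule.span ℂ {W} := by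
  obtain ⟨h0, rfl⟩ := h
  exact Projectivization.submodule_mk _ _

theorem isRep_of_mem {p : CP3} {W : C4} (h0 : W ≠ 0) (h : W ∈ p.submodule) : IsRep p W := by
  have hp : IsRep p p.rep := ⟨p.rep_nonzero, p.mk_rep⟩
  rw [hp.submodule_eq, Submodule.mem_span_singleton] at h
  obtain ⟨c, rfl⟩ := h
  exact hp.smul fun hc => h0 (by simp [hc])

theorem isRep_polyMap_coe {d : ℕ} (a : V d) (z : ℂ) : IsRep (polyMap a (z : S2)) (evalC a.1 z) :=
  ⟨a.2.1 z, rfl⟩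

theorem isRep_polyMap {d : ℕ} (a : V d) (c : Bool) (z : ℂ) :
    IsRep (polyMap a (chart c z)) (evalC (flipC c a.1) z) := by
  cases c with
  | false => exact isRep_polyMap_coe a z
  | true =>
    by_cases hz : z = 0
    · subst hz
      rw [evalC_flipC_zero]
      exact ⟨a.2.2, by simp [chart, polyMap]⟩
    · rw [evalC_flipC _ hz]
      simp only [chart, hz, if_false]
      exact (isRep_polyMap_coe a _).smul (pow_ne_zero _ hz)

theorem exists_chart (x : S2) : ∃ c z, chart c z = x := by
  induction x using OnePoint.rec with
  | infty => exact ⟨true, 0, by simp [chart]⟩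
  | coe z => exact ⟨false, z, rfl⟩

theorem exists_eq_smul_of_polyMap_eq {d : ℕ} {a b : V d} (h : polyMap a = polyMap b) :
    ∃ c : ℂ, c ≠ 0 ∧ b.1 = c • a.1 := by
  obtain ⟨c, hc⟩ := exists_eq_smul_of_proportional (b := b.1) a.2 fun n i j => by
    have h1 := isRep_polyMap_coe a ((n : ℕ) : ℂ)
    rw [h] at h1
    obtain ⟨r, -, hr⟩ := h1.exists_smul (isRep_polyMap_coe b ((n : ℕ) : ℂ))
    rw [hr]
    simp only [Pi.smul_apply, smul_eq_mul]; ring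
  refine ⟨c, ?_, hc⟩
  rintro rfl
  exact b.2.2 (by rw [hc]; ext i; simp [topC])

theorem smul_mem_V {d : ℕ} {a : Coef d} (ha : a ∈ V d) {c : ℂ} (hc : c ≠ 0) : c • a ∈ V d :=
  ⟨fun z => by rw [evalC_smul]; exact smul_ne_zero hc (ha.1 z), by
    have : topC (c • a) = c • topC a := rfl
    rw [this]; exact smul_ne_zero hc ha.2⟩

theorem polyMap_smul {d : ℕ} (a : V d) {c : ℂ} (hc : c ≠ 0) (b : V d) (hb : b.1 = c • a.1) :
    polyMap b = polyMap a := by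
  funext x
  obtain ⟨e, z, rfl⟩ := exists_chart x
  have h := isRep_polyMap b e z
  rw [hb, map_smul, evalC_smul] at h
  obtain ⟨h1, h2⟩ := (isRep_polyMap a e z).smul hc
  obtain ⟨h3, h4⟩ := h
  rw [← h2, ← h4]

/-! ### The topology of the space of maps -/

theorem continuous_evalC {d : ℕ} : Continuous fun q : Coef d × ℂ => evalC q.1 q.2 := by
  unfold evalC
  fun_prop

theorem mem_V_iff {d : ℕ} {a : Coef d} : a ∈ V d ↔
    ∀ z ∈ Metric.closedBall (0 : ℂ) 1, evalC a z ≠ 0 ∧ evalC (flipC true a) z ≠ 0 := by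
  refine ⟨fun h z _ => ⟨h.1 z, (flipC_mem_V true h).1 z⟩, fun h => ⟨fun z => ?_, ?_⟩⟩
  · by_cases hz : ‖z‖ ≤ 1
    · exact (h z (by simpa using hz)).1
    · push Not at hz
      have hz0 : z⁻¹ ≠ 0 := inv_ne_zero (norm_pos_iff.mp (one_pos.trans hz))
      have := (h z⁻¹ (by simpa using inv_le_one_of_one_le₀ hz.le)).2
      rw [evalC_flipC _ hz0, inv_inv] at this
      exact fun h0 => this (by rw [h0, smul_zero])
  · rw [← evalC_flipC_zero]
    exact (h 0 (by simp)).2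

theorem isOpen_V {d : ℕ} : IsOpen (V d) := by
  rw [isOpen_iff_eventually]
  intro a ha
  have hc : Continuous fun q : Coef d × ℂ => evalC (flipC true q.1) q.2 :=
    continuous_evalC.comp
      (((flipC (d := d) true).continuous_of_finiteDimensional.comp continuous_fst).prodMk
        continuous_snd)
  have := (isCompact_closedBall (0 : ℂ) 1).eventually_forall_of_forall_eventually (x₀ := a)
    (P := fun b z => evalC b z ≠ 0 ∧ evalC (flipC true b) z ≠ 0) fun z hz =>
      (continuous_evalC.continuousAt.eventually_ne (mem_V_iff.mp ha z hz).1).and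
        (hc.continuousAt.eventually_ne (mem_V_iff.mp ha z hz).2)
  filter_upwards [this] with b hb using mem_V_iff.mpr hb

theorem continuous_proj {d : ℕ} : Continuous (proj (d := d)) := continuous_coinduced_rng

theorem isOpenMap_proj {d : ℕ} : IsOpenMap (proj (d := d)) := by
  intro U hU
  obtain ⟨O, hO, rfl⟩ := isOpen_induced_iff.mp hU
  rw [isOpen_coinduced]
  have : proj ⁻¹' (proj '' (Subtype.val ⁻¹' O)) =
      ⋃ c : {c : ℂ // c ≠ 0}, {b : V d | c.1 • b.1 ∈ O} := by
    ext b
    simp only [Set.mem_preimage, Set.mem_image, Set.mem_iUnion, Set.mem_ofPred_eq]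
    constructor
    · rintro ⟨a, ha, hab⟩
      obtain ⟨c, hc, h⟩ := exists_eq_smul_of_polyMap_eq (congrArg Hol.toFun hab).symm
      exact ⟨⟨c, hc⟩, by rwa [← h]⟩
    · rintro ⟨⟨c, hc⟩, h⟩
      refine ⟨⟨c • b.1, smul_mem_V b.2 hc⟩, h, ?_⟩
      have := polyMap_smul b hc ⟨c • b.1, smul_mem_V b.2 hc⟩ rfl
      simp only [proj, this]
  rw [this]
  exact isOpen_iUnion fun c => hO.preimage (continuous_subtype_val.const_smul c.1)

theorem nhds_proj {d : ℕ} (a : V d) : 𝓝 (proj a) = Filter.map proj (𝓝 a) :=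
  le_antisymm (isOpenMap_proj.nhds_le a) continuous_proj.continuousAt

theorem eventually_nhds_proj {d : ℕ} (a : V d) {p : Hol d → Prop} :
    (∀ᶠ h in 𝓝 (proj a), p h) ↔ ∀ᶠ b in 𝓝 a.1, ∀ hb : b ∈ V d, p (proj ⟨b, hb⟩) := by
  rw [nhds_proj, Filter.eventually_map, nhds_subtype_eq_comap, Filter.eventually_comap]
  refine ⟨fun h => h.mono fun b hb hV => hb ⟨b, hV⟩ rfl, fun h => h.mono ?_⟩
  rintro b hb ⟨_, hV⟩ rfl
  exact hb hV

theorem exists_proj_eq {d : ℕ} (f : Hol d) : ∃ a : V d, proj a = f := by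
  obtain ⟨f, hf, a, rfl⟩ := f
  exact ⟨a, rfl⟩

/-! ### The horizontality equation -/

theorem symp_eq (V W : C4) : symp V W = V 1 * W 0 - V 0 * W 1 + V 3 * W 2 - V 2 * W 3 := by
  simp [symp, J0, Matrix.mulVec, dotProduct, Fin.sum_univ_four]
  ring

/-- Pairs of polynomials of degree at most `d`, given by their coefficients. -/
abbrev Pair (d : ℕ) : Type := (Fin (d + 1) → ℂ) × (Fin (d + 1) → ℂ)

/-- The bilinear map `((p, q), (r, s)) ↦ W(p, r) + W(q, s)` on pairs of polynomials of degree at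
most `d`, where `W` is the Wronskian. -/
def wron (d : ℕ) : Pair d →ₗ[ℂ] Pair d →ₗ[ℂ] ℂ[X] :=
  (wronskianBilin ℂ).compl₁₂ (polyOf ∘ₗ LinearMap.fst ℂ _ _) (polyOf ∘ₗ LinearMap.fst ℂ _ _) +
  (wronskianBilin ℂ).compl₁₂ (polyOf ∘ₗ LinearMap.snd ℂ _ _) (polyOf ∘ₗ LinearMap.snd ℂ _ _)

theorem wron_apply {d : ℕ} (F N : Pair d) :
    wron d F N = wronskian (polyOf F.1) (polyOf N.1) + wronskian (polyOf F.2) (polyOf N.2) := rfl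

/-- The components of index `0` and `2`. -/
def evenC {d : ℕ} : Coef d →ₗ[ℂ] Pair d :=
  (LinearMap.proj 0).prod (LinearMap.proj 2)

/-- The components of index `1` and `3`. -/
def oddC {d : ℕ} : Coef d →ₗ[ℂ] Pair d :=
  (LinearMap.proj 1).prod (LinearMap.proj 3)

theorem evenC_apply {d : ℕ} (a : Coef d) : evenC a = (a 0, a 2) := rfl

theorem oddC_apply {d : ℕ} (a : Coef d) : oddC a = (a 1, a 3) := rfl

/-- The polynomial whose vanishing expresses that `[a]` is horizontal. -/
def horizPoly {d : ℕ} (a : Coef d) : ℂ[X] := wron d (evenC a) (oddC a)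

/-- The polarization of the quadratic map `horizPoly`. -/
def horizPolar {d : ℕ} (a b : Coef d) : ℂ[X] :=
  wron d (evenC a) (oddC b) + wron d (evenC b) (oddC a)

theorem horizPoly_add_smul {d : ℕ} (a b : Coef d) (t : ℂ) :
    horizPoly (a + t • b) = horizPoly a + t • horizPolar a b + t ^ 2 • horizPoly b := by
  simp only [horizPoly, horizPolar, map_add, map_smul, LinearMap.add_apply, LinearMap.smul_apply,
    smul_add, smul_smul]
  ring_nf

theorem horizPoly_smul {d : ℕ} (a : Coef d) (t : ℂ) :
    horizPoly (t • a) = t ^ 2 • horizPoly a := by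
  simp only [horizPoly, map_smul, LinearMap.smul_apply, smul_smul, pow_two]

theorem horizPolar_self {d : ℕ} (a : Coef d) : horizPolar a a = 2 • horizPoly a := by
  simp only [horizPoly, horizPolar, two_smul]

theorem eval_horizPoly {d : ℕ} (a : Coef d) (z : ℂ) :
    (horizPoly a).eval z = symp (derivC a z) (evalC a z) := by
  simp only [horizPoly, wron_apply, evenC_apply, oddC_apply, wronskian, symp_eq, evalC_apply,
    derivC, eval_add, eval_sub, eval_mul]
  ring

theorem eval_horizPolar {d : ℕ} (a b : Coef d) (z : ℂ) :
    (horizPolar a b).eval z =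
      symp (derivC a z) (evalC b z) + symp (derivC b z) (evalC a z) := by
  simp only [horizPolar, wron_apply, evenC_apply, oddC_apply, wronskian, symp_eq, evalC_apply,
    derivC, eval_add, eval_sub, eval_mul]
  ring

theorem derivC_flipC {d : ℕ} (a : Coef d) {w : ℂ} (hw : w ≠ 0) :
    derivC (flipC true a) w =
      (d * w ^ (d - 1)) • evalC a w⁻¹ + (w ^ d * -(w ^ 2)⁻¹) • derivC a w⁻¹ := by
  have h1 := hasDerivAt_evalC (flipC true a) w
  have h2 : HasDerivAt (fun w => w ^ d • evalC a w⁻¹)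
      (w ^ d • (-(w ^ 2)⁻¹ • derivC a w⁻¹) + (d * w ^ (d - 1)) • evalC a w⁻¹) w :=
    (hasDerivAt_pow d w).smul ((hasDerivAt_evalC a w⁻¹).scomp w (hasDerivAt_inv hw))
  rw [h1.unique (h2.congr_of_eventuallyEq ?_), smul_smul, add_comm]
  filter_upwards [eventually_ne_nhds hw] with v hv using evalC_flipC a hv

theorem horizPolar_flipC {d : ℕ} {a b : Coef d} (h : horizPolar a b = 0) (c : Bool) :
    horizPolar (flipC c a) (flipC c b) = 0 := by
  cases c
  · exact h
  have : X * horizPolar (flipC true a) (flipC true b) = 0 := by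
    refine Polynomial.funext fun w => ?_
    by_cases hw : w = 0
    · simp [hw]
    have h0 := eval_horizPolar a b w⁻¹
    rw [h, eval_zero] at h0
    rw [eval_mul, eval_horizPolar, evalC_flipC _ hw, evalC_flipC _ hw, derivC_flipC _ hw,
      derivC_flipC _ hw, eval_zero]
    simp only [symp_eq, Pi.add_apply, Pi.smul_apply, smul_eq_mul] at h0 ⊢
    linear_combination (-(eval w X * w ^ d * (w ^ d * -(w ^ 2)⁻¹))) * h0
  exact (mul_eq_zero.mp this).resolve_left X_ne_zero

theorem horizPoly_flipC {d : ℕ} {a : Coef d} (h : horizPoly a = 0) (c : Bool) :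
    horizPoly (flipC c a) = 0 := by
  have h1 : horizPolar a a = 0 := by rw [horizPolar_self, h, smul_zero]
  have h2 := horizPolar_flipC h1 c
  rw [horizPolar_self] at h2
  exact (smul_eq_zero.mp h2).resolve_left two_ne_zero

/-- Two families of representatives of the same points differ by a ratio of coordinates. -/
theorem exists_ratio {T : Type*} [TopologicalSpace T] {p : T → CP3} {F G : T → C4} {z : T}
    (hG : ContinuousAt G z) (h1 : ∀ᶠ ζ in 𝓝 z, IsRep (p ζ) (F ζ))
    (h2 : ∀ᶠ ζ in 𝓝 z, IsRep (p ζ) (G ζ)) :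
    ∃ i, (∀ᶠ ζ in 𝓝 z, G ζ i ≠ 0) ∧ (∀ᶠ ζ in 𝓝 z, F ζ i / G ζ i ≠ 0) ∧
      ∀ᶠ ζ in 𝓝 z, F ζ = (F ζ i / G ζ i) • G ζ := by
  obtain ⟨i, hi⟩ := Function.ne_iff.mp h2.self_of_nhds.ne_zero
  have hi' : ∀ᶠ ζ in 𝓝 z, G ζ i ≠ 0 :=
    (((continuous_apply i).continuousAt (x := G z)).comp hG).eventually_ne hi
  have key : ∀ᶠ ζ in 𝓝 z, F ζ i / G ζ i ≠ 0 ∧ F ζ = (F ζ i / G ζ i) • G ζ := by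
    filter_upwards [h1, h2, hi'] with ζ h1 h2 h3
    obtain ⟨c, hc, h⟩ := h2.exists_smul h1
    have : F ζ i / G ζ i = c := by rw [h]; simp [h3]
    rw [this]
    exact ⟨hc, h⟩
  exact ⟨i, hi', key.mono fun _ h => h.1, key.mono fun _ h => h.2⟩

theorem differentiableAt_ratio {E : Type*} [NormedAddCommGroup E] [NormedSpace ℝ E] {f g : E → ℂ}
    {x : E} (hf : DifferentiableAt ℝ f x) (hg : DifferentiableAt ℝ g x) (h0 : g x ≠ 0) :
    DifferentiableAt ℝ (fun y => f y / g y) x := by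
  simp only [div_eq_mul_inv]
  exact hf.fun_mul (hg.fun_inv h0)

theorem hasFDerivAt_evalC {d : ℕ} (a : Coef d) (z : ℂ) : HasFDerivAt (𝕜 := ℝ) (evalC a)
    (((ContinuousLinearMap.toSpanSingleton ℂ (derivC a z)).restrictScalars ℝ)) z :=
  (hasDerivAt_evalC a z).hasFDerivAt.restrictScalars ℝ

theorem isHorizontal_polyMap {d : ℕ} (a : V d) :
    IsHorizontal (polyMap a) ↔ horizPoly a.1 = 0 := by
  constructor
  · intro h
    refine Polynomial.funext fun z => ?_
    have hd := hasFDerivAt_evalC a.1 z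
    have := h false z (evalC a.1) ?_ (Filter.Eventually.of_forall fun ζ => isRep_polyMap_coe a ζ) 1
    · rw [hd.fderiv] at this
      rw [eval_horizPoly, eval_zero, ← this]
      simp
    · exact ((analyticAt_evalC a.1 z).contDiffAt (n := ∞)).restrict_scalars ℝ
  · intro h c z F hF hL X
    have hb := horizPoly_flipC h c
    set b := flipC c a.1
    have hdF : DifferentiableAt ℝ F z := hF.differentiableAt (by simp)
    have hdb := hasFDerivAt_evalC b z
    obtain ⟨i, hi, -, h3⟩ := exists_ratio (hasDerivAt_evalC b z).continuousAt hL
      (Filter.Eventually.of_forall fun ζ => isRep_polyMap a c ζ)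
    have hi := hi.self_of_nhds
    have hμ : DifferentiableAt ℝ (fun ζ => F ζ i / evalC b ζ i) z :=
      differentiableAt_ratio (differentiableAt_pi.mp hdF i)
        (differentiableAt_pi.mp hdb.differentiableAt i) hi
    have hF' := (hμ.hasFDerivAt.smul hdb).congr_of_eventuallyEq (f₁ := F) h3
    have h0 := eval_horizPoly b z
    rw [hb, eval_zero] at h0
    have hz := h3.self_of_nhds
    beta_reduce at hF'
    generalize F z i / evalC b z i = m at hF' hz
    rw [hF'.fderiv, hz]
    simp only [symp_eq, add_apply, smul_apply,
      ContinuousLinearMap.coe_restrictScalars', ContinuousLinearMap.toSpanSingleton_apply,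
      ContinuousLinearMap.smulRight_apply, Pi.add_apply, Pi.smul_apply, smul_eq_mul] at h0 ⊢
    linear_combination (-m ^ 2 * X) * h0

theorem proj_mem_HHol {d : ℕ} (a : V d) : proj a ∈ HHol d ↔ horizPoly a.1 = 0 :=
  isHorizontal_polyMap a

/-! ### Tangent vectors -/

theorem IsDp.isRep {p : CP3} {τ : p.submodule →ₗ[ℂ] (C4 ⧸ p.submodule)} {W U : C4}
    (h : IsDp p τ W U) : IsRep p W :=
  isRep_of_mem h.1 h.2.1

theorem IsDp.smul_add {p : CP3} {τ : p.submodule →ₗ[ℂ] (C4 ⧸ p.submodule)} {W U : C4}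
    (h : IsDp p τ W U) {c : ℂ} (hc : c ≠ 0) (r : ℂ) : IsDp p τ (c • W) (c • U + r • W) := by
  obtain ⟨h0, hW, h⟩ := h
  refine ⟨smul_ne_zero hc h0, Submodule.smul_mem _ _ hW, ?_⟩
  have h1 : (⟨c • W, Submodule.smul_mem _ c hW⟩ : p.submodule) = c • ⟨W, hW⟩ := rfl
  rw [h1, map_smul, h, ← Submodule.Quotient.mk_smul, eq_comm, Submodule.Quotient.eq,
    add_sub_cancel_left]
  exact Submodule.smul_mem _ _ hW

theorem IsDp.exists_eq_add {p : CP3} {τ : p.submodule →ₗ[ℂ] (C4 ⧸ p.submodule)} {W U U' : C4}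
    (h : IsDp p τ W U) (h' : IsDp p τ W U') : ∃ r : ℂ, U' = U + r • W := by
  have hp := h.isRep.submodule_eq
  obtain ⟨-, hW, h⟩ := h
  obtain ⟨-, _, h'⟩ := h'
  rw [h, eq_comm, Submodule.Quotient.eq, hp, Submodule.mem_span_singleton] at h'
  obtain ⟨r, hr⟩ := h'
  exact ⟨r, by rw [hr]; abel⟩

theorem IsRep.exists_isDp {p : CP3} {W : C4} (h : IsRep p W)
    (τ : p.submodule →ₗ[ℂ] (C4 ⧸ p.submodule)) : ∃ U, IsDp p τ W U := by
  have hW : W ∈ p.submodule := by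
    rw [h.submodule_eq]; exact Submodule.mem_span_singleton_self W
  obtain ⟨U, hU⟩ := Submodule.Quotient.mk_surjective _ (τ ⟨W, hW⟩)
  exact ⟨U, h.ne_zero, hW, hU.symm⟩

theorem IsRep.exists_tangent {p : CP3} {W : C4} (h : IsRep p W) (U : C4) :
    ∃ τ : p.submodule →ₗ[ℂ] (C4 ⧸ p.submodule), IsDp p τ W U := by
  have hW : W ∈ p.submodule := by
    rw [h.submodule_eq]; exact Submodule.mem_span_singleton_self W
  obtain ⟨l, hl⟩ := Module.Projective.exists_dual_ne_zero ℂ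
    (show (⟨W, hW⟩ : p.submodule) ≠ 0 from fun h0 => h.ne_zero (congrArg Subtype.val h0))
  refine ⟨l.smulRight (Submodule.Quotient.mk ((l ⟨W, hW⟩)⁻¹ • U)), h.ne_zero, hW, ?_⟩
  rw [LinearMap.smulRight_apply, ← Submodule.Quotient.mk_smul, smul_smul, mul_inv_cancel₀ hl,
    one_smul]

/-- The tangent vector of a curve of points can be computed with any differentiable curve of
representatives. -/
theorem IsDp.transfer {p : CP3} {τ : p.submodule →ₗ[ℂ] (C4 ⧸ p.submodule)} {φ : ℝ → CP3}
    {F G : ℝ → C4} (hF : DifferentiableAt ℝ F 0) (hG : DifferentiableAt ℝ G 0)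
    (h1 : ∀ᶠ t in 𝓝 0, IsRep (φ t) (F t)) (h2 : ∀ᶠ t in 𝓝 0, IsRep (φ t) (G t))
    (h : IsDp p τ (G 0) (deriv G 0)) : IsDp p τ (F 0) (deriv F 0) := by
  obtain ⟨i, hi, hr, h3⟩ := exists_ratio hG.continuousAt h1 h2
  have hμ : DifferentiableAt ℝ (fun t => F t i / G t i) 0 :=
    (differentiableAt_pi.mp hF i).fun_div (differentiableAt_pi.mp hG i) hi.self_of_nhds
  have hF' := (hμ.hasDerivAt.smul hG.hasDerivAt).congr_of_eventuallyEq (f₁ := F) h3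
  rw [hF'.deriv]
  have := h.smul_add hr.self_of_nhds (deriv (fun t => F t i / G t i) 0)
  rwa [← h3.self_of_nhds] at this

/-- The vector field `dp_a(U)` along `[a]`, for polynomial quadruplets `a` and `U`, characterized
by its lifts in both charts. -/
def IsPolyField {d : ℕ} (a : V d) (U : Coef d) (u : VectorField (polyMap a)) : Prop :=
  ∀ (c : Bool) (z : ℂ), IsDp (polyMap a (chart c z)) (u (chart c z))
    (evalC (flipC c a.1) z) (evalC (flipC c U) z)

theorem isPolyField_of {d : ℕ} {a : V d} {U : Coef d} {u : VectorField (polyMap a)}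
    (h1 : ∀ z : ℂ, IsDp (polyMap a (chart false z)) (u (chart false z)) (evalC a.1 z) (evalC U z))
    (h2 : IsDp (polyMap a (chart true 0)) (u (chart true 0)) (evalC (flipC true a.1) 0)
      (evalC (flipC true U) 0)) : IsPolyField a U u := by
  intro c z
  cases c with
  | false => exact h1 z
  | true =>
    by_cases hz : z = 0
    · subst hz; exact h2
    · have e : chart true z = chart false z⁻¹ := by simp [chart, hz]
      rw [evalC_flipC _ hz, evalC_flipC _ hz, e]
      have := (h1 z⁻¹).smul_add (pow_ne_zero d hz) 0
      rwa [zero_smul, add_zero] at this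

theorem exists_isPolyField {d : ℕ} (a : V d) (U : Coef d) : ∃ u, IsPolyField a U u := by
  have key : ∀ x : S2, ∃ τ : (polyMap a x).submodule →ₗ[ℂ] (C4 ⧸ (polyMap a x).submodule),
      (∀ z : ℂ, x = z → IsDp _ τ (evalC a.1 z) (evalC U z)) ∧
      (x = OnePoint.infty → IsDp _ τ (topC a.1) (topC U)) := by
    intro x
    induction x using OnePoint.rec with
    | infty =>
      obtain ⟨τ, hτ⟩ := (show IsRep (polyMap a OnePoint.infty) (topC a.1) from
        ⟨a.2.2, rfl⟩).exists_tangent (topC U)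
      exact ⟨τ, fun z h => absurd h (OnePoint.infty_ne_coe z), fun _ => hτ⟩
    | coe z =>
      obtain ⟨τ, hτ⟩ := (isRep_polyMap_coe a z).exists_tangent (evalC U z)
      refine ⟨τ, fun w h => ?_, fun h => absurd h (OnePoint.coe_ne_infty z)⟩
      rw [← OnePoint.coe_injective h]; exact hτ
  choose u hu using key
  refine ⟨u, isPolyField_of (fun z => (hu _).1 z rfl) ?_⟩
  rw [evalC_flipC_zero, evalC_flipC_zero]
  exact (hu _).2 (by simp [chart])

theorem IsPolyField.isHolomorphicField {d : ℕ} {a : V d} {U : Coef d}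
    {u : VectorField (polyMap a)} (h : IsPolyField a U u) : IsHolomorphicField (polyMap a) u :=
  fun c z => ⟨_, _, analyticAt_evalC (flipC c a.1) z, analyticAt_evalC (flipC c U) z,
    Filter.Eventually.of_forall fun ζ => h c ζ⟩

/-! ### Linear variations -/

/-- The variation `t ↦ [a + t U]` (constant for the `t` for which `a + t U` does not define a
map of degree `d`). -/
def lineVar {d : ℕ} (a : V d) (U : Coef d) (t : ℝ) : S2 → CP3 := by
  classical exact if h : a.1 + (t : ℂ) • U ∈ V d then polyMap ⟨_, h⟩ else polyMap a

theorem lineVar_eq {d : ℕ} {a : V d} {U : Coef d} {t : ℝ} (h : a.1 + (t : ℂ) • U ∈ V d) :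
    lineVar a U t = polyMap ⟨_, h⟩ := dif_pos h

theorem eventually_mem_V {d : ℕ} (a : V d) (U : Coef d) :
    ∀ᶠ t : ℝ in 𝓝 0, a.1 + (t : ℂ) • U ∈ V d := by
  have hc : ContinuousAt (fun t : ℝ => a.1 + (t : ℂ) • U) 0 := by fun_prop
  exact hc.eventually (isOpen_V.mem_nhds (by simp))

/-- The lift of a linear variation to `ℂ⁴`. -/
def lineLift {d : ℕ} (a U : Coef d) (c : Bool) (q : ℝ × ℂ) : C4 :=
  evalC (flipC c (a + (q.1 : ℂ) • U)) q.2

theorem lineLift_eq {d : ℕ} (a U : Coef d) (c : Bool) (q : ℝ × ℂ) :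
    lineLift a U c q = evalC (flipC c a) q.2 + (q.1 : ℂ) • evalC (flipC c U) q.2 := by
  rw [lineLift, map_add, map_smul, evalC_add, evalC_smul]

theorem contDiff_lineLift {d : ℕ} (a U : Coef d) (c : Bool) :
    ContDiff ℝ ∞ (lineLift a U c) := by
  have h : ∀ b : Coef d, ContDiff ℝ ∞ (evalC b) := by
    intro b
    unfold evalC
    fun_prop
  have e : lineLift a U c = fun q : ℝ × ℂ => evalC (flipC c a) q.2 +
      (Complex.ofRealCLM q.1) • evalC (flipC c U) q.2 := funext fun q => lineLift_eq a U c q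
  rw [e]
  exact ((h _).comp contDiff_snd).add
    ((Complex.ofRealCLM.contDiff.comp contDiff_fst).smul ((h _).comp contDiff_snd))

theorem isSmoothLift_lineLift {d : ℕ} (a : V d) (U : Coef d) (c : Bool) {t : ℝ} (z : ℂ)
    (ht : a.1 + (t : ℂ) • U ∈ V d) :
    IsSmoothLift (lineVar a U) c (lineLift a.1 U c) t z := by
  refine ⟨(contDiff_lineLift a.1 U c).contDiffAt, ?_⟩
  have hc : ContinuousAt (fun q : ℝ × ℂ => a.1 + (q.1 : ℂ) • U) (t, z) := by fun_prop
  filter_upwards [hc.eventually (isOpen_V.mem_nhds ht)] with q hq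
  rw [lineVar_eq hq]
  exact isRep_polyMap ⟨_, hq⟩ c q.2

theorem exists_isVariation_lineVar {d : ℕ} (a : V d) (U : Coef d) :
    ∃ ε, IsVariation (polyMap a) (lineVar a U) ε ∧
      ∀ t : ℝ, |t| < ε → a.1 + (t : ℂ) • U ∈ V d := by
  obtain ⟨ε, hε, h⟩ := Metric.eventually_nhds_iff.mp (eventually_mem_V a U)
  have h' : ∀ t : ℝ, |t| < ε → a.1 + (t : ℂ) • U ∈ V d := fun t ht => h (by simpa using ht)
  refine ⟨ε, ⟨hε, ?_, fun t ht c z => ⟨_, isSmoothLift_lineLift a U c z (h' t ht)⟩⟩, h'⟩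
  rw [lineVar_eq (h' 0 (by simpa using hε))]
  congr 1
  ext1
  simp

theorem IsSmoothLift.differentiableAt_left {φ : ℝ → S2 → CP3} {c : Bool} {F : ℝ × ℂ → C4} {t : ℝ}
    {z : ℂ} (h : IsSmoothLift φ c F t z) : DifferentiableAt ℝ (fun s => F (s, z)) t :=
  (h.1.differentiableAt (by simp)).comp (g := F) (f := fun s : ℝ => (s, z)) t
    (differentiableAt_id.prodMk (differentiableAt_const z))

theorem IsSmoothLift.eventually_left {φ : ℝ → S2 → CP3} {c : Bool} {F : ℝ × ℂ → C4} {t : ℝ}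
    {z : ℂ} (h : IsSmoothLift φ c F t z) :
    ∀ᶠ s in 𝓝 t, IsRep (φ s (chart c z)) (F (s, z)) :=
  (show ContinuousAt (fun s : ℝ => (s, z)) t by fun_prop).eventually h.2

theorem IsPolyField.isTangentTo_lineVar {d : ℕ} {a : V d} {U : Coef d}
    {u : VectorField (polyMap a)} (h : IsPolyField a U u) :
    IsTangentTo (polyMap a) u (lineVar a U) := by
  intro c z F hF
  have hG := isSmoothLift_lineLift a U c (t := 0) z (by simp)
  refine IsDp.transfer hF.differentiableAt_left hG.differentiableAt_left hF.eventually_left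
    hG.eventually_left ?_
  have hd : HasDerivAt (fun s : ℝ => lineLift a.1 U c (s, z)) (evalC (flipC c U) z) 0 := by
    have := ((Complex.ofRealCLM.hasDerivAt (x := 0)).smul_const (evalC (flipC c U) z)).const_add
      (evalC (flipC c a.1) z)
    simp only [Complex.ofRealCLM_apply, Complex.ofReal_one, one_smul] at this
    simpa only [lineLift_eq] using this
  rw [hd.deriv, lineLift_eq]
  simpa using h c z

/-! ### Infinitesimal horizontality -/

theorem sum_norm_sq_pos {W : C4} (h : W ≠ 0) : 0 < ∑ i, ‖W i‖ ^ 2 := by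
  obtain ⟨i, hi⟩ := Function.ne_iff.mp h
  exact Finset.sum_pos' (fun j _ => by positivity)
    ⟨i, Finset.mem_univ _, by have : W i ≠ 0 := hi; positivity⟩

/-- The vertical component of a family of vectors is `o(t)` if and only if the symplectic form
that measures it has value and derivative zero. -/
theorem verticalNorm_isLittleO_iff {G H : ℝ → C4} {s : ℝ → ℂ} (hG : ContinuousAt G 0)
    (h0 : G 0 ≠ 0) (hs : ∀ᶠ t in 𝓝 0, symp (H t) (G t) = s t) :
    (fun t => verticalNorm (G t) (H t)) =o[𝓝 0] (fun t : ℝ => t) ↔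
      s =o[𝓝 0] (fun t : ℝ => t) := by
  set q : ℝ → ℝ := fun t => ∑ i, ‖G t i‖ ^ 2 with hq
  have hcq : ContinuousAt q 0 := by
    refine tendsto_finsetSum _ fun i _ => ?_
    exact (((continuous_apply i).continuousAt (x := G 0)).comp hG).norm.pow 2
  have hq0 : q 0 ≠ 0 := (sum_norm_sq_pos h0).ne'
  have e1 : (fun t => verticalNorm (G t) (H t)) =ᶠ[𝓝 0] fun t => ‖s t‖ * (q t)⁻¹ := by
    filter_upwards [hs] with t ht
    rw [verticalNorm, ht, div_eq_mul_inv]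
  constructor
  · intro h
    have h1 := (h.congr' e1 Filter.EventuallyEq.rfl).mul_isBigO
      (hcq.tendsto.isBigO_one ℝ)
    simp only [mul_one] at h1
    rw [← Asymptotics.isLittleO_norm_left]
    refine h1.congr' ?_ Filter.EventuallyEq.rfl
    filter_upwards [hcq.eventually_ne hq0] with t ht
    rw [mul_assoc, inv_mul_cancel₀ ht, mul_one]
  · intro h
    have h1 := h.norm_left.mul_isBigO ((hcq.inv₀ hq0).tendsto.isBigO_one ℝ)
    simp only [mul_one] at h1
    exact h1.congr' e1.symm Filter.EventuallyEq.rfl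

theorem symp_isLittleO {g : ℝ → ℂ} (hd : HasDerivAt g 0 0) (h0 : g 0 = 0) :
    g =o[𝓝 0] (fun t : ℝ => t) := by
  have := hasDerivAt_iff_isLittleO.mp hd
  simpa [h0] using this

theorem hasDerivAt_symp {F G : ℝ → C4} {F' G' : C4} {t : ℝ} (hF : HasDerivAt F F' t)
    (hG : HasDerivAt G G' t) :
    HasDerivAt (fun t => symp (F t) (G t)) (symp F' (G t) + symp (F t) G') t := by
  rw [hasDerivAt_pi] at hF hG
  simp only [symp_eq]
  have := ((((hF 1).mul (hG 0)).sub ((hF 0).mul (hG 1))).add ((hF 3).mul (hG 2))).sub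
    ((hF 2).mul (hG 3))
  exact this.congr_deriv (by ring)

theorem IsPolyField.isInfHorizontal {d : ℕ} {a : V d} {U : Coef d} {u : VectorField (polyMap a)}
    (hu : IsPolyField a U u) (ha : horizPoly a.1 = 0) (hU : horizPolar a.1 U = 0) :
    IsInfHorizontal (polyMap a) u := by
  intro φ ε hφ hT c z F hF Y
  obtain ⟨hε, hφ0, hL⟩ := hφ
  have hb0 := horizPoly_flipC ha c
  have hbU := horizPolar_flipC hU c
  set b := flipC c a.1 with hb
  set w := flipC c U with hw
  obtain ⟨hFs, hFr⟩ := hF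
  have hF2 : ContDiffAt ℝ 2 F (0, z) := contDiffAt_infty.mp hFs 2
  -- near `(0, z)` the map `F` is differentiable, and its second derivative is symmetric
  have hdF : ∀ᶠ q in 𝓝 ((0 : ℝ), z), DifferentiableAt ℝ F q := by
    filter_upwards [hF2.eventually (by simp)] with q hq using hq.differentiableAt (by simp)
  have hsymm : IsSymmSndFDerivAt ℝ F (0, z) := hF2.isSymmSndFDerivAt (by simp)
  have hd2 : HasFDerivAt (fderiv ℝ F) (fderiv ℝ (fderiv ℝ F) (0, z)) (0, z) :=
    ((hF2.fderiv_right (m := 1) (by norm_num)).differentiableAt (by simp)).hasFDerivAt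
  set D2 := fderiv ℝ (fderiv ℝ F) (0, z)
  have hcz : ContinuousAt (fun ζ : ℂ => ((0 : ℝ), ζ)) z := by fun_prop
  have hct : ContinuousAt (fun t : ℝ => (t, z)) 0 := by fun_prop
  have hline : ∀ (t : ℝ) (ζ : ℂ), DifferentiableAt ℝ F (t, ζ) →
      HasFDerivAt (fun ζ => F (t, ζ))
        ((fderiv ℝ F (t, ζ)).comp (ContinuousLinearMap.inr ℝ ℝ ℂ)) ζ := fun t ζ h =>
    h.hasFDerivAt.comp ζ (hasFDerivAt_prodMk_right t ζ)
  have hline' : ∀ (t : ℝ) (ζ : ℂ), DifferentiableAt ℝ F (t, ζ) →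
      HasDerivAt (fun t => F (t, ζ)) (fderiv ℝ F (t, ζ) (1, 0)) t := fun t ζ h => by
    have := (h.hasFDerivAt.comp t (hasFDerivAt_prodMk_left t ζ)).hasDerivAt
    simp only [ContinuousLinearMap.comp_apply, ContinuousLinearMap.inl_apply] at this
    exact this
  -- the velocity of the variation along the sphere
  set B : ℂ → C4 := fun ζ => fderiv ℝ F (0, ζ) (1, 0) with hB
  have hBd : HasFDerivAt B ((ContinuousLinearMap.apply ℝ C4 ((1 : ℝ), (0 : ℂ))).comp
      (D2.comp (ContinuousLinearMap.inr ℝ ℝ ℂ))) z :=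
    (ContinuousLinearMap.apply ℝ C4 ((1 : ℝ), (0 : ℂ))).hasFDerivAt.comp z
      (hd2.comp z (hasFDerivAt_prodMk_right (0 : ℝ) z))
  have hA : HasFDerivAt (fun ζ => F (0, ζ)) _ z := hline 0 z hdF.self_of_nhds
  have hbd := hasFDerivAt_evalC b z
  have hwd := hasFDerivAt_evalC w z
  obtain ⟨i, hi, -, hμ⟩ := exists_ratio (p := fun ζ => polyMap a (chart c ζ))
    (F := fun ζ => F (0, ζ)) (G := evalC b) (z := z) hbd.continuousAt
    (by filter_upwards [hcz.eventually hFr] with ζ hζ; rwa [hφ0] at hζ)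
    (Filter.Eventually.of_forall fun ζ => isRep_polyMap a c ζ)
  set μ : ℂ → ℂ := fun ζ => F (0, ζ) i / evalC b ζ i with hμdef
  set ν : ℂ → ℂ := fun ζ => (B ζ i - μ ζ * evalC w ζ i) / evalC b ζ i with hνdef
  have hBeq : ∀ᶠ ζ in 𝓝 z, B ζ = μ ζ • evalC w ζ + ν ζ • evalC b ζ := by
    filter_upwards [hcz.eventually hFr.eventually_nhds, hcz.eventually hdF, hi, hμ]
      with ζ hr hd hi hμ
    obtain ⟨G, hG⟩ := hL 0 (by simpa using hε) c ζ
    have hFd : DifferentiableAt ℝ (fun t => F (t, ζ)) 0 := (hline' 0 ζ hd).differentiableAt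
    have hFr' : ∀ᶠ t in 𝓝 (0 : ℝ), IsRep (φ t (chart c ζ)) (F (t, ζ)) :=
      (show ContinuousAt (fun t : ℝ => (t, ζ)) 0 by fun_prop).eventually hr
    have h1 := IsDp.transfer hFd hG.differentiableAt_left hFr' hG.eventually_left (hT c ζ G hG)
    rw [(hline' 0 ζ hd).deriv] at h1
    have hμ0 : μ ζ ≠ 0 := fun h => h1.1 (by
      have : F (0, ζ) = μ ζ • evalC b ζ := hμ
      rw [this, h, zero_smul])
    have h2 := (hu c ζ).smul_add hμ0 0
    rw [zero_smul, add_zero] at h2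
    change IsDp _ _ (μ ζ • evalC b ζ) (μ ζ • evalC w ζ) at h2
    have h3 : F (0, ζ) = μ ζ • evalC b ζ := hμ
    rw [← h3] at h2
    obtain ⟨r, hr⟩ := h2.exists_eq_add h1
    have h4 : B ζ = μ ζ • evalC w ζ + (r * μ ζ) • evalC b ζ := by
      rw [hB]; simp only; rw [hr, h3, smul_smul]
    have h5 : ν ζ = r * μ ζ := by
      rw [hνdef]; simp only; rw [h4]; simp [hi]
    rw [h5, h4]
  have hμd : DifferentiableAt ℝ μ z := differentiableAt_ratio
    (differentiableAt_pi.mp hA.differentiableAt i)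
    (differentiableAt_pi.mp hbd.differentiableAt i) hi.self_of_nhds
  have hνd : DifferentiableAt ℝ ν z := differentiableAt_ratio
    ((differentiableAt_pi.mp hBd.differentiableAt i).fun_sub
      (hμd.fun_mul (differentiableAt_pi.mp hwd.differentiableAt i)))
    (differentiableAt_pi.mp hbd.differentiableAt i) hi.self_of_nhds
  have eA := hA.unique ((hμd.hasFDerivAt.smul hbd).congr_of_eventuallyEq hμ)
  have eB := hBd.unique (((hμd.hasFDerivAt.smul hwd).add
    (hνd.hasFDerivAt.smul hbd)).congr_of_eventuallyEq hBeq)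
  have eA' := DFunLike.congr_fun eA Y
  have eB' := DFunLike.congr_fun eB Y
  have hA0 : F (0, z) = μ z • evalC b z := hμ.self_of_nhds
  have hB0 : B z = μ z • evalC w z + ν z • evalC b z := hBeq.self_of_nhds
  simp only [ContinuousLinearMap.comp_apply, ContinuousLinearMap.inr_apply,
    ContinuousLinearMap.apply_apply, add_apply, smul_apply,
    ContinuousLinearMap.smulRight_apply, ContinuousLinearMap.coe_restrictScalars',
    ContinuousLinearMap.toSpanSingleton_apply] at eA' eB'
  -- the derivative of `t ↦ symp (dF_t Y) F_t`
  have hH : HasDerivAt (fun t : ℝ => fderiv ℝ F (t, z) (0, Y)) (D2 (1, 0) (0, Y)) 0 := by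
    have h1 := (ContinuousLinearMap.apply ℝ C4 ((0 : ℝ), Y)).hasFDerivAt.comp (0 : ℝ)
      (hd2.comp (0 : ℝ) (hasFDerivAt_prodMk_left (0 : ℝ) z))
    have h2 := h1.hasDerivAt
    simp only [ContinuousLinearMap.comp_apply, ContinuousLinearMap.inl_apply,
      ContinuousLinearMap.apply_apply] at h2
    exact h2
  rw [hsymm.eq, eB'] at hH
  have hS := hasDerivAt_symp hH (hline' 0 z hdF.self_of_nhds)
  have p0 := eval_horizPoly b z
  have p1 := eval_horizPolar b w z
  rw [hb0, eval_zero] at p0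
  rw [hbU, eval_zero] at p1
  have hS0 : symp (fderiv ℝ F (0, z) (0, Y)) (F (0, z)) = 0 := by
    rw [eA', hA0]
    simp only [symp_eq, Pi.add_apply, Pi.smul_apply, smul_eq_mul] at p0 ⊢
    linear_combination (-(μ z) ^ 2 * Y) * p0
  rw [verticalNorm_isLittleO_iff (s := fun t => symp (fderiv ℝ F (t, z) (0, Y)) (F (t, z)))
    ((hline' 0 z hdF.self_of_nhds).continuousAt) hFr.self_of_nhds.ne_zero]
  · refine symp_isLittleO ?_ hS0
    convert hS using 1
    change _ = symp _ (F (0, z)) + symp _ (B z)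
    rw [eA', hA0, hB0]
    simp only [symp_eq, Pi.add_apply, Pi.smul_apply, smul_eq_mul] at p0 p1 ⊢
    linear_combination (2 * μ z * ν z * Y) * p0 + ((μ z) ^ 2 * Y) * p1
  · filter_upwards [hct.eventually hdF] with t ht
    rw [(hline t z ht).fderiv]
    simp

theorem IsPolyField.horizPolar_eq_zero {d : ℕ} {a : V d} {U : Coef d}
    {u : VectorField (polyMap a)} (hu : IsPolyField a U u) (ha : horizPoly a.1 = 0)
    (h : IsInfHorizontal (polyMap a) u) : horizPolar a.1 U = 0 := by
  refine Polynomial.funext fun z => ?_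
  obtain ⟨ε, hε, -⟩ := exists_isVariation_lineVar a U
  have hl := isSmoothLift_lineLift a U false (t := 0) z (by simp)
  have h1 := h _ ε hε hu.isTangentTo_lineVar false z _ hl 1
  rw [verticalNorm_isLittleO_iff (s := fun t : ℝ =>
    (t : ℂ) * (horizPolar a.1 U).eval z + (t : ℂ) ^ 2 * (horizPoly U).eval z)
    hl.differentiableAt_left.continuousAt hl.2.self_of_nhds.ne_zero] at h1
  · set p := (horizPolar a.1 U).eval z
    set q := (horizPoly U).eval z
    have d1 : HasDerivAt (fun t : ℝ => (t : ℂ) * p + (t : ℂ) ^ 2 * q) 0 0 := by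
      rw [hasDerivAt_iff_isLittleO]
      simpa using h1
    have d2 : HasDerivAt (fun t : ℝ => (t : ℂ) * p + (t : ℂ) ^ 2 * q) p 0 := by
      have e := Complex.ofRealCLM.hasDerivAt (x := (0 : ℝ))
      have := (e.mul_const p).add ((e.pow 2).mul_const q)
      exact this.congr_deriv (by simp)
    rw [eval_zero, d2.unique d1]
  · refine Filter.Eventually.of_forall fun t => ?_
    have e : (fun ζ => lineLift a.1 U false (t, ζ)) = evalC (a.1 + (t : ℂ) • U) := rfl
    rw [e, (hasFDerivAt_evalC _ z).fderiv]
    change symp ((1 : ℂ) • _) (evalC (a.1 + (t : ℂ) • U) z) = _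
    rw [one_smul, ← eval_horizPoly, horizPoly_add_smul, ha]
    simp

/-! ### The action of the symplectic group -/

/-- The action of a matrix on the coefficients of a quadruplet of polynomials. -/
def actC {d : ℕ} (A : Matrix (Fin 4) (Fin 4) ℂ) : Coef d →ₗ[ℂ] Coef d where
  toFun a := fun i k => A.mulVec (fun j => a j k) i
  map_add' a b := by
    ext i k
    exact congrFun (A.mulVec_add (fun j => a j k) (fun j => b j k)) i
  map_smul' c a := by
    ext i k
    exact congrFun (A.mulVec_smul c (fun j => a j k)) i

theorem actC_apply {d : ℕ} (A : Matrix (Fin 4) (Fin 4) ℂ) (a : Coef d) (i : Fin 4) :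
    actC A a i = ∑ j, A i j • a j := by
  ext k
  simp [actC, Matrix.mulVec, dotProduct]

theorem actC_actC {d : ℕ} (A B : Matrix (Fin 4) (Fin 4) ℂ) (a : Coef d) :
    actC A (actC B a) = actC (A * B) a := by
  ext i k
  exact congrFun (Matrix.mulVec_mulVec (fun j => a j k) A B) i

theorem actC_one {d : ℕ} (a : Coef d) : actC 1 a = a := by
  ext i k
  simp [actC]

theorem evalC_actC {d : ℕ} (A : Matrix (Fin 4) (Fin 4) ℂ) (a : Coef d) (z : ℂ) :
    evalC (actC A a) z = A.mulVec (evalC a z) := by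
  ext i
  simp [evalC_apply, actC_apply, Matrix.mulVec, dotProduct, eval_finsetSum]

theorem derivC_actC {d : ℕ} (A : Matrix (Fin 4) (Fin 4) ℂ) (a : Coef d) (z : ℂ) :
    derivC (actC A a) z = A.mulVec (derivC a z) := by
  ext i
  simp [derivC, actC_apply, Matrix.mulVec, dotProduct, eval_finsetSum]

theorem flipC_actC {d : ℕ} (c : Bool) (A : Matrix (Fin 4) (Fin 4) ℂ) (a : Coef d) :
    flipC c (actC A a) = actC A (flipC c a) := rfl

theorem symp_mulVec {A : Matrix (Fin 4) (Fin 4) ℂ} (hA : A.transpose * J0 * A = J0) (V W : C4) :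
    symp (A.mulVec V) (A.mulVec W) = symp V W := by
  have h : J0.mulVec W = A.transpose.mulVec (J0.mulVec (A.mulVec W)) := by
    conv_lhs => rw [← hA]
    simp only [Matrix.mulVec_mulVec, Matrix.mul_assoc]
  rw [symp, symp, h, Matrix.dotProduct_mulVec V, Matrix.vecMul_transpose]

theorem mul_mem_Sp2 {A B : Matrix (Fin 4) (Fin 4) ℂ} (hA : A ∈ Sp2) (hB : B ∈ Sp2) :
    A * B ∈ Sp2 := by
  refine ⟨mul_mem hA.1 hB.1, ?_⟩
  calc (A * B).transpose * J0 * (A * B)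
      = B.transpose * (A.transpose * J0 * A) * B := by
        rw [Matrix.transpose_mul]; simp only [Matrix.mul_assoc]
    _ = J0 := by rw [hA.2, hB.2]

theorem actC_star_actC {d : ℕ} {A : Matrix (Fin 4) (Fin 4) ℂ} (hA : A ∈ Sp2) (a : Coef d) :
    actC (star A) (actC A a) = a := by
  rw [actC_actC, Matrix.mem_unitaryGroup_iff'.mp hA.1, actC_one]

theorem actC_actC_star {d : ℕ} {A : Matrix (Fin 4) (Fin 4) ℂ} (hA : A ∈ Sp2) (a : Coef d) :
    actC A (actC (star A) a) = a := by
  rw [actC_actC, Matrix.mem_unitaryGroup_iff.mp hA.1, actC_one]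

theorem mulVec_ne_zero {A : Matrix (Fin 4) (Fin 4) ℂ} (hA : A ∈ Sp2) {W : C4} (hW : W ≠ 0) :
    A.mulVec W ≠ 0 := fun h => hW (by
  rw [← Matrix.one_mulVec W, ← Matrix.mem_unitaryGroup_iff'.mp hA.1, ← Matrix.mulVec_mulVec, h,
    Matrix.mulVec_zero])

theorem actC_mem_V {d : ℕ} {A : Matrix (Fin 4) (Fin 4) ℂ} (hA : A ∈ Sp2) {a : Coef d}
    (ha : a ∈ V d) : actC A a ∈ V d :=
  ⟨fun z => by rw [evalC_actC]; exact mulVec_ne_zero hA (ha.1 z), by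
    rw [← evalC_flipC_zero, flipC_actC, evalC_actC, evalC_flipC_zero]
    exact mulVec_ne_zero hA ha.2⟩

theorem horizPoly_actC {d : ℕ} {A : Matrix (Fin 4) (Fin 4) ℂ} (hA : A ∈ Sp2) (a : Coef d) :
    horizPoly (actC A a) = horizPoly a :=
  Polynomial.funext fun z => by
    rw [eval_horizPoly, eval_horizPoly, evalC_actC, derivC_actC, symp_mulVec hA.2]

theorem horizPolar_actC {d : ℕ} {A : Matrix (Fin 4) (Fin 4) ℂ} (hA : A ∈ Sp2) (a b : Coef d) :
    horizPolar (actC A a) (actC A b) = horizPolar a b :=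
  Polynomial.funext fun z => by
    rw [eval_horizPolar, eval_horizPolar, evalC_actC, derivC_actC, evalC_actC, derivC_actC,
      symp_mulVec hA.2, symp_mulVec hA.2]

/-- The quadruplet of polynomials with given components of even and of odd index. -/
def mixC {d : ℕ} (E O : Pair d) : Coef d := ![E.1, O.1, E.2, O.2]

@[simp] theorem evenC_mixC {d : ℕ} (E O : Pair d) : evenC (mixC E O) = E := rfl

@[simp] theorem oddC_mixC {d : ℕ} (E O : Pair d) : oddC (mixC E O) = O := rfl

theorem mixC_evenC_oddC {d : ℕ} (a : Coef d) : mixC (evenC a) (oddC a) = a := by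
  funext i
  fin_cases i <;> rfl

/-! ### Normal form of the non-full horizontal maps -/

theorem blockSU2_mem_Sp2 {x y x' y' : ℂ} (h : x * star x + y * star y = 1)
    (h' : x' * star x' + y' * star y' = 1) :
    !![star y, -star x, 0, 0; x, y, 0, 0; 0, 0, star y', -star x'; 0, 0, x', y'] ∈ Sp2 := by
  constructor
  · rw [Matrix.mem_unitaryGroup_iff]
    ext i j
    fin_cases i <;> fin_cases j <;>
      simp [Matrix.mul_apply, Fin.sum_univ_four, Matrix.star_apply] <;>
      simp only [← starRingEnd_apply] at h h' <;>
      first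
      | ring1
      | linear_combination h
      | linear_combination h'
  · ext i j
    fin_cases i <;> fin_cases j <;>
      simp [J0, Matrix.mul_apply, Fin.sum_univ_four] <;>
      simp only [← starRingEnd_apply] at h h' <;>
      first
      | ring1
      | linear_combination h
      | linear_combination -h
      | linear_combination h'
      | linear_combination -h'

theorem rotation_mem_Sp2 {x y : ℝ} (h : x ^ 2 + y ^ 2 = 1) :
    !![(x : ℂ), 0, (y : ℂ), 0; 0, (x : ℂ), 0, (y : ℂ); -(y : ℂ), 0, (x : ℂ), 0;
      0, -(y : ℂ), 0, (x : ℂ)] ∈ Sp2 := by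
  have h : (x : ℂ) ^ 2 + (y : ℂ) ^ 2 = 1 := by exact_mod_cast h
  constructor
  · rw [Matrix.mem_unitaryGroup_iff]
    ext i j
    fin_cases i <;> fin_cases j <;>
      simp [Matrix.mul_apply, Fin.sum_univ_four, Matrix.star_apply] <;>
      first
      | ring1
      | linear_combination h
  · ext i j
    fin_cases i <;> fin_cases j <;>
      simp [J0, Matrix.mul_apply, Fin.sum_univ_four] <;>
      first
      | ring1
      | linear_combination h
      | linear_combination -h

theorem exists_unit_pair (p q : ℂ) : ∃ (x y : ℂ) (n : ℝ), x * star x + y * star y = 1 ∧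
    p = n * x ∧ q = n * y ∧ n ^ 2 = ‖p‖ ^ 2 + ‖q‖ ^ 2 := by
  by_cases h : ‖p‖ ^ 2 + ‖q‖ ^ 2 = 0
  · have hp : p = 0 := by
      have : ‖p‖ ^ 2 = 0 := by nlinarith [sq_nonneg ‖p‖, sq_nonneg ‖q‖]
      simpa using this
    have hq : q = 0 := by
      have : ‖q‖ ^ 2 = 0 := by nlinarith [sq_nonneg ‖p‖, sq_nonneg ‖q‖]
      simpa using this
    exact ⟨1, 0, 0, by simp, by simp [hp], by simp [hq], by simp [hp, hq]⟩
  · have hs := Real.sq_sqrt (show 0 ≤ ‖p‖ ^ 2 + ‖q‖ ^ 2 by positivity)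
    set n := √(‖p‖ ^ 2 + ‖q‖ ^ 2)
    have hn : (n : ℂ) ≠ 0 := by
      intro h0
      rw [Complex.ofReal_eq_zero.mp h0] at hs
      exact h (by rw [← hs]; simp)
    refine ⟨p / n, q / n, n, ?_, by field_simp, by field_simp, hs⟩
    have e : p * star p + q * star q = (n : ℂ) ^ 2 := by
      have hp : p * star p = ((‖p‖ ^ 2 : ℝ) : ℂ) := by
        rw [Complex.star_def, Complex.mul_conj, Complex.normSq_eq_norm_sq]
      have hq : q * star q = ((‖q‖ ^ 2 : ℝ) : ℂ) := by
        rw [Complex.star_def, Complex.mul_conj, Complex.normSq_eq_norm_sq]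
      rw [hp, hq, ← Complex.ofReal_add, ← hs]; push_cast; ring
    have hsn : star (n : ℂ) = n := Complex.conj_ofReal n
    rw [star_div₀, star_div₀, hsn]
    field_simp
    linear_combination e

theorem coeff_X_mul_derivative (S : ℂ[X]) (n : ℕ) :
    (X * derivative S).coeff n = n * S.coeff n := by
  cases n with
  | zero => simp
  | succ n => rw [coeff_X_mul, coeff_derivative]; push_cast; ring

theorem natDegree_X_mul_derivative_le {S : ℂ[X]} {n : ℕ} (h : S.natDegree ≤ n) :
    (X * derivative S).natDegree ≤ n := by
  rw [natDegree_le_iff_coeff_eq_zero]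
  intro m hm
  rw [coeff_X_mul_derivative, coeff_eq_zero_of_natDegree_lt (h.trans_lt hm), mul_zero]

theorem X_mul_wronskian (P Q : ℂ[X]) :
    X * wronskian P Q = P * (X * derivative Q) - (X * derivative P) * Q := by
  rw [wronskian]; ring

theorem coeff_X_mul_wronskian {P Q : ℂ[X]} {m n : ℕ} (hP : P.natDegree ≤ m)
    (hQ : Q.natDegree ≤ n) :
    (X * wronskian P Q).coeff (m + n) = P.coeff m * Q.coeff n * (n - m) := by
  rw [X_mul_wronskian, coeff_sub,
    coeff_mul_add_eq_of_natDegree_le hP (natDegree_X_mul_derivative_le hQ),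
    coeff_mul_add_eq_of_natDegree_le (natDegree_X_mul_derivative_le hP) hQ,
    coeff_X_mul_derivative, coeff_X_mul_derivative]
  ring

/-- Polynomials with vanishing Wronskian are linearly dependent. -/
theorem exists_eq_smul_of_wronskian_eq_zero {P Q : ℂ[X]} (hP : P ≠ 0) (h : wronskian P Q = 0) :
    ∃ c : ℂ, Q = c • P := by
  -- the multiple of `P` is chosen to cancel the coefficient of `Q` in the degree of `P`
  set c := Q.coeff P.natDegree / P.leadingCoeff with hc
  refine ⟨c, ?_⟩
  set R := Q - c • P with hR
  have hw : wronskian P R = 0 := by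
    have e : wronskianBilin ℂ P Q = 0 := h
    change wronskianBilin ℂ P R = 0
    rw [hR, map_sub, map_smul, e, wronskianBilin_apply, wronskian_self_eq_zero]
    simp
  by_contra hne
  have hR0 : R ≠ 0 := fun h0 => hne (sub_eq_zero.mp h0)
  have hRc : R.coeff P.natDegree = 0 := by
    rw [hR, coeff_sub, coeff_smul, coeff_natDegree, hc, smul_eq_mul,
      div_mul_cancel₀ _ (leadingCoeff_ne_zero.mpr hP), sub_self]
  have hdeg : R.natDegree ≠ P.natDegree := fun h0 => hR0 (by
    rw [← h0, coeff_natDegree] at hRc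
    exact leadingCoeff_eq_zero.mp hRc)
  -- the coefficient of the Wronskian in degree `deg P + deg R - 1`, shifted by a factor `X`
  have e3 : (X * wronskian P R).coeff (P.natDegree + R.natDegree) =
      P.leadingCoeff * R.leadingCoeff * (R.natDegree - P.natDegree) := by
    rw [coeff_X_mul_wronskian le_rfl le_rfl, coeff_natDegree, coeff_natDegree]
  rw [hw, mul_zero, coeff_zero, eq_comm, mul_eq_zero, mul_eq_zero, leadingCoeff_eq_zero,
    leadingCoeff_eq_zero, sub_eq_zero (a := (R.natDegree : ℂ)), Nat.cast_inj] at e3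
  tauto

theorem exists_relation_of_wronskian_eq_zero {P Q : ℂ[X]} (h : wronskian P Q = 0) :
    ∃ x y : ℂ, (x ≠ 0 ∨ y ≠ 0) ∧ x • P + y • Q = 0 := by
  by_cases hP : P = 0
  · exact ⟨1, 0, by simp, by simp [hP]⟩
  · obtain ⟨c, rfl⟩ := exists_eq_smul_of_wronskian_eq_zero hP h
    exact ⟨c, -1, by simp, by simp⟩

theorem exists_relation_of_not_isFull {d : ℕ} {a : V d} (h : ¬ IsFull (polyMap a)) :
    ∃ l : C4, l ≠ 0 ∧ ∑ i, l i • a.1 i = 0 := by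
  obtain ⟨l, hl0, hl⟩ := not_not.mp h
  have hlW : ∀ W : C4, l W = ∑ i, l (Pi.single i 1) * W i := by
    intro W
    conv_lhs => rw [pi_eq_sum_univ' W]
    rw [map_sum]
    refine Finset.sum_congr rfl fun i _ => ?_
    rw [map_smul, smul_eq_mul, mul_comm]
  refine ⟨fun i => l (Pi.single i 1), fun h0 => hl0 ?_, polyOf_injective ?_⟩
  · ext W
    simpa using congrFun h0 W
  · refine Polynomial.funext fun z => ?_
    have := hl z (evalC a.1 z) (by
      rw [(isRep_polyMap_coe a z).submodule_eq]; exact Submodule.mem_span_singleton_self _)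
    rw [hlW] at this
    rw [map_zero, eval_zero, ← this, map_sum, eval_finsetSum]
    simp [evalC_apply]

/-- The coordinates of index `1` and `3` of a non-full horizontal map can be made zero by an
element of `Sp(2)`. -/
theorem exists_normal_form {d : ℕ} {a : V d} (hH : horizPoly a.1 = 0)
    (hN : ¬ IsFull (polyMap a)) : ∃ A ∈ Sp2, oddC (actC A a.1) = 0 := by
  obtain ⟨l, hl0, hl⟩ := exists_relation_of_not_isFull hN
  obtain ⟨x, y, n, h1, hx, hy, hn⟩ := exists_unit_pair (l 0) (l 1)
  obtain ⟨x', y', n', h1', hx', hy', hn'⟩ := exists_unit_pair (l 2) (l 3)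
  have hA1 := blockSU2_mem_Sp2 h1 h1'
  set A1 := !![star y, -star x, 0, 0; x, y, 0, 0; 0, 0, star y', -star x'; 0, 0, x', y']
  obtain ⟨r, s, m, h2, hr, hs, hm⟩ : ∃ r s m : ℝ, r ^ 2 + s ^ 2 = 1 ∧ n = m * r ∧ n' = m * s ∧
      m ≠ 0 := by
    have hpos : 0 < n ^ 2 + n' ^ 2 := by
      rw [hn, hn']
      have := sum_norm_sq_pos hl0
      rw [Fin.sum_univ_four] at this
      linarith
    have hm : √(n ^ 2 + n' ^ 2) ≠ 0 := (Real.sqrt_pos.mpr hpos).ne'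
    have hsq := Real.sq_sqrt hpos.le
    refine ⟨n / √(n ^ 2 + n' ^ 2), n' / √(n ^ 2 + n' ^ 2), √(n ^ 2 + n' ^ 2), ?_,
      by field_simp, by field_simp, hm⟩
    rw [div_pow, div_pow, hsq]
    field_simp
  have hA2 := rotation_mem_Sp2 h2
  set A2 := !![(r : ℂ), 0, (s : ℂ), 0; 0, (r : ℂ), 0, (s : ℂ); -(s : ℂ), 0, (r : ℂ), 0;
      0, -(s : ℂ), 0, (r : ℂ)]
  have hB := mul_mem_Sp2 hA2 hA1
  have hb1 : actC (A2 * A1) a.1 1 = 0 := by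
    rw [← actC_actC, actC_apply]
    simp only [actC_apply, Fin.sum_univ_four]
    simp [A1, A2, -Complex.coe_smul]
    rw [Fin.sum_univ_four, hx, hy, hx', hy', hr, hs] at hl
    refine (smul_eq_zero_iff_right (show (m : ℂ) ≠ 0 by simpa using hm)).mp ?_
    rw [← hl]
    push_cast
    module
  set b := actC (A2 * A1) a.1 with hb
  have hbH : horizPoly b = 0 := by rw [hb, horizPoly_actC hB, hH]
  have hw : wronskian (polyOf (b 2)) (polyOf (b 3)) = 0 := by
    rw [horizPoly, wron_apply, evenC_apply, oddC_apply] at hbH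
    simpa [hb1] using hbH
  obtain ⟨p, q, hpq, hrel⟩ := exists_relation_of_wronskian_eq_zero hw
  obtain ⟨u, v, k, h3, hu, hv, -⟩ := exists_unit_pair p q
  have hk : (k : ℂ) ≠ 0 := by
    intro hk
    rw [hk] at hu hv
    simp [hu, hv] at hpq
  have hA3 := blockSU2_mem_Sp2 (x := 0) (y := 1) (by simp) h3
  refine ⟨_, mul_mem_Sp2 hA3 hB, ?_⟩
  rw [← actC_actC, ← hb, oddC_apply]
  refine Prod.ext ?_ ?_
  · simp only [actC_apply, Fin.sum_univ_four]
    simp [hb1]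
  · simp only [actC_apply, Fin.sum_univ_four]
    simp
    rw [← map_smul, ← map_smul, ← map_add] at hrel
    have := polyOf_injective (hrel.trans (map_zero _).symm)
    refine (smul_eq_zero_iff_right hk).mp ?_
    rw [← this, hu, hv]
    module

/-! ### Extra fields -/

/-- The pairs in the span of `(F₀, 0)`, `(0, F₂)` and `(F₂, F₀)`: the normal components of the
infinitesimal deformations of `[F₀, 0, F₂, 0]` through non-full horizontal maps. -/
def trivialNormal {d : ℕ} (F : Pair d) : Submodule ℂ (Pair d) :=
  Submodule.span ℂ (Set.range ![(F.1, 0), (0, F.2), (F.2, F.1)])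

theorem mem_trivialNormal {d : ℕ} {F N : Pair d} : N ∈ trivialNormal F ↔
    ∃ α β γ : ℂ, N.1 = α • F.1 + γ • F.2 ∧ N.2 = β • F.2 + γ • F.1 := by
  rw [trivialNormal, Submodule.mem_span_range_iff_exists_fun]
  constructor
  · rintro ⟨c, rfl⟩
    exact ⟨c 0, c 1, c 2, by simp [Fin.sum_univ_three], by simp [Fin.sum_univ_three]⟩
  · rintro ⟨α, β, γ, h1, h2⟩
    refine ⟨![α, β, γ], ?_⟩
    ext1 <;> simp [Fin.sum_univ_three, h1, h2]

theorem wron_of_mem_trivialNormal {d : ℕ} {F N : Pair d} (h : N ∈ trivialNormal F) :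
    wron d F N = 0 := by
  obtain ⟨α, β, γ, h1, h2⟩ := mem_trivialNormal.mp h
  rw [wron_apply, h1, h2]
  simp only [map_add, map_smul, wronskian, smul_eq_C_mul, derivative_C_mul]
  ring

theorem IsPolyField.exists_eq {d : ℕ} {a : V d} {U : Coef d} {u : VectorField (polyMap a)}
    (hu : IsPolyField a U u) {c : Bool} {z : ℂ} {W W' : C4}
    (h : IsDp (polyMap a (chart c z)) (u (chart c z)) W W') :
    ∃ r s : ℂ, W = r • evalC (flipC c a.1) z ∧
      W' = r • evalC (flipC c U) z + s • evalC (flipC c a.1) z := by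
  obtain ⟨r, hr, hW⟩ := (isRep_polyMap a c z).exists_smul h.isRep
  have h2 := (hu c z).smul_add hr 0
  rw [zero_smul, add_zero, ← hW] at h2
  obtain ⟨s, hs⟩ := h2.exists_eq_add h
  exact ⟨r, s * r, hW, by rw [hs, hW, smul_smul]⟩

/-- The condition that defines extra fields, in terms of polynomials. -/
theorem IsPolyField.normal_iff {d : ℕ} {a : V d} {U : Coef d} {u : VectorField (polyMap a)}
    (hu : IsPolyField a U u) {A : Matrix (Fin 4) (Fin 4) ℂ} (hA : oddC (actC A a.1) = 0) :
    (∃ α β γ : ℂ, ∀ (x : S2) (W U : C4), IsDp (polyMap a x) (u x) W U →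
      A.mulVec U 1 = α * A.mulVec W 0 + γ * A.mulVec W 2 ∧
      A.mulVec U 3 = β * A.mulVec W 2 + γ * A.mulVec W 0) ↔
    oddC (actC A U) ∈ trivialNormal (evenC (actC A a.1)) := by
  rw [mem_trivialNormal]
  refine exists_congr fun α => exists_congr fun β => exists_congr fun γ => ?_
  constructor
  · intro h
    constructor <;> refine polyOf_injective (Polynomial.funext fun z => ?_)
    · have := (h _ _ _ (hu false z)).1
      simp only [flipC_false, ← evalC_actC, evalC_apply] at this
      simpa [evenC_apply, oddC_apply] using this
    · have := (h _ _ _ (hu false z)).2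
      simp only [flipC_false, ← evalC_actC, evalC_apply] at this
      simpa [evenC_apply, oddC_apply] using this
  · rintro ⟨h1, h2⟩ x W U' hD
    obtain ⟨c, z, rfl⟩ := exists_chart x
    obtain ⟨r, s, rfl, rfl⟩ := hu.exists_eq hD
    have e1 : actC A a.1 1 = 0 := congrArg Prod.fst hA
    have e3 : actC A a.1 3 = 0 := congrArg Prod.snd hA
    have f1 : flipC c (actC A a.1) 1 = 0 := by ext k; exact congrFun e1 _
    have f3 : flipC c (actC A a.1) 3 = 0 := by ext k; exact congrFun e3 _
    have g1 : flipC c (actC A U) 1 =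
        α • flipC c (actC A a.1) 0 + γ • flipC c (actC A a.1) 2 := by ext k; exact congrFun h1 _
    have g3 : flipC c (actC A U) 3 =
        β • flipC c (actC A a.1) 2 + γ • flipC c (actC A a.1) 0 := by ext k; exact congrFun h2 _
    simp only [Matrix.mulVec_add, Matrix.mulVec_smul, ← evalC_actC, ← flipC_actC, Pi.add_apply,
      Pi.smul_apply, evalC_apply, f1, f3, g1, g3, map_add, map_smul, map_zero, eval_add, eval_smul,
      eval_zero, smul_eq_mul]
    constructor <;> ring

theorem oddC_actC_eq_zero_iff {d : ℕ} {a : V d} {A : Matrix (Fin 4) (Fin 4) ℂ} :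
    (∀ x, ∀ W ∈ (polyMap a x).submodule, A.mulVec W 1 = 0 ∧ A.mulVec W 3 = 0) ↔
      oddC (actC A a.1) = 0 := by
  constructor
  · intro h
    have hz : ∀ z, evalC (actC A a.1) z 1 = 0 ∧ evalC (actC A a.1) z 3 = 0 := by
      intro z
      rw [evalC_actC]
      refine h z _ ?_
      rw [(isRep_polyMap_coe a z).submodule_eq]
      exact Submodule.mem_span_singleton_self _
    refine Prod.ext ?_ ?_ <;> refine polyOf_injective (Polynomial.funext fun z => ?_)
    · simpa [evalC_apply, oddC_apply] using (hz z).1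
    · simpa [evalC_apply, oddC_apply] using (hz z).2
  · intro h x W hW
    obtain ⟨c, z, rfl⟩ := exists_chart x
    rw [(isRep_polyMap a c z).submodule_eq, Submodule.mem_span_singleton] at hW
    obtain ⟨r, rfl⟩ := hW
    have e1 : actC A a.1 1 = 0 := congrArg Prod.fst h
    have e3 : actC A a.1 3 = 0 := congrArg Prod.snd h
    have f1 : flipC c (actC A a.1) 1 = 0 := by ext k; exact congrFun e1 _
    have f3 : flipC c (actC A a.1) 3 = 0 := by ext k; exact congrFun e3 _
    simp only [Matrix.mulVec_smul, ← evalC_actC, ← flipC_actC, Pi.smul_apply, evalC_apply, f1, f3,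
      map_zero, eval_zero, smul_zero, and_self]

theorem IsPolyField.isExtra_iff {d : ℕ} {a : V d} {U : Coef d} {u : VectorField (polyMap a)}
    (hu : IsPolyField a U u) : IsExtra (polyMap a) u ↔ ∃ A ∈ Sp2, oddC (actC A a.1) = 0 ∧
      oddC (actC A U) ∉ trivialNormal (evenC (actC A a.1)) := by
  refine exists_congr fun A => and_congr_right fun _ => ?_
  rw [oddC_actC_eq_zero_iff]
  exact and_congr_right fun hA => not_congr (hu.normal_iff hA)

/-! ### Holomorphic vector fields are polynomial -/

/-- An entire function of polynomial growth is a polynomial. -/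
theorem exists_polynomial_of_growth (n : ℕ) {f : ℂ → ℂ} (hf : Differentiable ℂ f) {K : ℝ}
    (hK : ∀ z, 1 ≤ ‖z‖ → ‖f z‖ ≤ K * ‖z‖ ^ n) :
    ∃ P : ℂ[X], P.natDegree ≤ n ∧ ∀ z, f z = P.eval z := by
  induction n generalizing f K with
  | zero =>
    have hb : Bornology.IsBounded (Set.range f) := by
      obtain ⟨M, hM⟩ := (isCompact_closedBall (0 : ℂ) 1).exists_bound_of_continuousOn
        hf.continuous.continuousOn
      rw [isBounded_iff_forall_norm_le]
      refine ⟨max M K, ?_⟩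
      rintro _ ⟨z, rfl⟩
      by_cases hz : ‖z‖ ≤ 1
      · exact (hM z (by simpa using hz)).trans (le_max_left _ _)
      · have := hK z (not_le.mp hz).le
        rw [pow_zero, mul_one] at this
        exact this.trans (le_max_right _ _)
    exact ⟨C (f 0), by simp, fun z => by simpa using hf.apply_eq_apply_of_bounded hb z 0⟩
  | succ n ih =>
    have hg : Differentiable ℂ (dslope f 0) := by
      rw [← differentiableOn_univ, Complex.differentiableOn_dslope Filter.univ_mem]
      exact hf.differentiableOn
    have hbound : ∀ z : ℂ, 1 ≤ ‖z‖ → ‖dslope f 0 z‖ ≤ (K + ‖f 0‖) * ‖z‖ ^ n := by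
      intro z hz
      have hz0 : z ≠ 0 := norm_pos_iff.mp (one_pos.trans_le hz)
      rw [dslope_of_ne _ hz0, slope_def_field, sub_zero, norm_div, div_le_iff₀ (by positivity)]
      calc ‖f z - f 0‖ ≤ ‖f z‖ + ‖f 0‖ := norm_sub_le _ _
        _ ≤ K * ‖z‖ ^ (n + 1) + ‖f 0‖ * ‖z‖ ^ (n + 1) :=
          add_le_add (hK z hz) (le_mul_of_one_le_right (norm_nonneg _) (one_le_pow₀ hz))
        _ = (K + ‖f 0‖) * ‖z‖ ^ n * ‖z‖ := by ring
    obtain ⟨P, hP, h⟩ := ih hg hbound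
    refine ⟨C (f 0) + X * P, ?_, fun z => ?_⟩
    · refine (natDegree_add_le _ _).trans (max_le (by simp) (natDegree_mul_le.trans ?_))
      rw [natDegree_X]; omega
    · have := sub_smul_dslope f 0 z
      rw [smul_eq_mul, sub_zero, h z] at this
      simp [this]

theorem polyOf_flipC_true {d : ℕ} (a : Coef d) (i : Fin 4) :
    polyOf (flipC true a i) = (polyOf (a i)).reflect d := by
  ext n
  rw [coeff_reflect]
  by_cases hn : n ≤ d
  · have h1 := coeff_polyOf (flipC true a i) ⟨n, Nat.lt_succ_of_le hn⟩
    have h2 := coeff_polyOf (a i) (⟨n, Nat.lt_succ_of_le hn⟩ : Fin (d + 1)).rev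
    rw [revAt_le hn]
    have e : ((⟨n, Nat.lt_succ_of_le hn⟩ : Fin (d + 1)).rev : ℕ) = d - n := by
      rw [Fin.val_rev]; simp
    rw [e] at h2
    exact h1.trans h2.symm
  · push Not at hn
    rw [revAt_eq_self_of_lt hn, coeff_eq_zero_of_natDegree_lt ((natDegree_polyOf_le _).trans_lt hn),
      coeff_eq_zero_of_natDegree_lt ((natDegree_polyOf_le _).trans_lt hn)]

/-- The pairing of a holomorphic field with polynomials that annihilate the map is a polynomial,
in both charts. -/
theorem exists_pairing {d e : ℕ} {a : V d} {u : VectorField (polyMap a)}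
    (hu : IsHolomorphicField (polyMap a) u) {q : Coef e}
    (hq : ∑ i, polyOf (q i) * polyOf (a.1 i) = 0) :
    ∃ R : Coef (d + e), ∀ c z U, IsDp (polyMap a (chart c z)) (u (chart c z))
      (evalC (flipC c a.1) z) U → ∑ i, evalC (flipC c q) z i * U i = evalC (flipC c R) z 0 := by
  have hqc : ∀ c z, ∑ i, evalC (flipC c q) z i * evalC (flipC c a.1) z i = 0 := by
    intro c z
    have : ∑ i, polyOf (flipC c q i) * polyOf (flipC c a.1 i) = 0 := by
      cases c
      · exact hq
      · simp only [polyOf_flipC_true]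
        have h2 := congrArg (reflect (e + d)) hq
        simp only [Fin.sum_univ_four, reflect_add, reflect_zero,
          reflect_mul _ _ (natDegree_polyOf_le _) (natDegree_polyOf_le _)] at h2 ⊢
        exact h2
    have h2 := congrArg (eval z) this
    simpa [eval_finsetSum, evalC_apply] using h2
  choose U hU using fun c z => (isRep_polyMap a c z).exists_isDp (u (chart c z))
  set v : Bool → ℂ → ℂ := fun c z => ∑ i, evalC (flipC c q) z i * U c z i with hv
  have huniq : ∀ c z W, IsDp (polyMap a (chart c z)) (u (chart c z)) (evalC (flipC c a.1) z) W →
      ∑ i, evalC (flipC c q) z i * W i = v c z := by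
    intro c z W hW
    obtain ⟨r, rfl⟩ := (hU c z).exists_eq_add hW
    have e : ∀ i, evalC (flipC c q) z i * (U c z + r • evalC (flipC c a.1) z) i =
        evalC (flipC c q) z i * U c z i +
          r * (evalC (flipC c q) z i * evalC (flipC c a.1) z i) := fun i => by
      simp only [Pi.add_apply, Pi.smul_apply, smul_eq_mul]; ring
    simp only [e, Finset.sum_add_distrib, ← Finset.mul_sum, hqc, mul_zero, add_zero, hv]
  have hdiff : ∀ c, Differentiable ℂ (v c) := by
    intro c z
    obtain ⟨F, W, hF, hW, hD⟩ := hu c z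
    have hb := analyticAt_evalC (flipC c a.1) z
    obtain ⟨i, hi, hr, h3⟩ := exists_ratio (p := fun ζ => polyMap a (chart c ζ)) hF.continuousAt
      (Filter.Eventually.of_forall fun ζ => isRep_polyMap a c ζ) (hD.mono fun ζ h => h.isRep)
    have hev : v c =ᶠ[𝓝 z] fun ζ => ∑ j, evalC (flipC c q) ζ j *
        (evalC (flipC c a.1) ζ i / F ζ i * W ζ j) := by
      filter_upwards [hD, hr, h3] with ζ h1 h2 h3
      have h4 := h1.smul_add h2 0
      rw [zero_smul, add_zero, ← h3] at h4
      rw [← huniq c ζ _ h4]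
      rfl
    refine AnalyticAt.differentiableAt ?_
    refine AnalyticAt.congr ?_ hev.symm
    refine Finset.analyticAt_fun_sum _ fun j _ => ?_
    have hb' := analyticAt_pi_iff.mp hb
    have hF' := analyticAt_pi_iff.mp hF
    have hW' := analyticAt_pi_iff.mp hW
    have hq' := analyticAt_pi_iff.mp (analyticAt_evalC (flipC c q) z)
    exact (hq' j).fun_mul (((hb' i).fun_div (hF' i) hi.self_of_nhds).fun_mul (hW' j))
  have hrel : ∀ w : ℂ, w ≠ 0 → v true w = w ^ (d + e) * v false w⁻¹ := by
    intro w hw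
    have e1 : chart true w = chart false w⁻¹ := by simp [chart, hw]
    have h1 := (hU false w⁻¹).smul_add (pow_ne_zero d hw) 0
    rw [zero_smul, add_zero, ← e1, flipC_false, ← evalC_flipC _ hw] at h1
    rw [← huniq true w _ h1, hv, Finset.mul_sum]
    refine Finset.sum_congr rfl fun i _ => ?_
    rw [evalC_flipC _ hw, flipC_false]
    simp only [Pi.smul_apply, smul_eq_mul]; ring
  obtain ⟨K, hK⟩ := (isCompact_closedBall (0 : ℂ) 1).exists_bound_of_continuousOn
    (hdiff true).continuous.continuousOn
  obtain ⟨P, hP, hPv⟩ := exists_polynomial_of_growth (d + e) (hdiff false) (K := K) (by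
    intro z hz
    have hz0 : z ≠ 0 := norm_pos_iff.mp (one_pos.trans_le hz)
    have h1 := hrel z⁻¹ (inv_ne_zero hz0)
    rw [inv_inv, inv_pow] at h1
    have h2 : v false z = z ^ (d + e) * v true z⁻¹ := by
      rw [h1, mul_inv_cancel_left₀ (pow_ne_zero _ hz0)]
    rw [h2, norm_mul, norm_pow, mul_comm]
    exact mul_le_mul_of_nonneg_right (hK _ (by simpa using inv_le_one_of_one_le₀ hz))
      (by positivity))
  obtain ⟨p, rfl⟩ := exists_polyOf_eq hP
  refine ⟨fun _ => p, fun c z W hW => ?_⟩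
  rw [huniq c z W hW]
  cases c with
  | false => rw [hPv, flipC_false, evalC_apply]
  | true =>
    have h1 : ∀ w : ℂ, w ≠ 0 → v true w = evalC (flipC true fun _ => p) w 0 := fun w hw => by
      rw [hrel w hw, hPv, evalC_flipC _ hw, Pi.smul_apply, evalC_apply, smul_eq_mul]
    by_cases hz : z = 0
    · subst hz
      have c1 := ((hdiff true).continuous.tendsto 0).mono_left (nhdsWithin_le_nhds (s := {0}ᶜ))
      have c2 := (((continuous_apply (0 : Fin 4)).continuousAt.comp
        (hasDerivAt_evalC (flipC true fun _ => p) 0).continuousAt).tendsto).mono_left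
          (nhdsWithin_le_nhds (s := {0}ᶜ))
      refine tendsto_nhds_unique c1 (c2.congr' ?_)
      filter_upwards [self_mem_nhdsWithin] with w hw using (h1 w hw).symm
    · exact h1 z hz

/-- The map `(U₀, U₂) ↦ U₀ F₂ - U₂ F₀`. -/
def crossF {d : ℕ} (F : Pair d) : Pair d →ₗ[ℂ] ℂ[X] :=
  (LinearMap.mulRight ℂ (polyOf F.2)) ∘ₗ polyOf ∘ₗ LinearMap.fst ℂ _ _ -
    (LinearMap.mulRight ℂ (polyOf F.1)) ∘ₗ polyOf ∘ₗ LinearMap.snd ℂ _ _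

theorem crossF_apply {d : ℕ} (F U : Pair d) :
    crossF F U = polyOf U.1 * polyOf F.2 - polyOf U.2 * polyOf F.1 := rfl

/-- For coprime `F₀`, `F₂` of maximal degree `d`, every polynomial of degree at most `2 d` is of
the form `U₀ F₂ - U₂ F₀`, because the kernel of this map is spanned by `(F₀, F₂)`. -/
theorem exists_crossF_eq {d : ℕ} {F : Pair d} (hF : mixC F 0 ∈ V d) {P : ℂ[X]}
    (hP : P.natDegree ≤ d + d) : ∃ U, crossF F U = P := by
  have hmem : ∀ {Q : ℂ[X]}, Q.natDegree ≤ d + d → Q ∈ degreeLT ℂ (d + d + 1) := by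
    intro Q hQ
    rw [degreeLT_succ_eq_degreeLE, mem_degreeLE]
    exact degree_le_of_natDegree_le hQ
  have hdeg : ∀ U, (crossF F U).natDegree ≤ d + d := fun U =>
    (natDegree_sub_le _ _).trans (max_le
      (natDegree_mul_le.trans (add_le_add (natDegree_polyOf_le _) (natDegree_polyOf_le _)))
      (natDegree_mul_le.trans (add_le_add (natDegree_polyOf_le _) (natDegree_polyOf_le _))))
  let L : Pair d →ₗ[ℂ] degreeLT ℂ (d + d + 1) :=
    (crossF F).codRestrict _ fun U => hmem (hdeg U)
  have hker : L.ker ≤ Submodule.span ℂ {F} := by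
    intro U hU
    have h0 : crossF F U = 0 := congrArg Subtype.val (LinearMap.mem_ker.mp hU)
    rw [crossF_apply] at h0
    obtain ⟨c, hc⟩ := exists_eq_smul_of_proportional (b := mixC U 0) hF fun n i j => by
      have h1 := congrArg (eval ((n : ℕ) : ℂ)) h0
      simp only [eval_sub, eval_mul, eval_zero] at h1
      simp only [evalC_apply]
      fin_cases i <;> fin_cases j <;> simp [mixC] <;>
        first
        | ring1
        | linear_combination h1
        | linear_combination -h1
    rw [Submodule.mem_span_singleton]
    refine ⟨c, ?_⟩
    have := congrArg evenC hc
    rw [map_smul, evenC_mixC, evenC_mixC] at this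
    exact this.symm
  have h1 : Module.finrank ℂ L.ker ≤ 1 :=
    (Submodule.finrank_mono hker).trans ((finrank_span_le_card _).trans (by simp))
  have h2 := L.finrank_range_add_finrank_ker
  have h3 : Module.finrank ℂ (Pair d) = (d + 1) + (d + 1) := by simp
  have h4 : Module.finrank ℂ (degreeLT ℂ (d + d + 1)) = d + d + 1 := by
    rw [(degreeLTEquiv ℂ (d + d + 1)).finrank_eq]; simp
  have h5 : L.range = ⊤ := Submodule.eq_top_of_finrank_eq (by
    have := Submodule.finrank_le L.range
    omega)
  obtain ⟨U, hU⟩ := LinearMap.range_eq_top.mp h5 ⟨P, hmem hP⟩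
  exact ⟨U, congrArg Subtype.val hU⟩

/-- A holomorphic field along a map into `{[z₀, 0, z₂, 0]}`, up to `Sp(2)`, is polynomial. -/
theorem exists_isPolyField_eq {d : ℕ} {a : V d} {u : VectorField (polyMap a)}
    (hu : IsHolomorphicField (polyMap a) u) {A : Matrix (Fin 4) (Fin 4) ℂ} (hA : A ∈ Sp2)
    (ha : oddC (actC A a.1) = 0) : ∃ U, IsPolyField a U u := by
  have hsum : ∀ i, ∑ j, A i j • a.1 j = actC A a.1 i := fun i => (actC_apply A a.1 i).symm
  have e1 : actC A a.1 1 = 0 := congrArg Prod.fst ha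
  have e3 : actC A a.1 3 = 0 := congrArg Prod.snd ha
  set F := evenC (actC A a.1) with hF
  have hFV : mixC F 0 ∈ V d := by
    rw [← ha, hF, mixC_evenC_oddC]; exact actC_mem_V hA a.2
  -- the rows of `A` pair with the field to give its normal components
  have hrow : ∀ i, actC A a.1 i = 0 → ∃ R : Coef d, ∀ c z U,
      IsDp (polyMap a (chart c z)) (u (chart c z)) (evalC (flipC c a.1) z) U →
        A.mulVec U i = evalC (flipC c R) z 0 := by
    intro i hi
    obtain ⟨R, hR⟩ := exists_pairing (e := 0) hu (q := fun j _ => A i j) (by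
      have : ∀ j, polyOf (d := 0) (fun _ => A i j) = C (A i j) := fun j => by
        simp [polyOf_eq_sum]
      simp only [this, ← smul_eq_C_mul, ← map_smul, ← map_sum, hsum, hi, map_zero])
    refine ⟨R, fun c z U h => ?_⟩
    rw [← hR c z U h]
    simp [Matrix.mulVec, dotProduct, evalC, flipC]
  obtain ⟨R1, hR1⟩ := hrow 1 e1
  obtain ⟨R3, hR3⟩ := hrow 3 e3
  obtain ⟨T, hT⟩ := exists_pairing (e := d) hu (q := fun j => A 0 j • F.2 - A 2 j • F.1) (by
    have : ∀ j, polyOf (A 0 j • F.2 - A 2 j • F.1) * polyOf (a.1 j) =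
        polyOf F.2 * polyOf (A 0 j • a.1 j) - polyOf F.1 * polyOf (A 2 j • a.1 j) := fun j => by
      simp only [map_sub, map_smul, smul_eq_C_mul]; ring
    simp only [this, Finset.sum_sub_distrib, ← Finset.mul_sum, ← map_sum, hsum]
    change polyOf F.2 * polyOf F.1 - polyOf F.1 * polyOf F.2 = 0
    ring)
  obtain ⟨E, hE⟩ := exists_crossF_eq hFV (natDegree_polyOf_le (T 0))
  set U := actC (star A) (mixC E (R1 0, R3 0)) with hU
  have hAU : actC A U = mixC E (R1 0, R3 0) := actC_actC_star hA _
  refine ⟨U, fun c z => ?_⟩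
  obtain ⟨W, hW⟩ := (isRep_polyMap a c z).exists_isDp (u (chart c z))
  set b := flipC c (actC A a.1) with hb
  set w := flipC c (actC A U) with hw
  have hb0 : evalC b z ≠ 0 := (flipC_mem_V c (actC_mem_V hA a.2)).1 z
  have b1 : evalC b z 1 = 0 := by
    have : b 1 = 0 := by ext k; exact congrFun e1 _
    rw [evalC_apply, this, map_zero, eval_zero]
  have b3 : evalC b z 3 = 0 := by
    have : b 3 = 0 := by ext k; exact congrFun e3 _
    rw [evalC_apply, this, map_zero, eval_zero]
  have w1 : A.mulVec W 1 = evalC w z 1 := by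
    rw [hR1 c z W hW, hw, hAU]; rfl
  have w3 : A.mulVec W 3 = evalC w z 3 := by
    rw [hR3 c z W hW, hw, hAU]; rfl
  have hcross : evalC w z 0 * evalC b z 2 - evalC w z 2 * evalC b z 0 =
      evalC (flipC c T) z 0 := by
    have : polyOf (w 0) * polyOf (b 2) - polyOf (w 2) * polyOf (b 0) = polyOf (flipC c T 0) := by
      rw [hw, hAU, hb]
      cases c
      · exact hE
      · simp only [polyOf_flipC_true]
        rw [← hE, crossF_apply, reflect_sub,
          reflect_mul _ _ (natDegree_polyOf_le _) (natDegree_polyOf_le _),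
          reflect_mul _ _ (natDegree_polyOf_le _) (natDegree_polyOf_le _)]
        rfl
    simpa [evalC_apply] using congrArg (eval z) this
  have hcross' : A.mulVec W 0 * evalC b z 2 - A.mulVec W 2 * evalC b z 0 =
      evalC (flipC c T) z 0 := by
    rw [← hT c z W hW]
    have : ∀ j, evalC (flipC c fun j => A 0 j • F.2 - A 2 j • F.1) z j =
        A 0 j * evalC b z 2 - A 2 j * evalC b z 0 := by
      intro j
      have : (flipC c fun j => A 0 j • F.2 - A 2 j • F.1) j = A 0 j • b 2 - A 2 j • b 0 := rfl
      rw [evalC_apply, this]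
      simp [evalC_apply]
    simp only [this, Matrix.mulVec, dotProduct, Finset.sum_mul]
    rw [← Finset.sum_sub_distrib]
    exact Finset.sum_congr rfl fun j _ => by ring
  -- the difference of the two lifts is proportional to the map
  obtain ⟨k, hk0, hk2⟩ : ∃ k, A.mulVec W 0 = evalC w z 0 + k * evalC b z 0 ∧
      A.mulVec W 2 = evalC w z 2 + k * evalC b z 2 := by
    by_cases h0 : evalC b z 0 = 0
    · have h2 : evalC b z 2 ≠ 0 := fun h2 => hb0 (by
        ext i; fin_cases i <;> simp [h0, b1, h2, b3])
      refine ⟨(A.mulVec W 2 - evalC w z 2) / evalC b z 2, ?_, by field_simp; ring⟩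
      rw [h0, mul_zero, add_zero]
      refine mul_right_cancel₀ h2 ?_
      rw [h0] at hcross hcross'
      linear_combination hcross' - hcross
    · refine ⟨(A.mulVec W 0 - evalC w z 0) / evalC b z 0, by field_simp; ring, ?_⟩
      field_simp
      linear_combination hcross - hcross'
  have hfin : A.mulVec W = A.mulVec (evalC (flipC c U) z + k • evalC (flipC c a.1) z) := by
    rw [Matrix.mulVec_add, Matrix.mulVec_smul, ← evalC_actC, ← evalC_actC, ← flipC_actC,
      ← flipC_actC, ← hb, ← hw]
    ext i
    fin_cases i
    · simpa using hk0
    · simpa [b1] using w1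
    · simpa using hk2
    · simpa [b3] using w3
  have hWeq : W = evalC (flipC c U) z + k • evalC (flipC c a.1) z := by
    have := congrArg (star A).mulVec hfin
    simpa only [Matrix.mulVec_mulVec, Matrix.mem_unitaryGroup_iff'.mp hA.1, Matrix.one_mulVec]
      using this
  have := hW.smul_add one_ne_zero (-k)
  rw [one_smul, one_smul] at this
  convert this using 1
  rw [hWeq]; module

/-! ### The linearized equation at a map into a line -/

/-- The Wronskian of two polynomials of degree at most `d` has degree at most `2 d - 2`, since
the coefficients of degree `2 d - 1` cancel. -/
theorem coeff_wron_eq_zero {d n : ℕ} (F N : Pair d) (h : 2 * d - 1 ≤ n) :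
    (wron d F N).coeff n = 0 := by
  have key : ∀ p q : Fin (d + 1) → ℂ, (wronskian (polyOf p) (polyOf q)).coeff n = 0 := by
    intro p q
    rw [← coeff_X_mul]
    have hp := natDegree_polyOf_le p
    have hq := natDegree_polyOf_le q
    rcases (show n + 1 = d + d ∨ d + d < n + 1 by omega) with h1 | h1
    · rw [h1, coeff_X_mul_wronskian hp hq, sub_self, mul_zero]
    · refine coeff_eq_zero_of_natDegree_lt (lt_of_le_of_lt ?_ h1)
      rw [X_mul_wronskian]
      exact (natDegree_sub_le _ _).trans (max_le
        (natDegree_mul_le.trans (add_le_add hp (natDegree_X_mul_derivative_le hq)))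
        (natDegree_mul_le.trans (add_le_add (natDegree_X_mul_derivative_le hp) hq)))
  rw [wron_apply, coeff_add, key, key, add_zero]

/-- The coefficients of `wron d F N`. -/
def wronV (d : ℕ) : Pair d →ₗ[ℂ] Pair d →ₗ[ℂ] (Fin (2 * d - 1) → ℂ) :=
  (wron d).compr₂ (LinearMap.pi fun k => lcoeff ℂ (k : ℕ))

theorem wronV_eq_zero_iff {d : ℕ} {F N : Pair d} : wronV d F N = 0 ↔ wron d F N = 0 := by
  constructor
  · intro h
    ext n
    rw [coeff_zero]
    by_cases hn : n < 2 * d - 1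
    · exact congrFun h ⟨n, hn⟩
    · exact coeff_wron_eq_zero F N (not_lt.mp hn)
  · intro h
    ext k
    change (wron d F N).coeff k = 0
    rw [h, coeff_zero]

theorem eq_zero_of_smul_smul {d : ℕ} {F : Pair d} (hF : mixC F 0 ∈ V d) {P : ℂ[X]} {x y : ℂ}
    (h1 : polyOf F.1 = x • P) (h2 : polyOf F.2 = y • P) : d = 0 := by
  obtain ⟨u, hu⟩ := exists_bezout hF.1
  obtain ⟨i, hi, hi0⟩ := exists_natDegree_eq hF.2
  have hP : IsUnit P := by
    rw [Fin.sum_univ_four] at hu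
    simp only [mixC, Matrix.cons_val, h1, h2] at hu
    refine IsUnit.of_mul_eq_one (x • u 0 + y • u 2) ?_
    rw [← hu]
    simp [smul_eq_C_mul]
    ring
  have hP0 : P.natDegree = 0 := natDegree_eq_zero_of_isUnit hP
  rw [← hi]
  have hx : ∀ x : ℂ, (x • P).natDegree = 0 := fun x =>
    Nat.le_zero.mp ((natDegree_smul_le x P).trans hP0.le)
  fin_cases i
  · simpa [mixC, h1] using hx x
  · simp [mixC]
  · simpa [mixC, h2] using hx y
  · simp [mixC]

theorem smul_add_smul_eq_zero {d : ℕ} (hd : d ≠ 0) {F : Pair d} (hF : mixC F 0 ∈ V d) {x y : ℂ}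
    (h : x • F.1 + y • F.2 = 0) : x = 0 ∧ y = 0 := by
  have h' := congrArg polyOf h
  rw [map_add, map_smul, map_smul, map_zero] at h'
  by_contra hxy
  refine hd ?_
  by_cases hx : x = 0
  · have hy : y ≠ 0 := fun hy => hxy ⟨hx, hy⟩
    refine eq_zero_of_smul_smul hF (P := polyOf F.1) (x := 1) (y := 0) (by simp) ?_
    rw [hx, zero_smul, zero_add] at h'
    simpa [hy] using h'
  · refine eq_zero_of_smul_smul hF (P := polyOf F.2) (x := -(y / x)) (y := 1) ?_ (by simp)
    have := congrArg (x⁻¹ • ·) h'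
    simp only [smul_add, smul_smul, inv_mul_cancel₀ hx, one_smul, smul_zero] at this
    rw [eq_neg_of_add_eq_zero_left this, ← neg_smul]
    congr 1
    field_simp

theorem mem_trivialNormal_of_degree_zero {F : Pair 0} (hF : mixC F 0 ∈ V 0) (N : Pair 0) :
    N ∈ trivialNormal F := by
  rw [mem_trivialNormal]
  have hF0 : F.1 0 ≠ 0 ∨ F.2 0 ≠ 0 := by
    by_contra! h
    refine hF.2 ?_
    ext i
    fin_cases i <;> simp [topC, mixC, h]
  rcases hF0 with h | h
  · refine ⟨(N.1 0 - N.2 0 / F.1 0 * F.2 0) / F.1 0, 0, N.2 0 / F.1 0, ?_, ?_⟩ <;> ext k <;>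
      obtain rfl : k = 0 := Fin.fin_one_eq_zero k
    · simp; field_simp; ring
    · simp; field_simp
  · refine ⟨0, (N.2 0 - N.1 0 / F.2 0 * F.1 0) / F.2 0, N.1 0 / F.2 0, ?_, ?_⟩ <;> ext k <;>
      obtain rfl : k = 0 := Fin.fin_one_eq_zero k
    · simp; field_simp
    · simp; field_simp; ring

theorem linearIndependent_trivialNormal {d : ℕ} (hd : d ≠ 0) {F : Pair d} (hF : mixC F 0 ∈ V d) :
    LinearIndependent ℂ ![((F.1, 0) : Pair d), (0, F.2), (F.2, F.1)] := by
  rw [Fintype.linearIndependent_iff]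
  intro c hc
  rw [Fin.sum_univ_three] at hc
  have h1 := congrArg Prod.fst hc
  have h2 := congrArg Prod.snd hc
  simp at h1 h2
  obtain ⟨h3, h4⟩ := smul_add_smul_eq_zero hd hF h1
  obtain ⟨-, h5⟩ := smul_add_smul_eq_zero hd hF ((add_comm _ _).trans h2)
  intro i
  fin_cases i <;> assumption

theorem finrank_trivialNormal {d : ℕ} (hd : d ≠ 0) {F : Pair d} (hF : mixC F 0 ∈ V d) :
    Module.finrank ℂ (trivialNormal F) = 3 := by
  rw [trivialNormal, finrank_span_eq_card (linearIndependent_trivialNormal hd hF)]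
  simp

theorem trivialNormal_le_ker {d : ℕ} (F : Pair d) : trivialNormal F ≤ (wronV d F).ker :=
  fun _ h => LinearMap.mem_ker.mpr (wronV_eq_zero_iff.mpr (wron_of_mem_trivialNormal h))

theorem finrank_pair (d : ℕ) : Module.finrank ℂ (Pair d) = 2 * d + 2 := by
  simp; ring

/-- If there are no extra solutions, the linearized equation is surjective: the trivial solutions
form a space of dimension at most `3`, and `2 d + 2 = 3 + (2 d - 1)`. -/
theorem surjective_wronV {d : ℕ} {F : Pair d}
    (h : ∀ N, wron d F N = 0 → N ∈ trivialNormal F) : Function.Surjective (wronV d F) := by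
  rw [← LinearMap.range_eq_top]
  have h1 : (wronV d F).ker ≤ trivialNormal F := fun N hN =>
    h N (wronV_eq_zero_iff.mp (LinearMap.mem_ker.mp hN))
  have h2 : Module.finrank ℂ (wronV d F).ker ≤ 3 :=
    (Submodule.finrank_mono h1).trans ((finrank_range_le_card _).trans (by simp))
  have h3 := (wronV d F).finrank_range_add_finrank_ker
  have h4 := Submodule.finrank_le (wronV d F).range
  rw [finrank_pair] at h3
  refine Submodule.eq_top_of_finrank_eq ?_
  rw [Module.finrank_fin_fun] at h4 ⊢
  omega

/-- Surjectivity of a linear map that depends linearly on a parameter is an open condition. -/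
theorem eventually_surjective {E G H : Type*} [NormedAddCommGroup E] [NormedSpace ℂ E]
    [FiniteDimensional ℂ E] [AddCommGroup G] [Module ℂ G] [NormedAddCommGroup H]
    [NormedSpace ℂ H] [FiniteDimensional ℂ H] (L : E →ₗ[ℂ] G →ₗ[ℂ] H) {x : E}
    (hx : Function.Surjective (L x)) : ∀ᶠ y in 𝓝 x, Function.Surjective (L y) := by
  obtain ⟨S, hS⟩ := (L x).exists_rightInverse_of_surjective (LinearMap.range_eq_top.mpr hx)
  let Φ : E →ₗ[ℂ] (H →L[ℂ] H) := LinearMap.toContinuousLinearMap.toLinearMap ∘ₗ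
    (LinearMap.lcomp ℂ H S) ∘ₗ L
  have hΦ : Continuous Φ := Φ.continuous_of_finiteDimensional
  have h1 : IsUnit (Φ x) := by
    have : Φ x = 1 := by
      ext v
      exact congrArg (fun T : H →ₗ[ℂ] H => T v) hS
    rw [this]; exact isUnit_one
  filter_upwards [hΦ.continuousAt.eventually (Units.isOpen.mem_nhds h1)] with y hy
  obtain ⟨u, hu⟩ := hy
  intro v
  refine ⟨S ((↑u⁻¹ : H →L[ℂ] H) v), ?_⟩
  have h2 : Φ y ((↑u⁻¹ : H →L[ℂ] H) v) = v := by
    rw [← hu]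
    exact congrArg (fun T : H →L[ℂ] H => T v) u.mul_inv
  exact h2

/-- If there are no extra solutions for `F`, there are none for the pairs near `F`. -/
theorem eventually_mem_trivialNormal {d : ℕ} {F : Pair d}
    (h : ∀ N, wron d F N = 0 → N ∈ trivialNormal F) :
    ∀ᶠ F' in 𝓝 F, mixC F' 0 ∈ V d → ∀ N, wron d F' N = 0 → N ∈ trivialNormal F' := by
  filter_upwards [eventually_surjective (wronV d) (surjective_wronV h)] with F' hs hV N hN
  by_cases hd : d = 0
  · subst hd; exact mem_trivialNormal_of_degree_zero hV N
  · have h3 := (wronV d F').finrank_range_add_finrank_ker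
    rw [finrank_pair, LinearMap.range_eq_top.mpr hs, finrank_top, Module.finrank_fin_fun] at h3
    have h4 := finrank_trivialNormal hd hV
    rw [Submodule.eq_of_le_of_finrank_eq (trivialNormal_le_ker F') (by omega)]
    exact LinearMap.mem_ker.mpr (wronV_eq_zero_iff.mpr hN)

/-! ### Full and non-full horizontal maps near a line -/

theorem not_isFull_of_mem_trivialNormal {d : ℕ} {b : V d} {A : Matrix (Fin 4) (Fin 4) ℂ}
    (hA : A ∈ Sp2) (h : oddC (actC A b.1) ∈ trivialNormal (evenC (actC A b.1))) :
    ¬ IsFull (polyMap b) := by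
  obtain ⟨α, β, γ, h1, -⟩ := mem_trivialNormal.mp h
  rw [IsFull, not_not]
  refine ⟨(LinearMap.proj 1 - α • LinearMap.proj 0 - γ • LinearMap.proj 2) ∘ₗ A.mulVecLin,
    fun h0 => ?_, fun x W hW => ?_⟩
  · have := LinearMap.congr_fun h0 ((star A).mulVec (Pi.single 1 1))
    simp only [LinearMap.comp_apply, Matrix.mulVecLin_apply, Matrix.mulVec_mulVec,
      Matrix.mem_unitaryGroup_iff.mp hA.1, Matrix.one_mulVec] at this
    simp at this
  · obtain ⟨c, z, rfl⟩ := exists_chart x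
    rw [(isRep_polyMap b c z).submodule_eq, Submodule.mem_span_singleton] at hW
    obtain ⟨r, rfl⟩ := hW
    have g1 : flipC c (actC A b.1) 1 =
        α • flipC c (actC A b.1) 0 + γ • flipC c (actC A b.1) 2 := by ext k; exact congrFun h1 _
    simp only [LinearMap.comp_apply, Matrix.mulVecLin_apply, ← evalC_actC,
      ← flipC_actC, LinearMap.sub_apply, LinearMap.smul_apply, LinearMap.proj_apply,
      evalC_apply, g1, map_add, map_smul, eval_add, eval_smul, smul_eq_mul]
    ring

theorem trivial_of_relation_aux {d : ℕ} {F N : Pair d}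
    (hF : ∀ x y : ℂ, x • F.1 + y • F.2 = 0 → x = 0 ∧ y = 0) (hw : wron d F N = 0)
    {l : Fin 4 → ℂ} (hl1 : l 1 ≠ 0) (h : l 0 • F.1 + l 1 • N.1 + l 2 • F.2 + l 3 • N.2 = 0) :
    ∃ α β γ : ℂ, N.1 = α • F.1 + γ • F.2 ∧ N.2 = β • F.2 + γ • F.1 := by
  obtain ⟨α, c, e, h1⟩ : ∃ α c e : ℂ, N.1 = α • F.1 + c • F.2 + e • N.2 := by
    refine ⟨-(l 0 / l 1), -(l 2 / l 1), -(l 3 / l 1), smul_right_injective _ hl1 ?_⟩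
    simp only [smul_add, smul_smul]
    rw [mul_neg, mul_neg, mul_neg, mul_div_cancel₀ _ hl1, mul_div_cancel₀ _ hl1,
      mul_div_cancel₀ _ hl1]
    linear_combination (norm := module) h
  -- the equation becomes the vanishing of the Wronskian of `F₂ + e F₀` and `N₃ - c F₀`
  have hw2 : wronskian (polyOf (F.2 + e • F.1)) (polyOf (N.2 - c • F.1)) = 0 := by
    rw [← hw, wron_apply, h1]
    simp only [map_add, map_sub, map_smul, wronskian, smul_eq_C_mul, derivative_C_mul]
    ring
  have hne : polyOf (F.2 + e • F.1) ≠ 0 := fun h0 => by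
    have h2 := polyOf_injective (h0.trans (map_zero _).symm)
    have := (hF e 1 (by rw [one_smul]; exact (add_comm _ _).trans h2)).2
    exact one_ne_zero this
  obtain ⟨β, hβ⟩ := exists_eq_smul_of_wronskian_eq_zero hne hw2
  rw [← map_smul] at hβ
  have h2 : N.2 = c • F.1 + β • (F.2 + e • F.1) := by
    rw [← polyOf_injective hβ]; abel
  refine ⟨α + e * (c + β * e), β, c + β * e, ?_, ?_⟩
  · rw [h1, h2]; module
  · rw [h2]; module

theorem isFull_of_not_mem_trivialNormal {d : ℕ} {b : V d} {A : Matrix (Fin 4) (Fin 4) ℂ}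
    (hA : A ∈ Sp2) (hb : horizPoly b.1 = 0)
    (hF : ∀ x y : ℂ, x • (evenC (actC A b.1)).1 + y • (evenC (actC A b.1)).2 = 0 → x = 0 ∧ y = 0)
    (h : oddC (actC A b.1) ∉ trivialNormal (evenC (actC A b.1))) : IsFull (polyMap b) := by
  by_contra hN
  obtain ⟨l, hl0, hl⟩ := exists_relation_of_not_isFull hN
  refine h (mem_trivialNormal.mpr ?_)
  set b' := actC A b.1 with hb'
  have hw : wron d (evenC b') (oddC b') = 0 := by
    have := horizPoly_actC hA b.1
    rw [hb] at this
    exact this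
  set m : Fin 4 → ℂ := Matrix.vecMul l (star A) with hm
  have hm0 : m ≠ 0 := fun h0 => hl0 (by
    have := congrArg (fun v => Matrix.vecMul v A) h0
    simpa [hm, Matrix.mem_unitaryGroup_iff'.mp hA.1] using this)
  have hrel : ∑ j, m j • b' j = 0 := by
    rw [← actC_star_actC hA b.1, ← hb'] at hl
    rw [← hl]
    simp only [actC_apply, hm, Matrix.vecMul, dotProduct, Finset.sum_smul, Finset.smul_sum,
      smul_smul]
    exact Finset.sum_comm
  rw [Fin.sum_univ_four] at hrel
  by_cases h1 : m 1 = 0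
  · by_cases h3 : m 3 = 0
    · rw [h1, h3, zero_smul, zero_smul, add_zero, add_zero] at hrel
      obtain ⟨h0, h2⟩ := hF _ _ hrel
      exact absurd (by ext i; fin_cases i <;> assumption) hm0
    · obtain ⟨α, β, γ, e1, e2⟩ := trivial_of_relation_aux (F := (evenC b').swap)
        (N := (oddC b').swap) (l := ![m 2, m 3, m 0, m 1])
        (fun x y hxy => (hF y x ((add_comm _ _).trans hxy)).symm)
        (by rw [← hw, wron_apply, wron_apply, add_comm]; rfl) h3 (by
          rw [← hrel]
          simp [evenC_apply, oddC_apply]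
          abel)
      exact ⟨β, α, γ, e2, e1⟩
  · exact trivial_of_relation_aux hF hw h1 hrel

/-! ### Maps without extra solutions -/

theorem mixC_evenC_mem_V {d : ℕ} {a : V d} {A : Matrix (Fin 4) (Fin 4) ℂ} (hA : A ∈ Sp2)
    (ha : oddC (actC A a.1) = 0) : mixC (evenC (actC A a.1)) 0 ∈ V d := by
  rw [← ha, mixC_evenC_oddC]
  exact actC_mem_V hA a.2

theorem not_isCollapsePoint {d : ℕ} {a : V d} {A : Matrix (Fin 4) (Fin 4) ℂ} (hA : A ∈ Sp2)
    (ha : oddC (actC A a.1) = 0)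
    (h : ∀ N, wron d (evenC (actC A a.1)) N = 0 → N ∈ trivialNormal (evenC (actC A a.1))) :
    ¬ IsCollapsePoint (proj a) := by
  rintro ⟨hc, -⟩
  rw [mem_closure_iff_frequently] at hc
  refine hc ?_
  rw [eventually_nhds_proj]
  let Φ : Coef d →ₗ[ℂ] Pair d := evenC ∘ₗ actC A
  let Ψ : Pair d →ₗ[ℂ] Coef d :=
    { toFun := fun F => mixC F 0
      map_add' := fun F G => by funext i; fin_cases i <;> simp [mixC]
      map_smul' := fun c F => by funext i; fin_cases i <;> simp [mixC] }
  have hΦ : ContinuousAt Φ a.1 := Φ.continuous_of_finiteDimensional.continuousAt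
  have h1 := hΦ.eventually (eventually_mem_trivialNormal h)
  have h2 := ((Ψ ∘ₗ Φ).continuous_of_finiteDimensional.continuousAt (x := a.1)).eventually
    (isOpen_V.mem_nhds (mixC_evenC_mem_V hA ha))
  filter_upwards [h1, h2] with b h1 h2 hb hfull
  have hb0 := (proj_mem_HHol ⟨b, hb⟩).mp hfull.1
  refine not_isFull_of_mem_trivialNormal (b := ⟨b, hb⟩) hA (h1 h2 _ ?_) hfull.2
  have := horizPoly_actC hA b
  rw [show horizPoly b = 0 from hb0] at this
  exact this

/-- The coefficients of `horizPoly`, as a quadratic map. -/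
def horizV {d : ℕ} (a : Coef d) : Fin (2 * d - 1) → ℂ := wronV d (evenC a) (oddC a)

theorem horizV_eq_zero_iff {d : ℕ} {a : Coef d} : horizV a = 0 ↔ horizPoly a = 0 :=
  wronV_eq_zero_iff

theorem horizV_smul {d : ℕ} (c : ℂ) (a : Coef d) : horizV (c • a) = c ^ 2 • horizV a := by
  simp only [horizV, map_smul, LinearMap.smul_apply, smul_smul, pow_two]

theorem analyticAt_quadratic {E F G H : Type*} [NormedAddCommGroup E] [NormedSpace ℂ E]
    [FiniteDimensional ℂ E] [NormedAddCommGroup F] [NormedSpace ℂ F] [FiniteDimensional ℂ F]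
    [NormedAddCommGroup G] [NormedSpace ℂ G] [FiniteDimensional ℂ G]
    [NormedAddCommGroup H] [NormedSpace ℂ H] (L : F →ₗ[ℂ] G →ₗ[ℂ] H) (p : E →ₗ[ℂ] F)
    (q : E →ₗ[ℂ] G) (x : E) : AnalyticAt ℂ (fun y => L (p y) (q y)) x :=
  (L.toContinuousBilinearMap.analyticAt_bilinear (p x, q x)).comp_of_eq
    ((p.toContinuousLinearMap.analyticAt x).prod (q.toContinuousLinearMap.analyticAt x)) rfl

theorem analyticAt_horizV {d : ℕ} (a : Coef d) : AnalyticAt ℂ (horizV (d := d)) a :=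
  analyticAt_quadratic (wronV d) evenC oddC a

/-- A function that cuts out the horizontal maps near a map whose coefficient of index `(i, k)`
does not vanish: the equation, made homogeneous of degree `0`. -/
def defFun {d : ℕ} (i : Fin 4) (k : Fin (d + 1)) (h : Hol d) : Fin (2 * d - 1) → ℂ :=
  ((Classical.choose (exists_proj_eq h)).1 i k ^ 2)⁻¹ •
    horizV (Classical.choose (exists_proj_eq h)).1

theorem defFun_proj {d : ℕ} (i : Fin 4) (k : Fin (d + 1)) (b : V d) :
    defFun i k (proj b) = (b.1 i k ^ 2)⁻¹ • horizV b.1 := by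
  have h := Classical.choose_spec (exists_proj_eq (proj b))
  obtain ⟨c, hc, h⟩ := exists_eq_smul_of_polyMap_eq (congrArg Hol.toFun h).symm
  rw [defFun, h, horizV_smul, smul_smul]
  congr 1
  simp only [Pi.smul_apply, smul_eq_mul, mul_pow, mul_inv]
  rw [mul_right_comm, inv_mul_cancel₀ (pow_ne_zero 2 hc), one_mul]

theorem pullback_apply {d n : ℕ} (g : Hol d → Fin n → ℂ) {a : Coef d} (h : a ∈ V d) :
    pullback g a = g (proj ⟨a, h⟩) := dif_pos h

theorem isSmoothPoint_of_surjective {d : ℕ} {a : V d} (ha : horizPoly a.1 = 0)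
    (h : ∀ v : Fin (2 * d - 1) → ℂ, ∃ U : Coef d, ∀ k : Fin (2 * d - 1),
      (horizPolar a.1 U).coeff (k : ℕ) = v k) :
    IsSmoothPoint (HHol d) (proj a) := by
  obtain ⟨i, hi⟩ := Function.ne_iff.mp a.2.2
  set k : Fin (d + 1) := Fin.last d
  have hik : a.1 i k ≠ 0 := hi
  have hev : pullback (defFun i k) =ᶠ[𝓝 a.1] fun b => (b i k ^ 2)⁻¹ • horizV b := by
    filter_upwards [isOpen_V.mem_nhds a.2] with b hb
    rw [pullback_apply _ hb, defFun_proj]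
  have han : AnalyticAt ℂ (fun b : Coef d => (b i k ^ 2)⁻¹ • horizV b) a.1 := by
    have hc : AnalyticAt ℂ (fun b : Coef d => b i k) a.1 :=
      ((ContinuousLinearMap.proj k : (Fin (d + 1) → ℂ) →L[ℂ] ℂ).comp
        (ContinuousLinearMap.proj i : Coef d →L[ℂ] _)).analyticAt a.1
    exact ((hc.fun_pow 2).fun_inv (pow_ne_zero 2 hik)).fun_smul (analyticAt_horizV a.1)
  refine ⟨(proj_mem_HHol a).mpr ha, a, rfl, 2 * d - 1, defFun i k, han.congr hev.symm, ?_, ?_⟩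
  · rw [hev.fderiv_eq]
    intro v
    obtain ⟨U, hU⟩ := h (a.1 i k ^ 2 • v)
    refine ⟨U, ?_⟩
    -- the derivative in the direction of `U` is computed along a line
    have hline : HasDerivAt (fun t : ℂ => a.1 + t • U) U 0 := by
      simpa using ((hasDerivAt_id (0 : ℂ)).smul_const U).const_add a.1
    have h1 := HasFDerivAt.comp_hasDerivAt_of_eq (0 : ℂ) han.differentiableAt.hasFDerivAt hline
      (by simp)
    have h2 : ∀ t : ℂ, horizV (a.1 + t • U) =
        t • (a.1 i k ^ 2 • v) + t ^ 2 • horizV U := by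
      intro t
      ext m
      have := congrArg (coeff · (m : ℕ)) (horizPoly_add_smul a.1 U t)
      simp only [ha, coeff_add, coeff_smul, zero_add, hU] at this
      exact this
    have hcoord : HasDerivAt (fun t : ℂ => (((a.1 + t • U) i k) ^ 2)⁻¹)
        (deriv (fun t : ℂ => (((a.1 + t • U) i k) ^ 2)⁻¹) 0) 0 := by
      refine DifferentiableAt.hasDerivAt ?_
      refine DifferentiableAt.fun_inv (DifferentiableAt.fun_pow ?_ 2) (by simpa using hik)
      exact differentiableAt_pi.mp (differentiableAt_pi.mp hline.differentiableAt i) k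
    have h3 : HasDerivAt (fun t : ℂ => t • (a.1 i k ^ 2 • v) + t ^ 2 • horizV U)
        (a.1 i k ^ 2 • v) 0 := by
      have := ((hasDerivAt_id (0 : ℂ)).smul_const (a.1 i k ^ 2 • v)).add
        ((hasDerivAt_pow 2 (0 : ℂ)).smul_const (horizV U))
      exact this.congr_deriv (by simp)
    have h4 := hcoord.fun_smul h3
    have h5 : HasDerivAt (fun t : ℂ => (((a.1 + t • U) i k) ^ 2)⁻¹ • horizV (a.1 + t • U)) _ 0 :=
      h4.congr_of_eventuallyEq (Filter.Eventually.of_forall fun t => by simp only [h2])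
    rw [h1.unique h5]
    simp only [zero_smul, add_zero, ne_eq, OfNat.ofNat_ne_zero, not_false_eq_true, zero_pow,
      smul_zero]
    rw [smul_smul, inv_mul_cancel₀ (pow_ne_zero 2 hik), one_smul]
  · rw [eventually_nhds_proj]
    have hc : Continuous fun b : Coef d => b i k := by fun_prop
    filter_upwards [hc.continuousAt.eventually_ne hik] with b hb hbV
    rw [proj_mem_HHol, defFun_proj, smul_eq_zero_iff_right (inv_ne_zero (pow_ne_zero 2 hb)),
      horizV_eq_zero_iff]

theorem isSmoothPoint_of_no_extra {d : ℕ} {a : V d} {A : Matrix (Fin 4) (Fin 4) ℂ} (hA : A ∈ Sp2)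
    (ha : oddC (actC A a.1) = 0)
    (h : ∀ N, wron d (evenC (actC A a.1)) N = 0 → N ∈ trivialNormal (evenC (actC A a.1))) :
    IsSmoothPoint (HHol d) (proj a) := by
  refine isSmoothPoint_of_surjective ?_ fun v => ?_
  · rw [← horizPoly_actC hA, horizPoly, ha, map_zero]
  · obtain ⟨N, hN⟩ := surjective_wronV h v
    refine ⟨actC (star A) (mixC 0 N), fun k => ?_⟩
    rw [← horizPolar_actC hA, actC_actC_star hA, horizPolar, ha, map_zero, add_zero, oddC_mixC]
    exact congrFun hN k

/-! ### Obstructed directions -/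

/-- If the determinant of a family of endomorphisms, affine in a parameter, does not vanish
identically, then at every parameter there is a direction such that the determinant does not
vanish along the curves that leave in this direction. It is a direction at which the leading
homogeneous term of the determinant does not vanish. -/
theorem exists_direction_det_ne_zero {E Y : Type*} [NormedAddCommGroup E] [NormedSpace ℂ E]
    [FiniteDimensional ℂ E] [AddCommGroup Y] [Module ℂ Y] [FiniteDimensional ℂ Y]
    (K₀ : Y →ₗ[ℂ] Y) (K₁ : E →ₗ[ℂ] (Y →ₗ[ℂ] Y)) {G : E} (hG : (K₀ + K₁ G).det ≠ 0) (F : E) :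
    ∃ h : E, ∀ κ : ℝ → E, Filter.Tendsto κ (𝓝[≠] 0) (𝓝 h) →
      ∀ᶠ t : ℝ in 𝓝[≠] 0, (K₀ + K₁ (F + (t : ℂ) • κ t)).det ≠ 0 := by
  classical
  let b := Module.finBasis ℂ Y
  let entry : Fin (Module.finrank ℂ Y) → Fin (Module.finrank ℂ Y) → (Y →ₗ[ℂ] Y) →ₗ[ℂ] ℂ :=
    fun i j => b.coord i ∘ₗ LinearMap.applyₗ (b j)
  have hentry : ∀ (K : Y →ₗ[ℂ] Y) i j, LinearMap.toMatrix b b K i j = entry i j K := fun K i j => by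
    rw [LinearMap.toMatrix_apply]; rfl
  -- the determinant along `t ↦ F + t k`, as a polynomial in `t` with coefficients that are
  -- continuous functions of `k`
  let M : Matrix (Fin (Module.finrank ℂ Y)) (Fin (Module.finrank ℂ Y)) (Polynomial C(E, ℂ)) :=
    fun i j => C (ContinuousMap.const E (entry i j (K₀ + K₁ F))) +
      X * C ⟨fun k => entry i j (K₁ k), (entry i j ∘ₗ K₁).continuous_of_finiteDimensional⟩
  let ev : E → ℂ → (Polynomial C(E, ℂ) →+* ℂ) := fun k t =>
    eval₂RingHom (ContinuousMap.evalAlgHom ℂ ℂ k : C(E, ℂ) →+* ℂ) t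
  have hev : ∀ k t, ev k t M.det = (K₀ + K₁ (F + t • k)).det := by
    intro k t
    refine (RingHom.map_det (ev k t) M).trans ?_
    rw [← LinearMap.det_toMatrix b]
    congr 1
    ext i j
    rw [hentry, RingHom.mapMatrix_apply, Matrix.map_apply]
    simp only [M, ev, map_add, map_mul, coe_eval₂RingHom, eval₂_C, eval₂_X, map_smul]
    simp only [RingHom.coe_coe, ContinuousMap.evalAlgHom_apply, ContinuousMap.const_apply,
      ContinuousMap.coe_mk, smul_eq_mul]
    ring
  have hM : M.det ≠ 0 := by
    intro h0
    have := hev (G - F) 1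
    rw [h0, map_zero, one_smul, add_sub_cancel] at this
    exact hG this.symm
  obtain ⟨q, hq, hq0⟩ := exists_eq_pow_rootMultiplicity_mul_and_not_dvd M.det hM 0
  rw [C_0, sub_zero, X_dvd_iff] at hq0
  rw [C_0, sub_zero] at hq
  obtain ⟨h, hh⟩ : ∃ h, q.coeff 0 h ≠ 0 := by
    by_contra! h0
    exact hq0 (ContinuousMap.ext h0)
  refine ⟨h, fun κ hκ => ?_⟩
  have hcont : Continuous fun x : E × ℂ => ev x.1 x.2 q := by
    simp only [ev, coe_eval₂RingHom, eval₂_eq_sum_range]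
    refine continuous_finsetSum _ fun n _ => ?_
    exact ((q.coeff n).continuous.comp continuous_fst).mul (continuous_snd.pow n)
  have hev0 : ev h 0 q ≠ 0 := by
    have : ev h 0 q = q.coeff 0 h := by
      simp only [ev, coe_eval₂RingHom, eval₂_at_zero]
      rfl
    rwa [this]
  have hlim : Filter.Tendsto (fun t : ℝ => (κ t, (t : ℂ))) (𝓝[≠] 0) (𝓝 (h, 0)) :=
    hκ.prodMk_nhds ((Complex.continuous_ofReal.tendsto' 0 0 (by simp)).mono_left
      nhdsWithin_le_nhds)
  filter_upwards [hlim.eventually (hcont.continuousAt.eventually_ne hev0), self_mem_nhdsWithin]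
    with t ht ht0
  rw [← hev, hq, map_mul, map_pow]
  refine mul_ne_zero (pow_ne_zero _ ?_) ht
  have : ev (κ t) t X = (t : ℂ) := by simp [ev]
  rw [this]
  exact_mod_cast ht0

/-- Evaluation of coefficients that is injective on the solutions of the linearized equation at
the pair `(z ^ d, 1)`. -/
def probe (d : ℕ) : Pair d →ₗ[ℂ] (Fin 3 → ℂ) :=
  LinearMap.pi ![LinearMap.proj (Fin.last d) ∘ₗ LinearMap.fst ℂ _ _,
    LinearMap.proj 0 ∘ₗ LinearMap.snd ℂ _ _, LinearMap.proj 0 ∘ₗ LinearMap.fst ℂ _ _]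

theorem disjoint_ker_probe {d : ℕ} (hd : d ≠ 0) :
    ∃ G : Pair d, Disjoint (wronV d G).ker (probe d).ker := by
  obtain ⟨g1, hg1⟩ := exists_polyOf_eq (P := (X : ℂ[X]) ^ d) (d := d) (by simp)
  obtain ⟨g2, hg2⟩ := exists_polyOf_eq (P := (1 : ℂ[X])) (d := d) (by simp)
  refine ⟨(g1, g2), ?_⟩
  rw [Submodule.disjoint_def]
  intro N hN hT
  have hw : wron d (g1, g2) N = 0 := wronV_eq_zero_iff.mp (LinearMap.mem_ker.mp hN)
  have ht := LinearMap.mem_ker.mp hT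
  have t0 : N.1 (Fin.last d) = 0 := congrFun ht 0
  have t1 : N.2 0 = 0 := congrFun ht 1
  have t2 : N.1 0 = 0 := congrFun ht 2
  rw [← coeff_polyOf N.1] at t0 t2
  rw [← coeff_polyOf N.2] at t1
  rw [wron_apply, hg1, hg2] at hw
  set r := polyOf N.1
  set s := polyOf N.2
  have hs : s.natDegree ≤ d := natDegree_polyOf_le _
  have hr : r.natDegree ≤ d := natDegree_polyOf_le _
  have hX : X * derivative ((X : ℂ[X]) ^ d) = C (d : ℂ) * X ^ d := by
    ext n
    rw [coeff_X_mul_derivative, coeff_C_mul, coeff_X_pow]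
    split_ifs with h
    · rw [h]
    · simp
  have hXw : X ^ d * (X * derivative r) - C (d : ℂ) * (X ^ d * r) + X * derivative s = 0 := by
    have h1 : X * (wronskian (X ^ d) r + wronskian 1 s) = 0 := by rw [hw, mul_zero]
    rw [mul_add, X_mul_wronskian, X_mul_wronskian, hX] at h1
    rw [← h1]
    simp
    ring
  have hc : ∀ n, (if d ≤ n then ((n - d : ℕ) : ℂ) * r.coeff (n - d) else 0) -
      d * (if d ≤ n then r.coeff (n - d) else 0) + n * s.coeff n = 0 := by
    intro n
    have := congrArg (coeff · n) hXw
    simpa only [coeff_add, coeff_sub, coeff_C_mul, coeff_X_pow_mul', coeff_X_mul_derivative,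
      coeff_zero] using this
  have hs0 : ∀ n, s.coeff n = 0 := by
    intro n
    rcases Nat.eq_zero_or_pos n with rfl | hn
    · exact t1
    · rcases lt_trichotomy n d with h | h | h
      · have := hc n
        rw [if_neg (not_le.mpr h), if_neg (not_le.mpr h), mul_zero, sub_zero, zero_add] at this
        exact (mul_eq_zero.mp this).resolve_left (by exact_mod_cast hn.ne')
      · have := hc n
        have t2' : r.coeff 0 = 0 := t2
        rw [h] at this ⊢
        simp only [le_refl, if_true, Nat.sub_self, t2', mul_zero, sub_zero, zero_add] at this
        exact (mul_eq_zero.mp this).resolve_left (by exact_mod_cast hd)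
      · exact coeff_eq_zero_of_natDegree_lt (hs.trans_lt h)
  have hr0 : ∀ n, r.coeff n = 0 := by
    intro n
    rcases lt_trichotomy n d with h | h | h
    · have := hc (n + d)
      rw [hs0] at this
      simp only [le_add_iff_nonneg_left, zero_le, if_true, Nat.add_sub_cancel, mul_zero,
        add_zero] at this
      rw [← sub_mul] at this
      refine (mul_eq_zero.mp this).resolve_left (sub_ne_zero.mpr ?_)
      exact_mod_cast h.ne
    · rw [h]; exact t0
    · exact coeff_eq_zero_of_natDegree_lt (hr.trans_lt h)
  refine Prod.ext (polyOf_injective ?_) (polyOf_injective ?_)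
  · exact (Polynomial.ext hr0).trans (map_zero _).symm
  · exact (Polynomial.ext hs0).trans (map_zero _).symm

/-- From every pair there is a direction such that along the curves that leave in this direction
the linearized equation has only a three-dimensional space of solutions. -/
theorem exists_direction_disjoint {d : ℕ} (hd : d ≠ 0) (F : Pair d) :
    ∃ h : Pair d, ∀ κ : ℝ → Pair d, Filter.Tendsto κ (𝓝[≠] 0) (𝓝 h) →
      ∀ᶠ t : ℝ in 𝓝[≠] 0, Disjoint (wronV d (F + (t : ℂ) • κ t)).ker (probe d).ker := by
  obtain ⟨G, hG⟩ := disjoint_ker_probe hd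
  have hker : ((wronV d G).prod (probe d)).ker = ⊥ := by
    rw [LinearMap.ker_prod]; exact hG.eq_bot
  obtain ⟨S, hS⟩ := LinearMap.exists_leftInverse_of_injective _ hker
  let K₀ : Pair d →ₗ[ℂ] Pair d := S ∘ₗ LinearMap.inr ℂ _ _ ∘ₗ probe d
  let K₁ : Pair d →ₗ[ℂ] (Pair d →ₗ[ℂ] Pair d) := (wronV d).compr₂ (S ∘ₗ LinearMap.inl ℂ _ _)
  have hK : ∀ F N, (K₀ + K₁ F) N = S (wronV d F N, probe d N) := by
    intro F N
    change S (0, probe d N) + S (wronV d F N, 0) = _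
    rw [← map_add]
    simp
  have hG1 : K₀ + K₁ G = LinearMap.id := by
    refine LinearMap.ext fun N => ?_
    rw [hK]
    exact LinearMap.congr_fun hS N
  obtain ⟨h, hh⟩ := exists_direction_det_ne_zero K₀ K₁ (G := G) (by rw [hG1]; simp) F
  refine ⟨h, fun κ hκ => (hh κ hκ).mono fun t ht => ?_⟩
  rw [Submodule.disjoint_def]
  intro N h1 h2
  have h3 : (K₀ + K₁ (F + (t : ℂ) • κ t)).ker = ⊥ := by
    exact (LinearMap.isUnit_iff_ker_eq_bot _).mp
      ((LinearMap.isUnit_iff_isUnit_det _).mpr (isUnit_iff_ne_zero.mpr ht))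
  have h4 : N ∈ (K₀ + K₁ (F + (t : ℂ) • κ t)).ker := by
    rw [LinearMap.mem_ker, hK, LinearMap.mem_ker.mp h1, LinearMap.mem_ker.mp h2]
    exact map_zero S
  rwa [h3, Submodule.mem_bot] at h4

/-- Extra solutions do not extend along the curves that leave in a suitable direction: otherwise
they would persist, together with the three-dimensional space of trivial solutions. -/
theorem exists_obstructed_direction {d : ℕ} (hd : d ≠ 0) {F : Pair d} (hF : mixC F 0 ∈ V d) :
    ∃ h : Pair d, ∀ N ∉ trivialNormal F, ∀ γ ν : ℝ → Pair d, γ 0 = F → ν 0 = 0 →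
      HasDerivAt γ h 0 → HasDerivAt ν N 0 → ¬ ∀ᶠ t in 𝓝 0, wron d (γ t) (ν t) = 0 := by
  obtain ⟨h, hh⟩ := exists_direction_disjoint hd F
  refine ⟨h, fun N hN γ ν hγ0 hν0 hγ hν hw => ?_⟩
  have hγc : Filter.Tendsto γ (𝓝[≠] 0) (𝓝 F) := by
    rw [← hγ0]
    exact hγ.continuousAt.tendsto.mono_left nhdsWithin_le_nhds
  rw [hasDerivAt_iff_tendsto_slope_zero] at hγ hν
  simp only [zero_add, hγ0, hν0, sub_zero] at hγ hν
  have h1 := hh _ hγ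
  -- three trivial solutions and one extra solution, linearly independent for small `t`
  let w : Pair d → Pair d → Fin 4 → Pair d := fun G N => ![N, (G.1, 0), (0, G.2), (G.2, G.1)]
  have hw0 : LinearIndependent ℂ (w F N) :=
    linearIndependent_finCons.mpr ⟨linearIndependent_trivialNormal hd hF, hN⟩
  have hwc : Continuous fun x : Pair d × Pair d => w x.1 x.2 := by
    refine continuous_pi fun i => ?_
    fin_cases i
    · exact continuous_snd
    all_goals exact Continuous.prodMk (by fun_prop) (by fun_prop)
  have h2 := ((hwc.tendsto (F, N)).comp (hγc.prodMk_nhds hν)).eventually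
    (isOpen_setOfPred_linearIndependent.mem_nhds hw0)
  obtain ⟨t, ht1, ht2, ht3, ht0⟩ := (h1.and (h2.and
    ((hw.filter_mono nhdsWithin_le_nhds).and self_mem_nhdsWithin))).exists
  have ht0' : (t : ℂ) ≠ 0 := by exact_mod_cast ht0
  have hγt : F + (t : ℂ) • (t⁻¹ • (γ t - F)) = γ t := by
    have : (t : ℂ) • (t⁻¹ • (γ t - F)) = t • (t⁻¹ • (γ t - F)) := Complex.coe_smul _ _
    rw [this, smul_inv_smul₀ ht0, add_sub_cancel]
  rw [hγt] at ht1
  have ht2' : LinearIndependent ℂ (w (γ t) (t⁻¹ • ν t)) := ht2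
  have hspan : Submodule.span ℂ (Set.range (w (γ t) (t⁻¹ • ν t))) ≤ (wronV d (γ t)).ker := by
    rw [Submodule.span_le]
    rintro _ ⟨i, rfl⟩
    have htriv : ∀ j, (![((γ t).1, 0), (0, (γ t).2), ((γ t).2, (γ t).1)] : Fin 3 → Pair d) j ∈
        (wronV d (γ t)).ker := fun j =>
      trivialNormal_le_ker _ (Submodule.subset_span ⟨j, rfl⟩)
    refine Fin.cases ?_ (fun j => htriv j) i
    change t⁻¹ • ν t ∈ _
    have : t⁻¹ • ν t = ((t⁻¹ : ℝ) : ℂ) • ν t := (Complex.coe_smul _ _).symm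
    rw [this]
    exact Submodule.smul_mem _ _ (LinearMap.mem_ker.mpr (wronV_eq_zero_iff.mpr ht3))
  have h4 := (ht2'.map (ht1.mono_left hspan)).fintype_card_le_finrank
  simp at h4

/-! ### Coefficients of a smooth family of maps -/

/-- Evaluation at a point, as a linear map. -/
def evalL {d : ℕ} (z : ℂ) : Coef d →ₗ[ℂ] C4 where
  toFun a := evalC a z
  map_add' a b := evalC_add a b z
  map_smul' c a := evalC_smul c a z

/-- The exterior products of the values of a quadruplet at `0, 1, …, 2 d` with given vectors. -/
def wedgeL (d : ℕ) : (Fin (2 * d + 1) → C4) →ₗ[ℂ] Coef d →ₗ[ℂ]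
    (Fin (2 * d + 1) → Fin 4 → Fin 4 → ℂ) :=
  LinearMap.mk₂ ℂ
    (fun g b n i j => evalC b ((n : ℕ) : ℂ) i * g n j - evalC b ((n : ℕ) : ℂ) j * g n i)
    (fun g g' b => by ext n i j; simp only [Pi.add_apply]; ring)
    (fun c g b => by ext n i j; simp only [Pi.smul_apply, smul_eq_mul]; ring)
    (fun g b b' => by ext n i j; simp only [Pi.add_apply, evalC_add]; ring)
    (fun c g b => by ext n i j; simp only [Pi.smul_apply, smul_eq_mul, evalC_smul]; ring)

theorem wedgeL_apply {d : ℕ} (g : Fin (2 * d + 1) → C4) (b : Coef d) (n : Fin (2 * d + 1))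
    (i j : Fin 4) : wedgeL d g b n i j =
      evalC b ((n : ℕ) : ℂ) i * g n j - evalC b ((n : ℕ) : ℂ) j * g n i := rfl

theorem exists_eq_smul_of_wedgeL {d : ℕ} {a b : Coef d} (ha : a ∈ V d)
    {g : Fin (2 * d + 1) → C4} {r : Fin (2 * d + 1) → ℂ} (hr : ∀ n, r n ≠ 0)
    (hg : ∀ n, g n = r n • evalC a ((n : ℕ) : ℂ)) (h : wedgeL d g b = 0) : ∃ c : ℂ, b = c • a := by
  refine exists_eq_smul_of_proportional ha fun n i j => ?_
  have := congrFun (congrFun (congrFun h n) i) j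
  rw [wedgeL_apply, hg n] at this
  simp only [Pi.smul_apply, smul_eq_mul, Pi.zero_apply] at this
  refine mul_left_cancel₀ (hr n) ?_
  linear_combination -this

theorem wedgeL_eq_zero {d : ℕ} {b : Coef d} {g : Fin (2 * d + 1) → C4} {r : Fin (2 * d + 1) → ℂ}
    (hg : ∀ n, g n = r n • evalC b ((n : ℕ) : ℂ)) : wedgeL d g b = 0 := by
  ext n i j
  rw [wedgeL_apply, hg n]
  simp only [Pi.smul_apply, smul_eq_mul, Pi.zero_apply]
  ring

/-- A solution of a linear system depends differentiably on the coefficients of the system, if it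
is unique up to a scalar: near `g₀` all the solutions of `Θ g b = 0` are the multiples of a
differentiable function of `g`. -/
theorem exists_differentiable_solution {E B H : Type*} [NormedAddCommGroup E] [NormedSpace ℂ E]
    [FiniteDimensional ℂ E] [NormedAddCommGroup B] [NormedSpace ℂ B] [FiniteDimensional ℂ B]
    [AddCommGroup H] [Module ℂ H] (Θ : E →ₗ[ℂ] B →ₗ[ℂ] H) {g₀ : E} {a : B} (ha : a ≠ 0)
    (h0 : Θ g₀ a = 0) (h1 : ∀ b, Θ g₀ b = 0 → ∃ c : ℂ, b = c • a) :
    ∃ s : E → B, DifferentiableAt ℂ s g₀ ∧ s g₀ = a ∧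
      ∀ᶠ g in 𝓝 g₀, ∀ b, Θ g b = 0 → ∃ c : ℂ, b = c • s g := by
  obtain ⟨l, hl⟩ := Module.Projective.exists_dual_ne_zero ℂ ha
  obtain ⟨S, hS⟩ := LinearMap.exists_leftInverse_of_injective ((Θ g₀).prod l) (by
    rw [LinearMap.ker_eq_bot']
    intro b hb
    obtain ⟨c, rfl⟩ := h1 b (congrArg Prod.fst hb)
    have : l (c • a) = 0 := congrArg Prod.snd hb
    rw [map_smul, smul_eq_mul] at this
    rw [(mul_eq_zero.mp this).resolve_right hl, zero_smul])
  let K₀ : B →L[ℂ] B := (S ∘ₗ LinearMap.inr ℂ H ℂ ∘ₗ l).toContinuousLinearMap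
  let K₁ : E →ₗ[ℂ] (B →L[ℂ] B) := LinearMap.toContinuousLinearMap.toLinearMap ∘ₗ
    Θ.compr₂ (S ∘ₗ LinearMap.inl ℂ H ℂ)
  have hK : ∀ g b, (K₀ + K₁ g) b = S (Θ g b, l b) := by
    intro g b
    change S (0, l b) + S (Θ g b, 0) = _
    rw [← map_add]
    simp
  have hK0 : K₀ + K₁ g₀ = 1 := by
    ext1 b
    rw [hK]
    exact LinearMap.congr_fun hS b
  have hd : DifferentiableAt ℂ (fun g => K₀ + K₁ g) g₀ :=
    (K₁.toContinuousLinearMap.differentiableAt).const_add K₀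
  have hu0 : IsUnit (K₀ + K₁ g₀) := by rw [hK0]; exact isUnit_one
  refine ⟨fun g => Ring.inverse (K₀ + K₁ g) a, ?_, ?_, ?_⟩
  · exact (hd.inverse hu0).clm_apply (differentiableAt_const a)
  · simp only [hK0, Ring.inverse_one]; rfl
  · filter_upwards [hd.continuousAt.eventually (Units.isOpen.mem_nhds hu0)] with g hg b hb
    refine ⟨l b / l a, ?_⟩
    have e1 : S (0, l a) = a := by
      rw [← h0]
      exact LinearMap.congr_fun hS a
    have e2 : (K₀ + K₁ g) b = (l b / l a) • a := by
      calc (K₀ + K₁ g) b = S ((l b / l a) • (0, l a)) := by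
            rw [hK, hb, Prod.smul_mk, smul_zero, smul_eq_mul, div_mul_cancel₀ _ hl]
        _ = (l b / l a) • a := by rw [map_smul, e1]
    rw [← map_smul, ← e2]
    exact (congrArg (fun T : B →L[ℂ] B => T b) (Ring.inverse_mul_cancel _ hg)).symm

/-- A field tangent to a smooth family of horizontal maps is tangent to a differentiable curve of
quadruplets of polynomials that satisfy the horizontality equation. The polynomials are recovered
from the values of the maps at the points `0, 1, …, 2 d`. -/
theorem IsPolyField.exists_curve {d : ℕ} {a : V d} {U : Coef d} {u : VectorField (polyMap a)}
    (hu : IsPolyField a U u) (h : IsIntegrable (proj a) u) :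
    ∃ γ : ℝ → Coef d, γ 0 = a.1 ∧ HasDerivAt γ U 0 ∧ ∀ᶠ t in 𝓝 0, horizPoly (γ t) = 0 := by
  obtain ⟨φ, ε, ⟨hε, hφ0, hL⟩, hT, hH⟩ := h
  change φ 0 = polyMap a at hφ0
  change IsTangentTo (polyMap a) u φ at hT
  choose F hF using fun n : Fin (2 * d + 1) => hL 0 (by simpa using hε) false ((n : ℕ) : ℂ)
  let G : ℝ → Fin (2 * d + 1) → C4 := fun t n => F n (t, ((n : ℕ) : ℂ))
  have hGd : DifferentiableAt ℝ G 0 := differentiableAt_pi.mpr fun n => (hF n).differentiableAt_left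
  have hGr : ∀ᶠ t in 𝓝 0, ∀ n : Fin (2 * d + 1), IsRep (φ t (chart false ((n : ℕ) : ℂ))) (G t n) :=
    Filter.eventually_all.mpr fun n => (hF n).eventually_left
  have hrs : ∀ n : Fin (2 * d + 1), ∃ r s : ℂ, G 0 n = r • evalC a.1 ((n : ℕ) : ℂ) ∧
      deriv G 0 n = r • evalC U ((n : ℕ) : ℂ) + s • evalC a.1 ((n : ℕ) : ℂ) := by
    intro n
    obtain ⟨r, s, h1, h2⟩ := hu.exists_eq (hT false ((n : ℕ) : ℂ) (F n) (hF n))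
    refine ⟨r, s, h1, ?_⟩
    rw [deriv_pi fun n => (differentiableAt_pi.mp hGd n)]
    exact h2
  choose r s hr hs using hrs
  have hr0 : ∀ n, r n ≠ 0 := fun n h0 => (hGr.self_of_nhds n).ne_zero (by rw [hr, h0, zero_smul])
  have ha0 : a.1 ≠ 0 := fun h0 => a.2.2 (by rw [h0]; rfl)
  obtain ⟨σ, hσd, hσ0, hσ⟩ := exists_differentiable_solution (wedgeL d) ha0 (wedgeL_eq_zero hr)
    fun b hb => exists_eq_smul_of_wedgeL a.2 hr0 hr hb
  have hσG : DifferentiableAt ℝ (fun t => σ (G t)) 0 :=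
    (hσd.restrictScalars ℝ).comp (0 : ℝ) hGd
  have hcurve : ∀ᶠ t in 𝓝 0, wedgeL d (G t) (σ (G t)) = 0 ∧ horizPoly (σ (G t)) = 0 := by
    have hsmall : ∀ᶠ t : ℝ in 𝓝 0, |t| < ε := by
      filter_upwards [Metric.ball_mem_nhds (0 : ℝ) hε] with t ht
      simpa using ht
    filter_upwards [hGd.continuousAt.eventually hσ, hGr, hsmall] with t h1 h2 h3
    obtain ⟨g, hg, hgφ⟩ := hH t h3
    obtain ⟨P, rfl⟩ := exists_proj_eq g
    have hP0 := (proj_mem_HHol P).mp hg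
    choose k hk0 hk using fun n : Fin (2 * d + 1) =>
      (show IsRep (φ t (chart false ((n : ℕ) : ℂ))) _ by
        rw [← hgφ]; exact isRep_polyMap P false ((n : ℕ) : ℂ)).exists_smul (h2 n)
    have hW := wedgeL_eq_zero hk
    obtain ⟨c, hc⟩ := h1 P.1 hW
    have hc0 : c ≠ 0 := by
      rintro rfl
      exact P.2.2 (by rw [hc, zero_smul]; rfl)
    simp only [flipC_false] at hW
    rw [hc, map_smul, smul_eq_zero_iff_right hc0] at hW
    rw [hc, horizPoly_smul, smul_eq_zero_iff_right (pow_ne_zero 2 hc0)] at hP0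
    exact ⟨hW, hP0⟩
  -- the derivative of the equation `wedgeL d (G t) (σ (G t)) = 0`
  set D := deriv (fun t => σ (G t)) 0 with hD
  have hDd : HasDerivAt (fun t => σ (G t)) D 0 := hσG.hasDerivAt
  have hwD : wedgeL d (G 0) (D - U) = 0 := by
    ext n i j
    have e1 : HasDerivAt (fun t => evalC (σ (G t)) ((n : ℕ) : ℂ)) (evalC D ((n : ℕ) : ℂ)) 0 :=
      (((evalL (d := d) ((n : ℕ) : ℂ)).toContinuousLinearMap.restrictScalars
        ℝ).hasFDerivAt.comp_hasDerivAt (0 : ℝ) hDd)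
    have e2 := hasDerivAt_pi.mp hGd.hasDerivAt n
    rw [hasDerivAt_pi] at e1 e2
    have e3 := ((e1 i).mul (e2 j)).sub ((e1 j).mul (e2 i))
    have e4 : HasDerivAt (fun _ : ℝ => (0 : ℂ)) _ 0 := e3.congr_of_eventuallyEq (by
      filter_upwards [hcurve] with t ht
      exact (congrFun (congrFun (congrFun ht.1 n) i) j).symm)
    have e5 := (hasDerivAt_const (0 : ℝ) (0 : ℂ)).unique e4
    rw [hσ0, hs n, hr n] at e5
    rw [wedgeL_apply, hr n]
    have e6 : evalC (D - U) ((n : ℕ) : ℂ) = evalC D ((n : ℕ) : ℂ) - evalC U ((n : ℕ) : ℂ) :=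
      (evalL ((n : ℕ) : ℂ)).map_sub D U
    rw [e6]
    simp only [Pi.smul_apply, Pi.add_apply, Pi.sub_apply, smul_eq_mul, Pi.zero_apply] at e5 ⊢
    linear_combination -e5
  obtain ⟨c, hc⟩ := exists_eq_smul_of_wedgeL a.2 hr0 hr hwD
  refine ⟨fun t => (1 - (t : ℂ) * c) • σ (G t), by simp [hσ0], ?_, ?_⟩
  · have e1 : HasDerivAt (fun t : ℝ => 1 - (t : ℂ) * c) (-c) 0 := by
      have := ((Complex.ofRealCLM.hasDerivAt (x := (0 : ℝ))).mul_const c).const_sub 1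
      exact this.congr_deriv (by simp)
    refine (e1.smul hDd).congr_deriv ?_
    rw [hσ0, eq_add_of_sub_eq hc]
    simp
  · filter_upwards [hcurve] with t ht
    rw [horizPoly_smul, ht.2, smul_zero]

/-! ### Consequences of the existence of an extra deformation -/

/-- An extra deformation of a map provides, in normal form, an extra solution of the linearized
equation. -/
theorem IsExtraIHHD.exists_solution {d : ℕ} {a : V d} {u : VectorField (polyMap a)}
    (h : IsExtraIHHD (proj a) u) : ∃ A ∈ Sp2, oddC (actC A a.1) = 0 ∧
      ∃ N, wron d (evenC (actC A a.1)) N = 0 ∧ N ∉ trivialNormal (evenC (actC A a.1)) := by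
  obtain ⟨⟨hH, hhol, hinf⟩, A, hA, hz, hE⟩ := h
  have ha := (proj_mem_HHol a).mp hH
  have hA0 := oddC_actC_eq_zero_iff.mp hz
  obtain ⟨U, hU⟩ := exists_isPolyField_eq hhol hA hA0
  refine ⟨A, hA, hA0, oddC (actC A U), ?_, fun h => hE ((hU.normal_iff hA0).mpr h)⟩
  have := hU.horizPolar_eq_zero ha hinf
  rw [← horizPolar_actC hA, horizPolar, hA0, map_zero, add_zero] at this
  exact this

theorem horizPoly_eq_zero_of_oddC {d : ℕ} {a : Coef d} {A : Matrix (Fin 4) (Fin 4) ℂ}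
    (hA : A ∈ Sp2) (ha : oddC (actC A a) = 0) : horizPoly a = 0 := by
  rw [← horizPoly_actC hA, horizPoly, ha, map_zero]

theorem horizPolar_eq_zero_of_wron {d : ℕ} {a U : Coef d} {A : Matrix (Fin 4) (Fin 4) ℂ}
    (hA : A ∈ Sp2) (ha : oddC (actC A a) = 0)
    (hU : wron d (evenC (actC A a)) (oddC (actC A U)) = 0) : horizPolar a U = 0 := by
  rw [← horizPolar_actC hA, horizPolar, ha, map_zero, add_zero, hU]

theorem IsPolyField.isExtraIHHD {d : ℕ} {a : V d} {U : Coef d} {u : VectorField (polyMap a)}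
    (hu : IsPolyField a U u) {A : Matrix (Fin 4) (Fin 4) ℂ} (hA : A ∈ Sp2)
    (ha : oddC (actC A a.1) = 0)
    (hU : wron d (evenC (actC A a.1)) (oddC (actC A U)) = 0)
    (hN : oddC (actC A U) ∉ trivialNormal (evenC (actC A a.1))) : IsExtraIHHD (proj a) u := by
  have ha0 := horizPoly_eq_zero_of_oddC hA ha
  exact ⟨⟨(proj_mem_HHol a).mpr ha0, hu.isHolomorphicField,
    hu.isInfHorizontal ha0 (horizPolar_eq_zero_of_wron hA ha hU)⟩,
    hu.isExtra_iff.mpr ⟨A, hA, ha, hN⟩⟩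

theorem horizPoly_add_smul_mixC {d : ℕ} {a : Coef d} {A : Matrix (Fin 4) (Fin 4) ℂ}
    (hA : A ∈ Sp2) (ha : oddC (actC A a) = 0) {N : Pair d}
    (hN : wron d (evenC (actC A a)) N = 0) (t : ℂ) :
    horizPoly (a + t • actC (star A) (mixC 0 N)) = 0 := by
  have hAb : actC A (a + t • actC (star A) (mixC 0 N)) = actC A a + t • mixC 0 N := by
    rw [map_add, map_smul, actC_actC_star hA]
  have he : evenC (actC A a + t • mixC 0 N) = evenC (actC A a) := by
    rw [map_add, map_smul, evenC_mixC, smul_zero, add_zero]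
  have ho : oddC (actC A a + t • mixC 0 N) = t • N := by
    rw [map_add, map_smul, oddC_mixC, ha, zero_add]
  rw [← horizPoly_actC hA, horizPoly, hAb, he, ho, map_smul, hN, smul_zero]

/-- The equation is linear in the components of odd index, so that extra solutions are tangent to
linear families of horizontal maps. -/
theorem exists_integrable_extra {d : ℕ} {a : V d} {A : Matrix (Fin 4) (Fin 4) ℂ} (hA : A ∈ Sp2)
    (ha : oddC (actC A a.1) = 0) {N : Pair d} (hw : wron d (evenC (actC A a.1)) N = 0)
    (hN : N ∉ trivialNormal (evenC (actC A a.1))) :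
    ∃ u : VectorField (polyMap a), IsExtraIHHD (proj a) u ∧ IsIntegrable (proj a) u := by
  set U := actC (star A) (mixC 0 N) with hU
  have hAU : oddC (actC A U) = N := by rw [hU, actC_actC_star hA, oddC_mixC]
  obtain ⟨u, hu⟩ := exists_isPolyField a U
  refine ⟨u, hu.isExtraIHHD hA ha (by rw [hAU, hw]) (by rwa [hAU]), ?_⟩
  obtain ⟨ε, hε, hV⟩ := exists_isVariation_lineVar a U
  refine ⟨lineVar a U, ε, hε, hu.isTangentTo_lineVar, fun t ht => ?_⟩
  refine ⟨proj ⟨_, hV t ht⟩, (proj_mem_HHol _).mpr ?_, (lineVar_eq (hV t ht)).symm⟩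
  exact horizPoly_add_smul_mixC hA ha hw t

theorem isCollapsePoint_of_extra {d : ℕ} {a : V d} {A : Matrix (Fin 4) (Fin 4) ℂ} (hA : A ∈ Sp2)
    (ha : oddC (actC A a.1) = 0) {N : Pair d} (hw : wron d (evenC (actC A a.1)) N = 0)
    (hN : N ∉ trivialNormal (evenC (actC A a.1))) (hnon : proj a ∈ HHolNon d) :
    IsCollapsePoint (proj a) := by
  refine ⟨?_, hnon⟩
  have hFV := mixC_evenC_mem_V hA ha
  have hd : d ≠ 0 := by
    rintro rfl
    exact hN (mem_trivialNormal_of_degree_zero hFV N)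
  set U := actC (star A) (mixC 0 N) with hU
  rw [mem_closure_iff_frequently]
  intro hev
  rw [eventually_nhds_proj] at hev
  have hc : ContinuousAt (fun t : ℝ => a.1 + (t : ℂ) • U) 0 := by fun_prop
  have h1 := hc.eventually (by simpa using hev)
  obtain ⟨t, ⟨h1, h2⟩, ht0⟩ := (((h1.and (eventually_mem_V a U)).filter_mono
    (nhdsWithin_le_nhds (s := {0}ᶜ))).and self_mem_nhdsWithin).exists
  have ht0' : (t : ℂ) ≠ 0 := by exact_mod_cast ht0
  refine h1 h2 ⟨(proj_mem_HHol _).mpr (horizPoly_add_smul_mixC hA ha hw t), ?_⟩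
  have hAb : actC A (a.1 + (t : ℂ) • U) = actC A a.1 + (t : ℂ) • mixC 0 N := by
    rw [map_add, map_smul, hU, actC_actC_star hA]
  have he : evenC (actC A (a.1 + (t : ℂ) • U)) = evenC (actC A a.1) := by
    rw [hAb, map_add, map_smul, evenC_mixC, smul_zero, add_zero]
  have ho : oddC (actC A (a.1 + (t : ℂ) • U)) = (t : ℂ) • N := by
    rw [hAb, map_add, map_smul, oddC_mixC, ha, zero_add]
  refine isFull_of_not_mem_trivialNormal (b := ⟨_, h2⟩) hA
    (horizPoly_add_smul_mixC hA ha hw t) ?_ ?_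
  · rw [he]
    exact fun x y hxy => smul_add_smul_eq_zero hd hFV hxy
  · rw [he, ho]
    exact fun h => hN ((Submodule.smul_mem_iff _ ht0').mp h)

/-- No curve of horizontal maps leaves in a suitable direction that extends an extra solution. -/
theorem exists_obstructed {d : ℕ} {a : V d} {A : Matrix (Fin 4) (Fin 4) ℂ} (hA : A ∈ Sp2)
    (ha : oddC (actC A a.1) = 0) {N : Pair d} (hN : N ∉ trivialNormal (evenC (actC A a.1))) :
    ∃ E : Pair d, ∀ γ : ℝ → Coef d, γ 0 = a.1 → HasDerivAt γ (actC (star A) (mixC E N)) 0 →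
      ¬ ∀ᶠ t in 𝓝 0, horizPoly (γ t) = 0 := by
  have hFV := mixC_evenC_mem_V hA ha
  have hd : d ≠ 0 := by
    rintro rfl
    exact hN (mem_trivialNormal_of_degree_zero hFV N)
  obtain ⟨E, hE⟩ := exists_obstructed_direction hd hFV
  refine ⟨E, fun γ hγ0 hγ hev => ?_⟩
  have hlin : ∀ (L : Coef d →ₗ[ℂ] Pair d),
      HasDerivAt (fun t => L (γ t)) (L (actC (star A) (mixC E N))) 0 := fun L =>
    (L.toContinuousLinearMap.restrictScalars ℝ).hasFDerivAt.comp_hasDerivAt (0 : ℝ) hγ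
  refine hE N hN (fun t => evenC (actC A (γ t))) (fun t => oddC (actC A (γ t)))
    (by simp only [hγ0]) (by simp only [hγ0, ha]) ?_ ?_ ?_
  · have := hlin (evenC ∘ₗ actC A)
    simp only [LinearMap.comp_apply, actC_actC_star hA, evenC_mixC] at this
    exact this
  · have := hlin (oddC ∘ₗ actC A)
    simp only [LinearMap.comp_apply, actC_actC_star hA, oddC_mixC] at this
    exact this
  · filter_upwards [hev] with t ht
    rw [← horizPoly_actC hA] at ht
    exact ht

theorem exists_nonintegrable_extra {d : ℕ} {a : V d} {A : Matrix (Fin 4) (Fin 4) ℂ} (hA : A ∈ Sp2)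
    (ha : oddC (actC A a.1) = 0) {N : Pair d} (hw : wron d (evenC (actC A a.1)) N = 0)
    (hN : N ∉ trivialNormal (evenC (actC A a.1))) :
    ∃ u : VectorField (polyMap a), IsExtraIHHD (proj a) u ∧ ¬ IsIntegrable (proj a) u := by
  obtain ⟨E, hE⟩ := exists_obstructed hA ha hN
  set U := actC (star A) (mixC E N) with hU
  have hAU : oddC (actC A U) = N := by rw [hU, actC_actC_star hA, oddC_mixC]
  obtain ⟨u, hu⟩ := exists_isPolyField a U
  refine ⟨u, hu.isExtraIHHD hA ha (by rw [hAU, hw]) (by rwa [hAU]), fun hint => ?_⟩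
  obtain ⟨γ, h0, h1, h2⟩ := hu.exists_curve hint
  exact hE γ h0 h1 h2

/-- Every tangent vector of the zero set of a submersion is the velocity of a curve in it. -/
theorem exists_curve_of_mem_ker {B : Type*} [NormedAddCommGroup B] [NormedSpace ℂ B]
    [NormedSpace ℝ B] [IsScalarTower ℝ ℂ B] [CompleteSpace B] {n : ℕ} {g : B → Fin n → ℂ} {b : B}
    (hg : AnalyticAt ℂ g b) (hs : Function.Surjective (fderiv ℂ g b)) (h0 : g b = 0) {U : B}
    (hU : fderiv ℂ g b U = 0) :
    ∃ γ : ℝ → B, γ 0 = b ∧ HasDerivAt γ U 0 ∧ ∀ᶠ t in 𝓝 0, g (γ t) = 0 := by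
  have hst : HasStrictFDerivAt g (fderiv ℂ g b) b := hg.hasStrictFDerivAt
  have hr : (fderiv ℂ g b).range = ⊤ := LinearMap.range_eq_top.mpr hs
  let v : (fderiv ℂ g b).ker := ⟨U, LinearMap.mem_ker.mpr hU⟩
  let line : ℂ → (fderiv ℂ g b).ker := fun t => t • v
  have hline : HasDerivAt line v 0 := by
    simpa [line] using (hasDerivAt_id (0 : ℂ)).smul_const v
  have hline0 : line 0 = 0 := zero_smul ℂ v
  have hγ : HasDerivAt (fun t : ℂ => hst.implicitFunction g _ hr (g b) (line t)) U 0 :=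
    HasFDerivAt.comp_hasDerivAt_of_eq (0 : ℂ) (hst.to_implicitFunction hr).hasFDerivAt hline
      hline0.symm
  refine ⟨fun t => hst.implicitFunction g _ hr (g b) (line (t : ℂ)), ?_, ?_, ?_⟩
  · simp only [Complex.ofReal_zero, hline0]
    exact hst.implicitFunction_apply_image hr
  · have := (hγ.hasFDerivAt.restrictScalars ℝ).comp_hasDerivAt_of_eq (0 : ℝ)
      Complex.ofRealCLM.hasDerivAt (by simp)
    exact this.congr_deriv (by simp)
  · have hc : Filter.Tendsto (fun t : ℝ => (g b, line (t : ℂ))) (𝓝 0) (𝓝 (g b, 0)) := by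
      refine tendsto_const_nhds.prodMk_nhds ?_
      have h1 : ContinuousAt (fun t : ℝ => line (t : ℂ)) 0 :=
        ContinuousAt.comp_of_eq hline.continuousAt Complex.continuous_ofReal.continuousAt (by simp)
      have := h1.tendsto
      simpa only [Complex.ofReal_zero, hline0] using this
    filter_upwards [hc.eventually (hst.map_implicitFunction_eq hr)] with t ht
    rw [ht, h0]

/-- At a smooth point every infinitesimal horizontal deformation would be tangent to a curve of
horizontal maps: the tangential and the normal deformations are, and those of a submanifold form
a linear space. -/
theorem not_isSmoothPoint_of_extra {d : ℕ} {f : Hol d} {u : VectorField f.toFun}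
    (hu : IsExtraIHHD f u) : ¬ IsSmoothPoint (HHol d) f := by
  rintro ⟨hfS, a, rfl, n, g, hg, hs, hev⟩
  obtain ⟨A, hA, ha, N, hw, hN⟩ := IsExtraIHHD.exists_solution hu
  obtain ⟨E, hE⟩ := exists_obstructed hA ha hN
  have hev' : ∀ᶠ b in 𝓝 a.1, horizPoly b = 0 ↔ pullback g b = 0 := by
    rw [eventually_nhds_proj] at hev
    filter_upwards [hev, isOpen_V.mem_nhds a.2] with b hb hV
    rw [pullback_apply g hV, ← hb hV, proj_mem_HHol]
  have h0 : pullback g a.1 = 0 := hev'.self_of_nhds.mp ((proj_mem_HHol a).mp hfS)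
  have hker : ∀ U : Coef d, (∀ t : ℂ, horizPoly (a.1 + t • U) = 0) →
      fderiv ℂ (pullback g) a.1 U = 0 := by
    intro U hU
    have hline : HasDerivAt (fun t : ℂ => a.1 + t • U) U 0 := by
      simpa using ((hasDerivAt_id (0 : ℂ)).smul_const U).const_add a.1
    have h1 : HasDerivAt (pullback g ∘ fun t : ℂ => a.1 + t • U) _ 0 :=
      HasFDerivAt.comp_hasDerivAt_of_eq (0 : ℂ) hg.differentiableAt.hasFDerivAt hline (by simp)
    have h2 : HasDerivAt (pullback g ∘ fun t : ℂ => a.1 + t • U) 0 0 := by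
      refine (hasDerivAt_const (0 : ℂ) (0 : Fin n → ℂ)).congr_of_eventuallyEq ?_
      have hc := hline.continuousAt.eventually (by simpa using hev')
      filter_upwards [hc] with t ht using ht.mp (hU t)
    exact h1.unique h2
  have hU1 := hker (actC (star A) (mixC 0 N)) (horizPoly_add_smul_mixC hA ha hw)
  have hU2 := hker (actC (star A) (mixC E 0)) fun t => by
    refine horizPoly_eq_zero_of_oddC hA ?_
    rw [map_add, map_smul, actC_actC_star hA, map_add, map_smul, ha, oddC_mixC, smul_zero,
      add_zero]
  have hsum : mixC E N = mixC 0 N + mixC E 0 := by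
    funext i
    fin_cases i <;> simp [mixC]
  obtain ⟨γ, hγ0, hγ, hγg⟩ := exists_curve_of_mem_ker hg hs h0
    (U := actC (star A) (mixC E N)) (by rw [hsum, map_add, map_add, hU1, hU2, add_zero])
  refine hE γ hγ0 hγ ?_
  have hc := hγ.continuousAt.eventually (by rw [hγ0]; exact hev')
  filter_upwards [hc, hγg] with t h1 h2 using h1.mpr h2

end Twistor

end

theorem proposition3p5 (d : ℕ) (f : Twistor.Hol d) (hf : f ∈ Twistor.HHolNon d) :
    List.TFAE
      [¬ Twistor.IsSmoothPoint (Twistor.HHol d) f,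
       Twistor.IsCollapsePoint f,
       ∃ u : Twistor.VectorField f.toFun, Twistor.IsExtraIHHD f u,
       ∃ u : Twistor.VectorField f.toFun, Twistor.IsExtraIHHD f u ∧ ¬ Twistor.IsIntegrable f u,
       ∃ u : Twistor.VectorField f.toFun, Twistor.IsExtraIHHD f u ∧ Twistor.IsIntegrable f u] := by
  open Twistor in
  obtain ⟨a, rfl⟩ := exists_proj_eq f
  -- without extra deformations, the linearized equation has only trivial solutions
  have key : (¬ ∃ u : VectorField (proj a).toFun, IsExtraIHHD (proj a) u) →
      ∃ A ∈ Sp2, oddC (actC A a.1) = 0 ∧ ∀ N, wron d (evenC (actC A a.1)) N = 0 →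
        N ∈ trivialNormal (evenC (actC A a.1)) := by
    intro h
    obtain ⟨A, hA, ha⟩ := exists_normal_form ((proj_mem_HHol a).mp hf.1) hf.2
    refine ⟨A, hA, ha, fun N hN => ?_⟩
    by_contra hne
    obtain ⟨u, hu, -⟩ := exists_integrable_extra hA ha hN hne
    exact h ⟨u, hu⟩
  tfae_have 1 → 3 := fun h => by
    by_contra h3
    obtain ⟨A, hA, ha, hN⟩ := key h3
    exact h (isSmoothPoint_of_no_extra hA ha hN)
  tfae_have 2 → 3 := fun h => by
    by_contra h3
    obtain ⟨A, hA, ha, hN⟩ := key h3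
    exact not_isCollapsePoint hA ha hN h
  tfae_have 3 → 1 := fun ⟨u, hu⟩ => not_isSmoothPoint_of_extra hu
  tfae_have 3 → 2 := fun ⟨u, hu⟩ => by
    obtain ⟨A, hA, ha, N, hw, hN⟩ := IsExtraIHHD.exists_solution hu
    exact isCollapsePoint_of_extra hA ha hw hN hf
  tfae_have 3 → 4 := fun ⟨u, hu⟩ => by
    obtain ⟨A, hA, ha, N, hw, hN⟩ := IsExtraIHHD.exists_solution hu
    exact exists_nonintegrable_extra hA ha hw hN
  tfae_have 3 → 5 := fun ⟨u, hu⟩ => by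
    obtain ⟨A, hA, ha, N, hw, hN⟩ := IsExtraIHHD.exists_solution hu
    exact exists_integrable_extra hA ha hw hN
  tfae_have 4 → 3 := fun ⟨u, hu, _⟩ => ⟨u, hu⟩
  tfae_have 5 → 3 := fun ⟨u, hu, _⟩ => ⟨u, hu⟩
  tfae_finish
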